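/- **Setting.** Write $|\cdot|$ for the Euclidean norm. Atomic gates are arbitrary one-qubit unitaries and CNOT gates; a circuit implements an operation on its main qubits if it does so with work qubits that start and end in $|0\dots0\rangle$. For a matrix $\Pi\in\mathbb C^{N\times 2^m}$ with orthonormal rows, the $\mathrm C_\Pi\mathrm{NOT}$ gate is the operation $\Pi^\dagger\Pi\otimes X+(\mathrm{Id}-\Pi^\dagger\Pi)\otimes\mathrm{Id}_2$ on $m+1$ qubits. *Block encodings.* A block encoding $B=(U,\Pi,\langle0|,\gamma)$ of a vector $v\in\mathbb C^N$ up to relative tolerance $\varepsilon\ge0$ consists of a circuit for a unitary $U$ on $m$ qubits, a matrix $\Pi\in\mathbb C^{N\times 2^m}$ with orthonormal rows, circuits for the gates $\mathrm C_\Pi\mathrm{NOT}$ and $\mathrm C_{\langle0|}\mathrm{NOT}$, and a number $\gamma\ge|v|$ such that $|\gamma\,\Pi U|0\rangle-v|\le\varepsilon|v|$. It is exact if $\varepsilon=0$. Its information efficiency is $\eta(B)=|\Pi U|0\rangle|$, and $t(B)$ is the total number of atomic gates in its three circuits. *Algorithms.* An algorithm executes atomic gates and measurements under classical control and finally returns data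 $(U,\Pi,\langle0|,\gamma)$ of the above kind. Its cost is the number of gates executed; numbers of gates (executed or returned) are taken in the worst case over the measurement outcomes of positive probability. *Constructive encodings.* Fix $C_{\mathrm{ie}}$. A constructive encoding $\mathcal A$ of a vector $v\in\mathbb C^N$ is an algorithm that takes $0<\varepsilon<1$ and $0<\delta<1$ and, with probability at least $1-\delta$, returns a block encoding of $v$ up to relative tolerance $\varepsilon$. A constructive encoding of a function $f:\mathbb C^M\to\mathbb C^N$ takes in addition an exact block encoding $U_x$, with $\eta(U_x)\ge C_{\mathrm{ie}}$, of a vector $x\in\mathbb C^M$, and returns, with probability at least $1-\delta$, a block encoding of $f(x)$ up to relative tolerance $\varepsilon$. We say that its outputs have information efficiency at least $q$ if, for all admissible arguments, with probability at least $1-\delta$ the output is such a block encoding and has information efficiency at least $q$. It is amplified if this holds with $q=C_{\mathrm{ie}}$. Let $t(\mathcal A(\varepsilon,\delta,U_x))$ be the number of gates of the returned block encoding. The complexity is $c(\mathcal A,\varepsilon,\delta,U_x)=t(\mathcal A(\varepsilon,\delta,U_x))/t(U_x)$, where $t(U_x)$ is replaced by $1$ for a vector, for which there is no input $U_x$. We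 call $\mathcal A$ efficient if there is a constant $K$, independent of $x,U_x,\varepsilon,\delta$, such that the number of gates executed by $\mathcal A$ is at most $K\,\varepsilon^{-1}(1+\log\delta^{-1})\,t(\mathcal A(\varepsilon,\delta,U_x))$. **Statement.** There are constants $C_{\mathrm{ie}}\in[\tfrac14,1]$ and $C$ such that the following holds. Let $\mathcal A$ be an efficient constructive encoding of a vector or of a vector-valued function whose outputs have information efficiency at least $\eta_{\min}>0$. Then one can find an efficient amplified encoding $\mathcal A'$ of the same vector or function, with complexity $$c(\mathcal A',\varepsilon,\delta,U_x)\le C\,\eta_{\min}^{-1}\,c(\mathcal A,\tfrac{\varepsilon}{2},\tfrac{\delta}{2},U_x)\qquad\text{for all }0<\varepsilon<1,\ 0<\delta<1\text{ and all admissible }U_x .$$ Here "one can find" means: $\mathcal A'$ calls $\mathcal A$ once, with tolerance $\varepsilon/2$ and failure probability $\delta/2$, and then runs a fixed routine, the same for all $\mathcal A$, all vectors and functions, and all dimensions. This routine knows $\eta_{\min}$, $\varepsilon$, $\delta$, the numbers of qubits and the factor $\gamma$ of the returned block encoding $B$, but uses the circuits of $B$ and their inverses only as black boxes: it executes them within larger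 circuits, measures, and assembles the output from them and from atomic gates; the output projection is that of $B$ tensored with $\langle0\dots0|$ on additional qubits. -/

import Mathlib

namespace QEnc

/-! ### Qubits, atomic gates, circuits -/

/-- Labels of the computational basis of `n` qubits. -/
abbrev Bits (n : ℕ) : Type := Fin n → Bool

/-- The all-zero label. -/
def zeroBits (n : ℕ) : Bits n := fun _ => false

/-- Atomic gates on `n` qubits: an arbitrary one-qubit unitary, or a controlled NOT. -/
inductive Gate (n : ℕ) : Type
  | single (i : Fin n) (u : Matrix.unitaryGroup Bool ℂ) : Gate n
  | cnot (control target : Fin n) (h : control ≠ target) : Gate n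

/-- The unitary matrix of an atomic gate. -/
noncomputable def Gate.matrix {n : ℕ} : Gate n → Matrix (Bits n) (Bits n) ℂ
  | .single i u => Matrix.of fun x y =>
      if ∀ k, k ≠ i → x k = y k then (u : Matrix Bool Bool ℂ) (x i) (y i) else 0
  | .cnot c t _ => Matrix.of fun x y =>
      if x = Function.update y t (xor (y t) (y c)) then 1 else 0

/-- The inverse of an atomic gate, again one atomic gate. -/
noncomputable def Gate.inv {n : ℕ} : Gate n → Gate n
  | .single i u => .single i u⁻¹
  | .cnot c t h => .cnot c t h

/-- The same gate, acting on other wires. -/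
def Gate.rewire {k n : ℕ} (f : Fin k ↪ Fin n) : Gate k → Gate n
  | .single i u => .single (f i) u
  | .cnot c t h => .cnot (f c) (f t) (fun e => h (f.injective e))

/-- A circuit is a list of atomic gates; the head of the list is applied first. -/
abbrev Circuit (n : ℕ) : Type := List (Gate n)

/-- The unitary matrix of a circuit. -/
noncomputable def Circuit.matrix {n : ℕ} : Circuit n → Matrix (Bits n) (Bits n) ℂ
  | [] => 1
  | g :: c => Circuit.matrix c * g.matrix

/-- The inverse circuit. -/
noncomputable def Circuit.inv {n : ℕ} (c : Circuit n) : Circuit n :=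
  c.reverse.map Gate.inv

/-- A circuit for an operation on `n` qubits, which may use `work` additional work qubits. -/
structure Implementation (n : ℕ) where
  work : ℕ
  circuit : Circuit (n + work)

/-- The operation on the `n` main qubits when the work qubits start and end in `|0…0⟩`. -/
noncomputable def Implementation.matrix {n : ℕ} (I : Implementation n) :
    Matrix (Bits n) (Bits n) ℂ :=
  Matrix.of fun x y => Circuit.matrix I.circuit
    (Fin.append x (zeroBits I.work)) (Fin.append y (zeroBits I.work))

/-- The circuit returns work qubits that start in `|0…0⟩` to `|0…0⟩`.  In that case
`I.matrix` is unitary, and it is the operation which the circuit implements. -/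
def Implementation.Clean {n : ℕ} (I : Implementation n) : Prop :=
  ∀ (x y : Bits n) (z : Bits I.work), z ≠ zeroBits I.work →
    Circuit.matrix I.circuit (Fin.append x z) (Fin.append y (zeroBits I.work)) = 0

/-- The circuit implements the matrix `V`. -/
def Implementation.Implements {n : ℕ} (I : Implementation n)
    (V : Matrix (Bits n) (Bits n) ℂ) : Prop :=
  I.Clean ∧ I.matrix = V

/-! ### Block encodings of vectors -/

/-- The controlled NOT of a subspace projection `P`: the operation `P† P ⊗ X + (1 - P† P) ⊗ 1`
on `m + 1` qubits, the last one being the target. -/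
noncomputable def projNot {N m : ℕ} (P : Matrix (Fin N) (Bits m) ℂ) :
    Matrix (Bits (m + 1)) (Bits (m + 1)) ℂ :=
  Matrix.of fun x y =>
    if x (Fin.last m) = y (Fin.last m)
    then (1 - P.conjTranspose * P : Matrix (Bits m) (Bits m) ℂ) (fun k => x k.castSucc) (fun k => y k.castSucc)
    else (P.conjTranspose * P : Matrix (Bits m) (Bits m) ℂ) (fun k => x k.castSucc) (fun k => y k.castSucc)

/-- The projection `⟨0|`, as a matrix with one row. -/
noncomputable def braZero (m : ℕ) : Matrix (Fin 1) (Bits m) ℂ :=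
  Matrix.of fun _ x => if x = zeroBits m then 1 else 0

/-- The data `(U, ⟨0|, Π, γ)` of a block encoding of a vector of length `N`: a circuit for the
unitary `U`, circuits for the controlled NOT gates of the projections `⟨0|` and `Π`, the matrix
`Π` and the normalization factor `γ`. -/
structure BlockEncoding (N : ℕ) where
  qubits : ℕ
  unitary : Implementation qubits
  zeroNot : Implementation (qubits + 1)
  proj : Matrix (Fin N) (Bits qubits) ℂ
  projNot : Implementation (qubits + 1)
  γ : ℝ

/-- The vector `Π U |0⟩`. -/
noncomputable def BlockEncoding.vec {N : ℕ} (B : BlockEncoding N) : EuclideanSpace ℂ (Fin N) :=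
  WithLp.toLp 2 (B.proj.mulVec fun x => B.unitary.matrix x (zeroBits B.qubits))

/-- The information efficiency `|Π U |0⟩|`. -/
noncomputable def BlockEncoding.efficiency {N : ℕ} (B : BlockEncoding N) : ℝ := ‖B.vec‖

/-- The number of atomic gates of a block encoding, in the circuits of all its components. -/
def BlockEncoding.gates {N : ℕ} (B : BlockEncoding N) : ℕ :=
  B.unitary.circuit.length + B.zeroNot.circuit.length + B.projNot.circuit.length

/-- `B` is a block encoding of the vector `v` up to relative tolerance `ε`. -/
structure BlockEncoding.Encodes {N : ℕ} (B : BlockEncoding N)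
    (v : EuclideanSpace ℂ (Fin N)) (ε : ℝ) : Prop where
  unitary_clean : B.unitary.Clean
  zeroNot_implements : B.zeroNot.Implements (QEnc.projNot (braZero B.qubits))
  orthonormal_rows : B.proj * B.proj.conjTranspose = 1
  projNot_implements : B.projNot.Implements (QEnc.projNot B.proj)
  norm_le : ‖v‖ ≤ B.γ
  error_le : ‖(B.γ : ℂ) • B.vec - v‖ ≤ ε * ‖v‖

/-! ### Algorithms with quantum gates, measurements and classical control -/

/-- Adaptive quantum programs that currently hold `n` qubits and finally return a value in `α`;
`G n` is the type of elementary operations on `n` qubits. -/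
inductive Prog (G : ℕ → Type) (α : Type) : ℕ → Type
  /-- stop and return `a` -/
  | ret {n : ℕ} (a : α) : Prog G α n
  /-- discard all qubits, take `k` fresh ones in the state `|0…0⟩`, and go on with `p` -/
  | fresh {n : ℕ} (k : ℕ) (p : Prog G α k) : Prog G α n
  /-- execute `g` and go on with `p` -/
  | gate {n : ℕ} (g : G n) (p : Prog G α n) : Prog G α n
  /-- measure qubit `i` in the computational basis and go on depending on the outcome -/
  | measure {n : ℕ} (i : Fin n) (p : Bool → Prog G α n) : Prog G α n

/-- Sequential composition. -/
def Prog.bind {G : ℕ → Type} {α β : Type} (f : α → Prog G β 0) :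
    {n : ℕ} → Prog G α n → Prog G β n
  | _, .ret a => .fresh 0 (f a)
  | _, .fresh k p => .fresh k (p.bind f)
  | _, .gate g p => .gate g (p.bind f)
  | _, .measure i p => .measure i fun b => (p b).bind f

/-- One possible course of a program: its probability, the number of gates executed, and the
value returned. -/
structure Run (α : Type) where
  prob : ℝ
  gates : ℕ
  output : α

/-- All courses of a program that starts in the (possibly subnormalized) state `ψ`. -/
noncomputable def Prog.runs {α : Type} :
    {n : ℕ} → Prog Gate α n → (Bits n → ℂ) → List (Run α)
  | _, .ret a, ψ => [⟨∑ x, ‖ψ x‖ ^ 2, 0, a⟩]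
  | _, .fresh k p, ψ =>
      (p.runs (Pi.single (zeroBits k) 1)).map fun r => { r with prob := (∑ x, ‖ψ x‖ ^ 2) * r.prob }
  | _, .gate g p, ψ => (p.runs (g.matrix.mulVec ψ)).map fun r => { r with gates := r.gates + 1 }
  | _, .measure i p, ψ =>
      (p false).runs (fun x => if x i = false then ψ x else 0) ++
      (p true).runs (fun x => if x i = true then ψ x else 0)

/-- All courses of a complete program, which starts without any qubits. -/
noncomputable def Prog.allRuns {α : Type} (p : Prog Gate α 0) : List (Run α) :=
  p.runs fun _ => 1

open Classical in
/-- The probability that the returned value satisfies `S`. -/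
noncomputable def Prog.prob {α : Type} (p : Prog Gate α 0) (S : α → Prop) : ℝ :=
  (p.allRuns.map fun r => if S r.output then r.prob else 0).sum

/-- The number of gates executed, in the worst case over the courses of positive probability. -/
noncomputable def Prog.worstGates {α : Type} (p : Prog Gate α 0) : ENNReal :=
  ⨆ r ∈ p.allRuns, ⨆ _ : 0 < r.prob, (r.gates : ENNReal)

/-- The number of atomic gates of the returned block encoding, in the worst case over the courses
of positive probability. -/
noncomputable def Prog.outputGates {N : ℕ} (p : Prog Gate (BlockEncoding N) 0) : ENNReal :=
  ⨆ r ∈ p.allRuns, ⨆ _ : 0 < r.prob, (r.output.gates : ENNReal)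

/-! ### Constructive encodings -/

/-- Algorithms that, given a tolerance `ε`, a failure probability `δ` and an input from `I`,
return the data of a block encoding of a vector of length `N`. -/
abbrev Algorithm (I : Type) (N : ℕ) : Type :=
  (ε δ : ℝ) → I → Prog Gate (BlockEncoding N) 0

/-- What is to be encoded: `Target i y` means that `i` is an admissible input and that on this
input the vector to be encoded is `y`; `inputGates i` is the number of gates of the input. -/
structure EncTask (I : Type) (N : ℕ) where
  Target : I → EuclideanSpace ℂ (Fin N) → Prop
  inputGates : I → ℕ

/-- Encoding a fixed vector: there is no input, and its gate number is set to one. -/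
def vectorTask {N : ℕ} (v : EuclideanSpace ℂ (Fin N)) : EncTask Unit N where
  Target _ y := y = v
  inputGates _ := 1

/-- Encoding a function `f`: the input is an exact block encoding, of information efficiency at
least `c`, of a vector `x`, and `f x` has to be encoded. -/
def functionTask {M N : ℕ} (c : ℝ) (f : EuclideanSpace ℂ (Fin M) → EuclideanSpace ℂ (Fin N)) :
    EncTask (BlockEncoding M) N where
  Target Ux y := ∃ x, Ux.Encodes x 0 ∧ c ≤ Ux.efficiency ∧ y = f x
  inputGates Ux := Ux.gates

/-- `A` is a constructive encoding whose output block encodings have information efficiency at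
least `q`: with probability at least `1 - δ` it returns a block encoding, up to relative tolerance
`ε`, of the desired vector, of information efficiency at least `q`. -/
def IsConstructiveEncoding {I : Type} {N : ℕ} (A : Algorithm I N) (T : EncTask I N) (q : ℝ) :
    Prop :=
  ∀ ε δ : ℝ, 0 < ε → ε < 1 → 0 < δ → δ < 1 → ∀ i y, T.Target i y →
    1 - δ ≤ (A ε δ i).prob fun B => B.Encodes y ε ∧ q ≤ B.efficiency

/-- `A` is efficient: it executes `O(ε⁻¹ log δ⁻¹)` times as many gates as its output has. The
summand `1` only matters for `δ` near `1`, where `log δ⁻¹` tends to zero. -/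
def IsEfficient {I : Type} {N : ℕ} (A : Algorithm I N) (T : EncTask I N) : Prop :=
  ∃ K : ℝ, ∀ ε δ : ℝ, 0 < ε → ε < 1 → 0 < δ → δ < 1 → ∀ i y, T.Target i y →
    (A ε δ i).worstGates ≤
      ENNReal.ofReal (K * ε⁻¹ * (1 + Real.log δ⁻¹)) * (A ε δ i).outputGates

/-- The complexity of `A`: gates of the output per gate of the input. -/
noncomputable def complexity {I : Type} {N : ℕ} (A : Algorithm I N) (T : EncTask I N)
    (ε δ : ℝ) (i : I) : ENNReal :=
  (A ε δ i).outputGates / (T.inputGates i : ENNReal)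

/-! ### Routines that use a block encoding only by executing it -/

/-- The part of a block encoding that is visible without executing it: the numbers of qubits and
the normalization factor. -/
structure Shape where
  qubits : ℕ
  unitaryWork : ℕ
  zeroNotWork : ℕ
  projNotWork : ℕ
  γ : ℝ

def BlockEncoding.shape {N : ℕ} (B : BlockEncoding N) : Shape :=
  ⟨B.qubits, B.unitary.work, B.zeroNot.work, B.projNot.work, B.γ⟩

/-- The three circuits of a block encoding. -/
inductive Box : Type
  | unitary | zeroNot | projNot

/-- The number of wires of these circuits. -/
def Shape.wires (s : Shape) : Box → ℕ
  | .unitary => s.qubits + s.unitaryWork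
  | .zeroNot => s.qubits + 1 + s.zeroNotWork
  | .projNot => s.qubits + 1 + s.projNotWork

def BlockEncoding.box {N : ℕ} (B : BlockEncoding N) : (b : Box) → Circuit (B.shape.wires b)
  | .unitary => B.unitary.circuit
  | .zeroNot => B.zeroNot.circuit
  | .projNot => B.projNot.circuit

/-- Operations available to a routine with access to an unknown block encoding of shape `s`:
atomic gates, and its three circuits or their inverses on wires of choice. -/
inductive BoxGate (s : Shape) (n : ℕ) : Type
  | gate (g : Gate n) : BoxGate s n
  | call (b : Box) (inverse : Bool) (wires : Fin (s.wires b) ↪ Fin n) : BoxGate s n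

/-- The atomic gates that are executed when the unknown block encoding is `B`. -/
noncomputable def BoxGate.expand {N : ℕ} (B : BlockEncoding N) {n : ℕ} :
    BoxGate B.shape n → Circuit n
  | .gate g => [g]
  | .call b inverse f =>
      (if inverse then Circuit.inv (B.box b) else B.box b).map (Gate.rewire f)

/-- A new block encoding, described in terms of an unknown one of shape `s`. It has
`ancillas` additional qubits, and its projection is `Π ⊗ ⟨0…0|`. -/
structure BoxEncoding (s : Shape) where
  ancillas : ℕ
  unitaryWork : ℕ
  unitary : List (BoxGate s (s.qubits + ancillas + unitaryWork))
  zeroNotWork : ℕ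
  zeroNot : List (BoxGate s (s.qubits + ancillas + 1 + zeroNotWork))
  projNotWork : ℕ
  projNot : List (BoxGate s (s.qubits + ancillas + 1 + projNotWork))
  γ : ℝ

/-- The new block encoding when the unknown one is `B`. -/
noncomputable def BoxEncoding.expand {N : ℕ} (B : BlockEncoding N) (E : BoxEncoding B.shape) :
    BlockEncoding N where
  qubits := B.qubits + E.ancillas
  unitary := ⟨E.unitaryWork, E.unitary.flatMap (BoxGate.expand B)⟩
  zeroNot := ⟨E.zeroNotWork, E.zeroNot.flatMap (BoxGate.expand B)⟩
  proj := Matrix.of fun j x =>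
    if (fun k => x (Fin.natAdd B.qubits k)) = zeroBits E.ancillas
    then B.proj j (fun k => x (Fin.castAdd E.ancillas k)) else 0
  projNot := ⟨E.projNotWork, E.projNot.flatMap (BoxGate.expand B)⟩
  γ := E.γ

/-- The execution of a routine when the unknown block encoding is `B`. -/
noncomputable def Prog.expand {N : ℕ} (B : BlockEncoding N) :
    {n : ℕ} → Prog (BoxGate B.shape) (BoxEncoding B.shape) n → Prog Gate (BlockEncoding N) n
  | _, .ret E => .ret (E.expand B)
  | _, .fresh k p => .fresh k (p.expand B)
  | _, .gate g p => (g.expand B).foldr (fun h q => Prog.gate h q) (p.expand B)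
  | _, .measure i p => .measure i fun b => (p b).expand B

/-- A routine that converts an unknown block encoding into a new one. Its arguments are a lower
bound for the information efficiency, a tolerance, a failure probability, and the shape of the
block encoding. It learns about the block encoding only by executing its circuits and measuring. -/
abbrev Routine : Type :=
  (ηmin ε δ : ℝ) → (s : Shape) → Prog (BoxGate s) (BoxEncoding s) 0

/-- The algorithm that calls `A` once, with tolerance `ε / 2` and failure probability `δ / 2`, and
then applies the routine `R` to the block encoding that `A` returned. -/
noncomputable def Routine.convert (R : Routine) (ηmin : ℝ) {I : Type} {N : ℕ}
    (A : Algorithm I N) : Algorithm I N :=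
  fun ε δ i => (A (ε / 2) (δ / 2) i).bind fun B => (R ηmin ε δ B.shape).expand B

end QEnc

/-!
# Amplification of constructive block encodings

Let a block encoding `B` have efficiency `e = |Π U |0⟩| ≥ η`. Amplitude amplification with `k`
Grover iterations multiplies `Π U |0⟩` by `a_k (e²)`, where `a_k` is a polynomial of degree `k` with
`a_k (sin² θ) = ± sin ((2 k + 1) θ) / sin θ` (`groverMap_iterate`, `amp_sin`). The result is again
an encoding of the same vector, but the factor depends on the unknown number `e`, which can only be
estimated by sampling. With `m` measurements one learns `e²` up to about `m ^ (-1/2)`, and no more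
than `O(ε⁻¹ log δ⁻¹)` measurements are permitted for a relative accuracy `ε`. So the estimate is only
accurate to about `√ε`, and this has to suffice.

It does if the amplification takes place at a critical point of `a_k`. Given an estimate `phat` of
`e²`, a rotation of one ancilla first attenuates the success probability from `e²` to
`p e² / phat`, which is `p` up to `O(√ε)`. Here `p` is a critical point of `a_k` between the zeros
`sin² (π / n)` and `sin² (2 π / n)`, `n = 2 k + 1`, at which `√p |a_k (p)| ≥ 2 / 3`
(`exists_critical`). By Taylor's formula `a_k` then takes the value `a_k (p)` up to a relative error
`O(ε)`, and the amplified vector is a known multiple of `Π U |0⟩ / √phat`: the unknown `e` only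
enters through `Π U |0⟩` itself (`amplitude_estimate`). A rotation of a second ancilla finally
attenuates the efficiency to about one third, and `γ' = 3 γ √phat` is the new normalization factor.
Since `p ≤ η² / 2` is possible with `k + 1 ≤ 7 / η`, the output is larger than `B` by a factor of
`O(1 / η)` only. The numbers `k`, `p` and the constant in the accuracy `τ √ε` depend on `η` alone.

The Chernoff bound for the sampling is `trials_deviation`, and `sampleProg_expect` identifies the
distribution of the returned value with that of independent Bernoulli trials.

The circuits are built on register states `regState`, the joint states of the main qubits of `B` and
six auxiliary qubits while all work qubits are in the state `|0⟩`. A circuit of `B` acts on them as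
the operation that it implements (`Maps.box`, `Maps.flip`). The controlled NOT of `Π ⊗ ⟨00|` is
obtained from that of `Π` by two logical ANDs, each a Toffoli gate up to relative phases, which are
computed into fresh qubits and uncomputed afterwards (`FlipsThree.condNotCircuit`). Together with a
phase gate it gives the reflections of the Grover iteration.
-/

namespace QEnc

open scoped Matrix Polynomial

/-! ### The action of gates and circuits on states -/

theorem Gate.single_mulVec {n : ℕ} (i : Fin n) (u : Matrix.unitaryGroup Bool ℂ)
    (ψ : Bits n → ℂ) (z : Bits n) :
    ((Gate.single i u).matrix *ᵥ ψ) z =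
      ∑ b, (u : Matrix Bool Bool ℂ) (z i) b * ψ (Function.update z i b) := by
  have h : ∀ b, (u : Matrix Bool Bool ℂ) (z i) b * ψ (Function.update z i b) =
      ∑ y : Bits n, if y = Function.update z i b
        then (u : Matrix Bool Bool ℂ) (z i) b * ψ y else 0 := by
    intro b; simp
  simp only [h]
  rw [Finset.sum_comm]
  refine Finset.sum_congr rfl fun y _ => ?_
  simp only [Gate.matrix, Matrix.of_apply]
  by_cases hy : ∀ k, k ≠ i → z k = y k
  · rw [if_pos hy, Finset.sum_eq_single (y i)]
    · rw [if_pos]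
      ext k
      by_cases hk : k = i
      · subst hk; simp
      · simp [hk, hy k hk]
    · intro b _ hb
      rw [if_neg]
      intro h'
      exact hb (by rw [h']; simp)
    · simp
  · rw [if_neg hy, zero_mul, Finset.sum_eq_zero]
    intro b _
    rw [if_neg]
    rintro rfl
    exact hy fun k hk => by simp [hk]

theorem Gate.cnot_mulVec {n : ℕ} (c t : Fin n) (h : c ≠ t) (ψ : Bits n → ℂ) (z : Bits n) :
    ((Gate.cnot c t h).matrix *ᵥ ψ) z = ψ (Function.update z t (xor (z t) (z c))) := by
  have hiff : ∀ y : Bits n, z = Function.update y t (xor (y t) (y c)) ↔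
      y = Function.update z t (xor (z t) (z c)) := by
    intro y
    constructor <;>
    · rintro rfl
      simp [h]
  simp [Matrix.mulVec, dotProduct, Gate.matrix, hiff]

/-- A gate moved to other wires acts on each slice on which the remaining wires are constant. -/
theorem Gate.rewire_mulVec {k n : ℕ} (f : Fin k ↪ Fin n) (g : Gate k) (ψ : Bits n → ℂ)
    (z : Bits n) :
    ((g.rewire f).matrix *ᵥ ψ) z =
      (g.matrix *ᵥ fun y => ψ (Function.extend f y z)) (fun i => z (f i)) := by
  have h : ∀ (i : Fin k) (b : Bool),
      Function.extend f (Function.update (fun i => z (f i)) i b) z =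
        Function.update z (f i) b := by
    intro i b
    ext j
    by_cases hj : ∃ a, f a = j
    · obtain ⟨a, rfl⟩ := hj
      rw [f.injective.extend_apply]
      by_cases ha : a = i
      · subst ha; simp
      · simp [ha]
    · rw [Function.extend_apply' _ _ _ hj, Function.update_of_ne]
      exact fun e => hj ⟨i, e.symm⟩
  cases g with
  | single i u => simp [Gate.rewire, Gate.single_mulVec, h]
  | cnot c t hct => simp [Gate.rewire, Gate.cnot_mulVec, h]

theorem Circuit.matrix_append {n : ℕ} (c d : Circuit n) :
    Circuit.matrix (c ++ d) = Circuit.matrix d * Circuit.matrix c := by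
  induction c with
  | nil => simp [Circuit.matrix]
  | cons g c ih => simp [Circuit.matrix, ih, Matrix.mul_assoc]

theorem Circuit.matrix_singleton {n : ℕ} (g : Gate n) : Circuit.matrix [g] = g.matrix := by
  simp [Circuit.matrix]

theorem Circuit.rewire_mulVec {k n : ℕ} (f : Fin k ↪ Fin n) (c : Circuit k) (ψ : Bits n → ℂ)
    (z : Bits n) :
    (Circuit.matrix (c.map (Gate.rewire f)) *ᵥ ψ) z =
      (Circuit.matrix c *ᵥ fun y => ψ (Function.extend f y z)) (fun i => z (f i)) := by
  induction c generalizing ψ with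
  | nil =>
    have : Function.extend f (fun i => z (f i)) z = z := by
      ext j
      by_cases hj : ∃ a, f a = j
      · obtain ⟨a, rfl⟩ := hj
        rw [f.injective.extend_apply]
      · rw [Function.extend_apply' _ _ _ hj]
    simp [Circuit.matrix, this]
  | cons g c ih =>
    simp only [List.map_cons, Circuit.matrix, ← Matrix.mulVec_mulVec]
    rw [ih]
    congr 2
    ext y
    rw [Gate.rewire_mulVec]
    congr 1
    · ext y'
      apply congrArg
      ext j
      by_cases hj : ∃ a, f a = j
      · obtain ⟨a, rfl⟩ := hj
        simp [f.injective.extend_apply]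
      · simp [Function.extend_apply' _ _ _ hj]
    · ext i
      rw [f.injective.extend_apply]

/-! ### Unitarity -/

theorem Gate.inv_inv {n : ℕ} (g : Gate n) : g.inv.inv = g := by
  cases g <;> simp [Gate.inv]

theorem Gate.inv_rewire {k n : ℕ} (f : Fin k ↪ Fin n) (g : Gate k) :
    (g.rewire f).inv = g.inv.rewire f := by
  cases g <;> rfl

theorem Gate.conjTranspose_matrix {n : ℕ} (g : Gate n) : g.matrixᴴ = g.inv.matrix := by
  cases g with
  | single i u =>
    ext x y
    simp only [Matrix.conjTranspose_apply, Gate.matrix, Gate.inv, Matrix.of_apply]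
    have : (∀ k, k ≠ i → y k = x k) ↔ ∀ k, k ≠ i → x k = y k := by simp [eq_comm]
    simp only [this]
    split_ifs
    · rfl
    · simp
  | cnot c t h =>
    ext x y
    simp only [Matrix.conjTranspose_apply, Gate.matrix, Gate.inv, Matrix.of_apply]
    have : y = Function.update x t (xor (x t) (x c)) ↔
        x = Function.update y t (xor (y t) (y c)) := by
      constructor <;>
      · rintro rfl
        simp [h]
    simp only [this]
    split_ifs <;> simp

theorem Gate.inv_matrix_mul {n : ℕ} (g : Gate n) : g.inv.matrix * g.matrix = 1 := by
  apply Matrix.ext_of_mulVec_single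
  intro y
  ext z
  rw [← Matrix.mulVec_mulVec]
  cases g with
  | single i u =>
    simp only [Gate.inv, Gate.single_mulVec, Function.update_self, Function.update_idem,
      Matrix.one_mulVec, Finset.mul_sum]
    rw [Finset.sum_comm]
    have hu : ((u⁻¹ : Matrix.unitaryGroup Bool ℂ) : Matrix Bool Bool ℂ) * u = 1 := by
      rw [← Submonoid.coe_mul, inv_mul_cancel, Submonoid.coe_one]
    simp only [← mul_assoc, ← Finset.sum_mul]
    simp only [← Matrix.mul_apply, hu, Matrix.one_apply, ite_mul, one_mul, zero_mul,
      Finset.sum_ite_eq, Finset.mem_univ, if_true, Function.update_eq_self]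
  | cnot c t h =>
    simp only [Gate.inv]
    rw [Gate.cnot_mulVec, Gate.cnot_mulVec]
    simp [h, Matrix.one_apply, Pi.single_apply]

theorem Circuit.inv_inv {n : ℕ} (c : Circuit n) : Circuit.inv (Circuit.inv c) = c := by
  simp [Circuit.inv, List.map_reverse, Function.comp_def, Gate.inv_inv]

theorem Circuit.inv_append {n : ℕ} (c d : Circuit n) :
    Circuit.inv (c ++ d) = Circuit.inv d ++ Circuit.inv c := by
  simp [Circuit.inv]

theorem Circuit.inv_map_rewire {k n : ℕ} (f : Fin k ↪ Fin n) (c : Circuit k) :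
    Circuit.inv (c.map (Gate.rewire f)) = (Circuit.inv c).map (Gate.rewire f) := by
  simp [Circuit.inv, List.map_reverse, Function.comp_def, Gate.inv_rewire]

theorem Circuit.inv_matrix_mul {n : ℕ} (c : Circuit n) :
    Circuit.matrix (Circuit.inv c) * Circuit.matrix c = 1 := by
  induction c with
  | nil => simp [Circuit.matrix, Circuit.inv]
  | cons g c ih =>
    have h : Circuit.inv (g :: c) = Circuit.inv c ++ [g.inv] := by simp [Circuit.inv]
    rw [h, Circuit.matrix_append, Circuit.matrix_singleton]
    simp only [Circuit.matrix]
    rw [Matrix.mul_assoc, ← Matrix.mul_assoc (Circuit.matrix (Circuit.inv c)), ih, Matrix.one_mul,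
      Gate.inv_matrix_mul]

theorem Circuit.conjTranspose_matrix {n : ℕ} (c : Circuit n) :
    (Circuit.matrix c)ᴴ = Circuit.matrix (Circuit.inv c) := by
  induction c with
  | nil => simp [Circuit.matrix, Circuit.inv]
  | cons g c ih =>
    have h : Circuit.inv (g :: c) = Circuit.inv c ++ [g.inv] := by simp [Circuit.inv]
    rw [h, Circuit.matrix_append, Circuit.matrix_singleton]
    simp only [Circuit.matrix, Matrix.conjTranspose_mul, ih, Gate.conjTranspose_matrix]

/-- The squared norm of a state. -/
noncomputable def normSq {ι : Type*} [Fintype ι] (ψ : ι → ℂ) : ℝ := ∑ x, ‖ψ x‖ ^ 2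

theorem normSq_nonneg {ι : Type*} [Fintype ι] (ψ : ι → ℂ) : 0 ≤ normSq ψ :=
  Finset.sum_nonneg fun _ _ => by positivity

theorem ofReal_normSq {ι : Type*} [Fintype ι] (ψ : ι → ℂ) :
    ((normSq ψ : ℝ) : ℂ) = star ψ ⬝ᵥ ψ := by
  simp only [normSq, dotProduct, Complex.ofReal_sum, Pi.star_apply]
  refine Finset.sum_congr rfl fun x _ => ?_
  rw [RCLike.star_def, Complex.conj_mul']
  push_cast
  rfl

theorem ofReal_normSq_mulVec {ι κ : Type*} [Fintype ι] [Fintype κ] (A : Matrix κ ι ℂ)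
    (ψ : ι → ℂ) : ((normSq (A *ᵥ ψ) : ℝ) : ℂ) = star ψ ⬝ᵥ ((Aᴴ * A) *ᵥ ψ) := by
  rw [ofReal_normSq, Matrix.star_mulVec, ← Matrix.mulVec_mulVec, Matrix.dotProduct_mulVec,
    Matrix.dotProduct_mulVec, Matrix.vecMul_vecMul, Matrix.dotProduct_mulVec, Matrix.vecMul_vecMul]

theorem normSq_gate {n : ℕ} (g : Gate n) (ψ : Bits n → ℂ) :
    normSq (g.matrix *ᵥ ψ) = normSq ψ := by
  have h := ofReal_normSq_mulVec g.matrix ψ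
  rw [Gate.conjTranspose_matrix, Gate.inv_matrix_mul, Matrix.one_mulVec, ← ofReal_normSq] at h
  exact_mod_cast h

theorem normSq_circuit {n : ℕ} (c : Circuit n) (ψ : Bits n → ℂ) :
    normSq (Circuit.matrix c *ᵥ ψ) = normSq ψ := by
  have h := ofReal_normSq_mulVec (Circuit.matrix c) ψ
  rw [Circuit.conjTranspose_matrix, Circuit.inv_matrix_mul, Matrix.one_mulVec,
    ← ofReal_normSq] at h
  exact_mod_cast h

/-! ### Runs of programs -/

theorem Prog.runs_prob_nonneg {α : Type} {n : ℕ} (p : Prog Gate α n) (ψ : Bits n → ℂ) :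
    ∀ r ∈ p.runs ψ, 0 ≤ r.prob := by
  induction p with
  | ret a =>
    intro r hr
    simp only [Prog.runs, List.mem_singleton] at hr
    subst hr
    exact normSq_nonneg ψ
  | fresh k p ih =>
    intro r hr
    simp only [Prog.runs, List.mem_map] at hr
    obtain ⟨s, hs, rfl⟩ := hr
    exact mul_nonneg (normSq_nonneg ψ) (ih _ s hs)
  | gate g p ih =>
    intro r hr
    simp only [Prog.runs, List.mem_map] at hr
    obtain ⟨s, hs, rfl⟩ := hr
    exact ih _ s hs
  | measure i p ih =>
    intro r hr
    simp only [Prog.runs, List.mem_append] at hr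
    rcases hr with hr | hr
    · exact ih _ _ r hr
    · exact ih _ _ r hr

/-- The expectation of a function of the returned value, for a program that starts in the possibly
subnormalized state `ψ`. -/
noncomputable def Prog.expect {α : Type} {n : ℕ} (p : Prog Gate α n) (ψ : Bits n → ℂ)
    (F : α → ℝ) : ℝ :=
  ((p.runs ψ).map fun r => r.prob * F r.output).sum

theorem Prog.expect_ret {α : Type} {n : ℕ} (a : α) (ψ : Bits n → ℂ) (F : α → ℝ) :
    (Prog.ret a : Prog Gate α n).expect ψ F = normSq ψ * F a := by
  simp [Prog.expect, Prog.runs, normSq]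

theorem Prog.expect_fresh {α : Type} {n k : ℕ} (p : Prog Gate α k) (ψ : Bits n → ℂ) (F : α → ℝ) :
    (Prog.fresh k p : Prog Gate α n).expect ψ F =
      normSq ψ * p.expect (Pi.single (zeroBits k) 1) F := by
  simp [Prog.expect, Prog.runs, normSq, Function.comp_def, mul_assoc, List.sum_map_mul_left]

theorem Prog.expect_gate {α : Type} {n : ℕ} (g : Gate n) (p : Prog Gate α n) (ψ : Bits n → ℂ)
    (F : α → ℝ) : (Prog.gate g p).expect ψ F = p.expect (g.matrix *ᵥ ψ) F := by
  simp [Prog.expect, Prog.runs, Function.comp_def]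

theorem Prog.expect_measure {α : Type} {n : ℕ} (i : Fin n) (p : Bool → Prog Gate α n)
    (ψ : Bits n → ℂ) (F : α → ℝ) :
    (Prog.measure i p).expect ψ F =
      (p false).expect (fun x => if x i = false then ψ x else 0) F +
      (p true).expect (fun x => if x i = true then ψ x else 0) F := by
  simp [Prog.expect, Prog.runs]

theorem normSq_split {n : ℕ} (i : Fin n) (ψ : Bits n → ℂ) :
    normSq (fun x => if x i = false then ψ x else 0) +
      normSq (fun x => if x i = true then ψ x else 0) = normSq ψ := by
  simp only [normSq, ← Finset.sum_add_distrib]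
  refine Finset.sum_congr rfl fun x _ => ?_
  cases x i <;> simp

theorem normSq_single {ι : Type*} [Fintype ι] [DecidableEq ι] (i : ι) :
    normSq (Pi.single i 1 : ι → ℂ) = 1 := by
  rw [normSq, Finset.sum_eq_single i] <;> simp +contextual

/-- The probabilities of all runs sum up to the squared norm of the initial state. -/
theorem Prog.expect_one {α : Type} {n : ℕ} (p : Prog Gate α n) (ψ : Bits n → ℂ) :
    p.expect ψ (fun _ => 1) = normSq ψ := by
  induction p with
  | ret a => simp [Prog.expect_ret]
  | fresh k p ih => rw [Prog.expect_fresh, ih, normSq_single, mul_one]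
  | gate g p ih => rw [Prog.expect_gate, ih, normSq_gate]
  | measure i p ih => rw [Prog.expect_measure, ih, ih, normSq_split]

theorem Prog.expect_mono {α : Type} {n : ℕ} (p : Prog Gate α n) (ψ : Bits n → ℂ)
    {F G : α → ℝ} (h : ∀ a, F a ≤ G a) : p.expect ψ F ≤ p.expect ψ G := by
  refine List.sum_le_sum fun r hr => ?_
  exact mul_le_mul_of_nonneg_left (h _) (p.runs_prob_nonneg ψ r hr)

theorem Prog.expect_const_mul {α : Type} {n : ℕ} (p : Prog Gate α n) (ψ : Bits n → ℂ) (c : ℝ)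
    (F : α → ℝ) : p.expect ψ (fun a => c * F a) = c * p.expect ψ F := by
  simp only [Prog.expect, mul_left_comm _ c, List.sum_map_mul_left]

theorem one_eq_single : (fun _ => 1 : Bits 0 → ℂ) = Pi.single (zeroBits 0) 1 := by
  ext x
  rw [Subsingleton.elim x (zeroBits 0)]
  simp

/-- A complete program starts in the only state on no qubits, which has norm one. -/
theorem normSq_bits_zero : normSq (fun _ => 1 : Bits 0 → ℂ) = 1 := by
  rw [one_eq_single, normSq_single]

open Classical in
theorem Prog.prob_eq_expect {α : Type} (p : Prog Gate α 0) (S : α → Prop) :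
    p.prob S = p.expect (fun _ => 1) fun a => if S a then 1 else 0 := by
  simp [Prog.prob, Prog.expect, Prog.allRuns]

theorem Prog.runs_bind {α β : Type} (f : α → Prog Gate β 0) {n : ℕ} (p : Prog Gate α n)
    (ψ : Bits n → ℂ) :
    (p.bind f).runs ψ = (p.runs ψ).flatMap fun r =>
      (f r.output).allRuns.map fun s => ⟨r.prob * s.prob, r.gates + s.gates, s.output⟩ := by
  induction p with
  | ret a => simp [Prog.bind, Prog.runs, Prog.allRuns, one_eq_single]
  | fresh k p ih =>
    simp [Prog.bind, Prog.runs, ih, List.map_flatMap, List.flatMap_map, Function.comp_def,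
      mul_assoc]
  | gate g p ih =>
    simp [Prog.bind, Prog.runs, ih, List.map_flatMap, List.flatMap_map, Function.comp_def,
      add_right_comm]
  | measure i p ih => simp [Prog.bind, Prog.runs, ih]

theorem Prog.expect_bind {α β : Type} (f : α → Prog Gate β 0) {n : ℕ} (p : Prog Gate α n)
    (ψ : Bits n → ℂ) (F : β → ℝ) :
    (p.bind f).expect ψ F = p.expect ψ fun a => (f a).expect (fun _ => 1) F := by
  simp only [Prog.expect, Prog.runs_bind, Prog.allRuns]
  induction p.runs ψ with
  | nil => simp
  | cons r l ih =>
    simp [ih, Function.comp_def, mul_assoc, List.sum_map_mul_left]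

theorem Prog.runs_foldr_gate {α : Type} {n : ℕ} (c : Circuit n) (p : Prog Gate α n)
    (ψ : Bits n → ℂ) :
    (c.foldr (fun h q => Prog.gate h q) p).runs ψ =
      (p.runs (Circuit.matrix c *ᵥ ψ)).map fun r => { r with gates := r.gates + c.length } := by
  induction c generalizing ψ with
  | nil => simp [Circuit.matrix]
  | cons g c ih =>
    simp [Prog.runs, ih, Circuit.matrix, Function.comp_def, add_assoc]

theorem Prog.expect_foldr_gate {α : Type} {n : ℕ} (c : Circuit n) (p : Prog Gate α n)
    (ψ : Bits n → ℂ) (F : α → ℝ) :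
    (c.foldr (fun h q => Prog.gate h q) p).expect ψ F = p.expect (Circuit.matrix c *ᵥ ψ) F := by
  simp [Prog.expect, Prog.runs_foldr_gate, Function.comp_def]

/-! ### States of registers -/

/-- The state of main and work qubits in which the main qubits are in the state `φ` and all work
qubits in the state `|0⟩`. -/
def padState {k w : ℕ} (φ : Bits k → ℂ) : Bits (k + w) → ℂ := fun y =>
  if ∀ j, y (Fin.natAdd k j) = false then φ (fun i => y (Fin.castAdd w i)) else 0

theorem padState_append {k w : ℕ} (φ : Bits k → ℂ) (x : Bits k) (z : Bits w) :
    padState φ (Fin.append x z) = if z = zeroBits w then φ x else 0 := by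
  simp [padState, funext_iff, zeroBits]

theorem exists_append {k w : ℕ} (z : Bits (k + w)) :
    ∃ (x : Bits k) (y : Bits w), z = Fin.append x y :=
  ⟨fun i => z (Fin.castAdd w i), fun j => z (Fin.natAdd k j), (Fin.append_castAdd_natAdd).symm⟩

theorem sum_append {k w : ℕ} {β : Type*} [AddCommMonoid β] (F : Bits (k + w) → β) :
    ∑ z, F z = ∑ x : Bits k, ∑ y : Bits w, F (Fin.append x y) := by
  rw [← Fintype.sum_prod_type']
  exact (Fintype.sum_equiv (Fin.appendEquiv k w) _ _ fun _ => rfl).symm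

theorem mulVec_padState {k w : ℕ} (A : Matrix (Bits (k + w)) (Bits (k + w)) ℂ) (φ : Bits k → ℂ)
    (z : Bits (k + w)) :
    (A *ᵥ padState φ) z = ∑ y, A z (Fin.append y (zeroBits w)) * φ y := by
  simp [Matrix.mulVec, dotProduct, sum_append, padState_append]

theorem Implementation.Implements.mulVec_padState {k : ℕ} {I : Implementation k}
    {V : Matrix (Bits k) (Bits k) ℂ} (h : I.Implements V) (φ : Bits k → ℂ) :
    Circuit.matrix I.circuit *ᵥ padState φ = padState (V *ᵥ φ) := by
  ext z
  obtain ⟨x, z, rfl⟩ := exists_append z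
  rw [QEnc.mulVec_padState, padState_append]
  split_ifs with hz
  · subst hz
    rw [← h.2]
    rfl
  · exact Finset.sum_eq_zero fun y _ => by rw [h.1 x y z hz, zero_mul]

theorem Implementation.clean_of_mulVec_padState {k w : ℕ} (c : Circuit (k + w))
    (T : (Bits k → ℂ) → Bits k → ℂ)
    (h : ∀ φ : Bits k → ℂ, Circuit.matrix c *ᵥ padState φ = padState (T φ)) :
    (⟨w, c⟩ : Implementation k).Clean ∧
      ∀ x y, (⟨w, c⟩ : Implementation k).matrix x y = T (Pi.single y 1) x := by
  have key : ∀ (x y : Bits k) (z : Bits w),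
      Circuit.matrix c (Fin.append x z) (Fin.append y (zeroBits w)) =
        if z = zeroBits w then T (Pi.single y 1) x else 0 := by
    intro x y z
    have := congrFun (h (Pi.single y 1)) (Fin.append x z)
    rw [QEnc.mulVec_padState, padState_append] at this
    simpa [Pi.single_apply] using this
  exact ⟨fun x y z hz => (key x y z).trans (if_neg hz), fun x y => (key x y _).trans (if_pos rfl)⟩

/-- The operation implemented by a clean circuit is unitary. -/
theorem Implementation.Implements.conjTranspose_mul {k : ℕ} {I : Implementation k}
    {V : Matrix (Bits k) (Bits k) ℂ} (h : I.Implements V) : Vᴴ * V = 1 := by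
  have hc := Circuit.inv_matrix_mul I.circuit
  rw [← Circuit.conjTranspose_matrix] at hc
  ext x y
  have h1 := congrFun (congrFun hc (Fin.append x (zeroBits I.work)))
    (Fin.append y (zeroBits I.work))
  have h2 : ∀ (x y : Bits k) z, Circuit.matrix I.circuit (Fin.append x z)
      (Fin.append y (zeroBits I.work)) = if z = zeroBits I.work then V x y else 0 := by
    intro x y z
    split_ifs with hz
    · rw [hz, ← h.2]; rfl
    · exact h.1 x y z hz
  have h3 : Fin.append x (zeroBits I.work) = Fin.append y (zeroBits I.work) ↔ x = y :=
    ⟨fun e => by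
      ext i
      simpa using congrFun e (Fin.castAdd I.work i), fun e => by rw [e]⟩
  simpa [Matrix.mul_apply, sum_append, h2, Matrix.one_apply, h3] using h1

/-- The state of a machine whose `n` wires are laid out by `e` as `q` main qubits, `r` auxiliary
qubits and `w` work qubits: the work qubits are in the state `|0⟩`, and `Φ` is the joint state of
the main and the auxiliary qubits. -/
def regState {q r w n : ℕ} (e : Fin q ⊕ Fin r ⊕ Fin w ≃ Fin n) (Φ : Bits q → Bits r → ℂ) :
    Bits n → ℂ := fun z =>
  if ∀ j, z (e (.inr (.inr j))) = false
  then Φ (fun i => z (e (.inl i))) (fun i => z (e (.inr (.inl i)))) else 0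

/-- The circuit `c` takes the register state `Φ` to the register state `Ψ`. -/
def Maps {q r w n : ℕ} (e : Fin q ⊕ Fin r ⊕ Fin w ≃ Fin n) (c : Circuit n)
    (Φ Ψ : Bits q → Bits r → ℂ) : Prop :=
  Circuit.matrix c *ᵥ regState e Φ = regState e Ψ

section Maps

variable {q r w n : ℕ} {e : Fin q ⊕ Fin r ⊕ Fin w ≃ Fin n}

theorem Maps.append {c d : Circuit n} {Φ Ψ Θ : Bits q → Bits r → ℂ} (hc : Maps e c Φ Ψ)
    (hd : Maps e d Ψ Θ) : Maps e (c ++ d) Φ Θ := by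
  rw [Maps, Circuit.matrix_append, ← Matrix.mulVec_mulVec, hc, hd]

theorem Maps.inv {c : Circuit n} {Φ Ψ : Bits q → Bits r → ℂ} (hc : Maps e c Φ Ψ) :
    Maps e (Circuit.inv c) Ψ Φ := by
  rw [Maps, ← hc, Matrix.mulVec_mulVec, Circuit.inv_matrix_mul, Matrix.one_mulVec]

theorem Maps.congr {c : Circuit n} {Φ Ψ Ψ' : Bits q → Bits r → ℂ} (hc : Maps e c Φ Ψ)
    (h : ∀ x s, Ψ x s = Ψ' x s) : Maps e c Φ Ψ' := by
  have : Ψ = Ψ' := by ext x s; exact h x s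
  rwa [← this]

theorem Maps.single (i : Fin r) (u : Matrix.unitaryGroup Bool ℂ) (Φ : Bits q → Bits r → ℂ) :
    Maps e [Gate.single (e (.inr (.inl i))) u] Φ
      (fun x s => ∑ b, (u : Matrix Bool Bool ℂ) (s i) b * Φ x (Function.update s i b)) := by
  ext z
  rw [Circuit.matrix_singleton, Gate.single_mulVec]
  have h : ∀ b, (fun j => Function.update z (e (.inr (.inl i))) b (e (.inr (.inl j)))) =
      Function.update (fun j => z (e (.inr (.inl j)))) i b := by
    intro b
    ext j
    by_cases hj : j = i
    · subst hj; simp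
    · simp [hj, e.injective.eq_iff]
  simp only [regState, h]
  simp only [Function.update_apply, e.injective.eq_iff, Sum.inr.injEq, reduceCtorEq, if_false]
  split_ifs <;> simp

theorem Maps.cnot (i j : Fin r) (hij : i ≠ j) (h : e (.inr (.inl i)) ≠ e (.inr (.inl j)))
    (Φ : Bits q → Bits r → ℂ) :
    Maps e [Gate.cnot (e (.inr (.inl i))) (e (.inr (.inl j))) h] Φ
      (fun x s => Φ x (Function.update s j (xor (s j) (s i)))) := by
  ext z
  rw [Circuit.matrix_singleton, Gate.cnot_mulVec]
  have h : ∀ b, (fun k => Function.update z (e (.inr (.inl j))) b (e (.inr (.inl k)))) =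
      Function.update (fun k => z (e (.inr (.inl k)))) j b := by
    intro b
    ext k
    by_cases hk : k = j
    · subst hk; simp
    · simp [hk, e.injective.eq_iff]
  simp only [regState, h]
  simp only [Function.update_apply, e.injective.eq_iff, Sum.inr.injEq, reduceCtorEq, if_false]

/-- The bits of a box's own wires, when the other wires carry the bits of `z`. -/
theorem extend_work {k v : ℕ} (f : Fin (k + v) ↪ Fin n) (g : Fin v → Fin w)
    (hw : ∀ j, f (Fin.natAdd k j) = e (.inr (.inr (g j))))
    (hm : ∀ i j, f (Fin.castAdd v i) ≠ e (.inr (.inr j)))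
    (y : Bits (k + v)) (z : Bits n) :
    (∀ j, Function.extend f y z (e (.inr (.inr j))) = false) ↔
      (∀ j, (∀ j', g j' ≠ j) → z (e (.inr (.inr j))) = false) ∧
        ∀ j', y (Fin.natAdd k j') = false := by
  have h1 : ∀ j', Function.extend f y z (e (.inr (.inr (g j')))) = y (Fin.natAdd k j') := by
    intro j'
    rw [← hw, f.injective.extend_apply]
  have h2 : ∀ j, (∀ j', g j' ≠ j) →
      Function.extend f y z (e (.inr (.inr j))) = z (e (.inr (.inr j))) := by
    intro j hj
    apply Function.extend_apply'
    rintro ⟨a, ha⟩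
    induction a using Fin.addCases with
    | left i => exact hm i j ha
    | right j' =>
      rw [hw, e.injective.eq_iff] at ha
      exact hj j' (by simpa using ha)
  constructor
  · intro h
    exact ⟨fun j hj => (h2 j hj).symm.trans (h j), fun j' => (h1 j').symm.trans (h _)⟩
  · rintro ⟨ha, hb⟩ j
    by_cases hj : ∀ j', g j' ≠ j
    · rw [h2 j hj, ha j hj]
    · push Not at hj
      obtain ⟨j', rfl⟩ := hj
      rw [h1, hb]

/-- The state after executing a box, if the register state looks like `φ z` to the box whenever
the other wires carry the bits of `z`. -/
theorem regState_box {k : ℕ} {I : Implementation k} {V : Matrix (Bits k) (Bits k) ℂ}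
    (hI : I.Implements V) (f : Fin (k + I.work) ↪ Fin n) (g : Fin I.work → Fin w)
    (hw : ∀ j, f (Fin.natAdd k j) = e (.inr (.inr (g j))))
    (hm : ∀ i j, f (Fin.castAdd I.work i) ≠ e (.inr (.inr j)))
    (Φ : Bits q → Bits r → ℂ) (φ : Bits n → Bits k → ℂ)
    (hφ : ∀ y z, Φ (fun i => Function.extend f y z (e (.inl i)))
      (fun i => Function.extend f y z (e (.inr (.inl i)))) = φ z (fun i => y (Fin.castAdd _ i)))
    (z : Bits n) :
    (Circuit.matrix (I.circuit.map (Gate.rewire f)) *ᵥ regState e Φ) z =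
      if ∀ j, z (e (.inr (.inr j))) = false
      then (V *ᵥ φ z) (fun i => z (f (Fin.castAdd _ i))) else 0 := by
  rw [Circuit.rewire_mulVec]
  by_cases hz : ∀ j, (∀ j', g j' ≠ j) → z (e (.inr (.inr j))) = false
  · have h1 : (fun y => regState e Φ (Function.extend f y z)) = padState (φ z) := by
      ext y
      simp only [regState, padState, extend_work f g hw hm, hφ, and_iff_right hz]
    rw [h1, hI.mulVec_padState, padState]
    congr 1
    simp only [hw, eq_iff_iff]
    refine ⟨fun h j => ?_, fun h j => h _⟩
    by_cases hj : ∀ j', g j' ≠ j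
    · exact hz j hj
    · push Not at hj
      obtain ⟨j', rfl⟩ := hj
      exact h j'
  · have h1 : (fun y => regState e Φ (Function.extend f y z)) = 0 := by
      ext y
      simp only [regState, extend_work f g hw hm, hz, false_and, if_false, Pi.zero_apply]
    rw [h1, Matrix.mulVec_zero, if_neg fun h => hz fun j _ => h j]
    rfl

/-- The effect of a circuit on the main qubits whose work qubits are among the work qubits of the
register state. -/
theorem Maps.box {I : Implementation q} {V : Matrix (Bits q) (Bits q) ℂ}
    (hI : I.Implements V) (f : Fin (q + I.work) ↪ Fin n) (g : Fin I.work → Fin w)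
    (hm : ∀ i, f (Fin.castAdd I.work i) = e (.inl i))
    (hw : ∀ j, f (Fin.natAdd q j) = e (.inr (.inr (g j))))
    (Φ : Bits q → Bits r → ℂ) :
    Maps e (I.circuit.map (Gate.rewire f)) Φ (fun x s => (V *ᵥ fun y => Φ y s) x) := by
  ext z
  rw [regState_box hI f g hw (fun i j => by rw [hm]; simp [e.injective.eq_iff]) Φ
    (fun z y => Φ y (fun i => z (e (.inr (.inl i)))))]
  · simp [regState, hm]
  · intro y z
    congr 1
    · ext i
      rw [← hm, f.injective.extend_apply]
    · ext i
      apply Function.extend_apply'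
      rintro ⟨a, ha⟩
      induction a using Fin.addCases with
      | left j => rw [hm, e.injective.eq_iff] at ha; simp at ha
      | right j => rw [hw, e.injective.eq_iff] at ha; simp at ha

theorem sum_snoc {k : ℕ} {β : Type*} [AddCommMonoid β] (F : Bits (k + 1) → β) :
    ∑ z, F z = ∑ x : Bits k, ∑ b : Bool, F (Fin.snoc x b) := by
  rw [← Fintype.sum_prod_type_right' (fun b x => F (Fin.snoc (α := fun _ => Bool) x b))]
  exact (Fintype.sum_equiv (Fin.snocEquiv fun _ => Bool) _ _ fun _ => rfl).symm

/-- The controlled NOT of a projection, applied to a state of main qubits and target. -/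
theorem projNot_mulVec {N m : ℕ} (P : Matrix (Fin N) (Bits m) ℂ) (φ : Bits (m + 1) → ℂ)
    (x : Bits (m + 1)) :
    (projNot P *ᵥ φ) x =
      ((1 - Pᴴ * P) *ᵥ fun y => φ (Fin.snoc y (x (Fin.last m)))) (fun i => x i.castSucc) +
      ((Pᴴ * P) *ᵥ fun y => φ (Fin.snoc y (!x (Fin.last m)))) (fun i => x i.castSucc) := by
  simp only [Matrix.mulVec, dotProduct, sum_snoc, ← Finset.sum_add_distrib, projNot,
    Matrix.of_apply, Fin.snoc_last, Fin.snoc_castSucc]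
  refine Finset.sum_congr rfl fun y _ => ?_
  cases x (Fin.last m) <;> simp [add_comm]

/-- The effect of the controlled NOT of a projection on the main qubits, with target `t`. -/
theorem Maps.flip {N : ℕ} {P : Matrix (Fin N) (Bits q) ℂ} {I : Implementation (q + 1)}
    (hI : I.Implements (projNot P)) (t : Fin r)
    (f : Fin (q + 1 + I.work) ↪ Fin n) (g : Fin I.work → Fin w)
    (hm : ∀ i : Fin q, f (Fin.castAdd I.work i.castSucc) = e (.inl i))
    (ht : f (Fin.castAdd I.work (Fin.last q)) = e (.inr (.inl t)))
    (hw : ∀ j, f (Fin.natAdd (q + 1) j) = e (.inr (.inr (g j))))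
    (Φ : Bits q → Bits r → ℂ) :
    Maps e (I.circuit.map (Gate.rewire f)) Φ (fun x s =>
      ((1 - Pᴴ * P) *ᵥ fun y => Φ y s) x +
      ((Pᴴ * P) *ᵥ fun y => Φ y (Function.update s t (!s t))) x) := by
  have hne : ∀ i j, f (Fin.castAdd I.work i) ≠ e (.inr (.inr j)) := by
    intro i j
    induction i using Fin.lastCases with
    | last => rw [ht]; simp [e.injective.eq_iff]
    | cast i => rw [hm]; simp [e.injective.eq_iff]
  ext z
  rw [regState_box hI f g hw hne Φ (fun z y => Φ (fun i => y i.castSucc)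
    (Function.update (fun i => z (e (.inr (.inl i)))) t (y (Fin.last q))))]
  · simp only [regState, projNot_mulVec, Fin.snoc_last, Fin.snoc_castSucc, hm, ht]
    congr 3
    simp
  · intro y z
    congr 1
    · ext i
      rw [← hm, f.injective.extend_apply]
    · ext i
      by_cases hi : i = t
      · subst hi
        rw [← ht, f.injective.extend_apply]
        simp
      rw [Function.update_of_ne hi]
      apply Function.extend_apply'
      rintro ⟨a, ha⟩
      induction a using Fin.addCases with
      | left j =>
        induction j using Fin.lastCases with
        | last => rw [ht, e.injective.eq_iff] at ha; simp [Ne.symm hi] at ha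
        | cast j => rw [hm, e.injective.eq_iff] at ha; simp at ha
      | right j => rw [hw, e.injective.eq_iff] at ha; simp at ha

theorem normSq_regState (Φ : Bits q → Bits r → ℂ) :
    normSq (regState e Φ) = ∑ x, ∑ s, ‖Φ x s‖ ^ 2 := by
  rw [normSq]
  let E : Bits q × Bits r × Bits w ≃ Bits n :=
    ((Equiv.refl _).prodCongr (Equiv.sumArrowEquivProdArrow _ _ _).symm).trans
      ((Equiv.sumArrowEquivProdArrow _ _ _).symm.trans (e.arrowCongr (Equiv.refl Bool)))
  rw [← Fintype.sum_equiv E _ _ fun _ => rfl, Fintype.sum_prod_type]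
  refine Finset.sum_congr rfl fun x _ => ?_
  rw [Fintype.sum_prod_type]
  refine Finset.sum_congr rfl fun s _ => ?_
  have h : ∀ y : Bits w, regState e Φ (E (x, s, y)) = if y = zeroBits w then Φ x s else 0 := by
    intro y
    simp [regState, E, Equiv.arrowCongr, Equiv.sumArrowEquivProdArrow, funext_iff, zeroBits]
  simp only [h]
  rw [Finset.sum_eq_single (zeroBits w)] <;> simp +contextual

end Maps

/-! ### One-qubit unitaries -/

/-- The real rotation by the angle `θ`. -/
noncomputable def rot (θ : ℝ) : Matrix.unitaryGroup Bool ℂ :=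
  ⟨Matrix.of fun a b => ((if a = b then Real.cos θ
      else if b then -Real.sin θ else Real.sin θ : ℝ) : ℂ), by
    rw [Matrix.mem_unitaryGroup_iff']
    have h := Real.cos_sq_add_sin_sq θ
    ext a b
    cases a <;> cases b <;>
      simp only [Matrix.mul_apply, Fintype.sum_bool, Matrix.star_apply, Matrix.of_apply,
        Matrix.one_apply, RCLike.star_def, Complex.conj_ofReal] <;>
      norm_cast <;> simp <;> linarith⟩

/-- The Pauli matrix `X`. -/
noncomputable def pauliX : Matrix.unitaryGroup Bool ℂ :=
  ⟨Matrix.of fun a b => if a = b then 0 else 1, by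
    rw [Matrix.mem_unitaryGroup_iff']
    ext a b
    cases a <;> cases b <;> simp [Matrix.mul_apply, Matrix.star_apply]⟩

/-- The Pauli matrix `Z`. -/
noncomputable def pauliZ : Matrix.unitaryGroup Bool ℂ :=
  ⟨Matrix.of fun a b => if a = b then (if a then -1 else 1) else 0, by
    rw [Matrix.mem_unitaryGroup_iff']
    ext a b
    cases a <;> cases b <;> simp [Matrix.mul_apply, Matrix.star_apply]⟩

theorem rot_apply (θ : ℝ) (a b : Bool) : (rot θ : Matrix Bool Bool ℂ) a b =
    if a = b then (Real.cos θ : ℂ) else if b then -(Real.sin θ : ℂ) else (Real.sin θ : ℂ) := by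
  simp only [rot, Matrix.of_apply]
  split_ifs <;> simp

section

variable {q r w n : ℕ} {e : Fin q ⊕ Fin r ⊕ Fin w ≃ Fin n}

theorem Maps.pauliX (i : Fin r) (Φ : Bits q → Bits r → ℂ) :
    Maps e [Gate.single (e (.inr (.inl i))) pauliX] Φ
      (fun x s => Φ x (Function.update s i (!s i))) := by
  refine (Maps.single i QEnc.pauliX Φ).congr fun x s => ?_
  cases h : s i <;> simp [QEnc.pauliX]

theorem Maps.pauliZ (i : Fin r) (Φ : Bits q → Bits r → ℂ) :
    Maps e [Gate.single (e (.inr (.inl i))) pauliZ] Φ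
      (fun x s => if s i then -Φ x s else Φ x s) := by
  refine (Maps.single i QEnc.pauliZ Φ).congr fun x s => ?_
  have : Function.update s i (s i) = s := by simp
  cases h : s i <;> rw [h] at this <;> simp [QEnc.pauliZ, this]

/-- The wire of the auxiliary qubit `i`. -/
abbrev aux (e : Fin q ⊕ Fin r ⊕ Fin w ≃ Fin n) (i : Fin r) : Fin n := e (.inr (.inl i))

theorem aux_ne {i j : Fin r} (h : i ≠ j) : aux e i ≠ aux e j := by
  simpa [aux, e.injective.eq_iff] using h

/-- The logical AND of the auxiliary qubits `i` and `j`, written into the auxiliary qubit `k`.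
The circuit is the Toffoli gate up to relative phases, which do not matter for a target in
state `|0⟩`. -/
noncomputable def andCircuit (e : Fin q ⊕ Fin r ⊕ Fin w ≃ Fin n) (i j k : Fin r) (hi : i ≠ k)
    (hj : j ≠ k) : Circuit n :=
  [.single (aux e k) (rot (Real.pi / 8)), .cnot (aux e j) (aux e k) (aux_ne hj),
    .single (aux e k) (rot (Real.pi / 8)), .cnot (aux e i) (aux e k) (aux_ne hi),
    .single (aux e k) (rot (-(Real.pi / 8))), .cnot (aux e j) (aux e k) (aux_ne hj),
    .single (aux e k) (rot (-(Real.pi / 8)))]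

theorem Maps.cons {g : Gate n} {d : Circuit n} {Φ Ψ Θ : Bits q → Bits r → ℂ}
    (hc : Maps e [g] Φ Ψ) (hd : Maps e d Ψ Θ) : Maps e (g :: d) Φ Θ :=
  hc.append hd

/-- The target `k`, initially in state `|0⟩`, becomes the logical AND of `i` and `j`: the new
amplitude is supported on `s k = (s i && s j)`. -/
theorem Maps.and (i j k : Fin r) (hi : i ≠ k) (hj : j ≠ k) (Φ : Bits q → Bits r → ℂ)
    (hΦ : ∀ x s, s k = true → Φ x s = 0) :
    Maps e (andCircuit e i j k hi hj) Φ
      (fun x s => if s k = (s i && s j) then Φ x (Function.update s k false) else 0) := by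
  have h := (Maps.single (e := e) k (rot (Real.pi / 8)) Φ).cons <|
    (Maps.cnot j k hj (aux_ne hj) _).cons <| (Maps.single k (rot (Real.pi / 8)) _).cons <|
    (Maps.cnot i k hi (aux_ne hi) _).cons <| (Maps.single k (rot (-(Real.pi / 8))) _).cons <|
    (Maps.cnot j k hj (aux_ne hj) _).cons <| Maps.single k (rot (-(Real.pi / 8))) _
  refine h.congr fun x s => ?_
  have h0 : Φ x (Function.update s k true) = 0 := hΦ _ _ (by simp)
  have h1 : ((Real.cos (Real.pi / 8) : ℝ) : ℂ) ^ 2 + ((Real.sin (Real.pi / 8) : ℝ) : ℂ) ^ 2 = 1 := by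
    exact_mod_cast Real.cos_sq_add_sin_sq _
  -- the angle `π / 8` makes the fourfold rotation a quarter turn
  have h2 : ((Real.cos (Real.pi / 8) : ℝ) : ℂ) ^ 2 - ((Real.sin (Real.pi / 8) : ℝ) : ℂ) ^ 2 =
      2 * (Real.sin (Real.pi / 8) : ℝ) * (Real.cos (Real.pi / 8) : ℝ) := by
    have h3 := Real.cos_two_mul' (Real.pi / 8)
    have h4 := Real.sin_two_mul (Real.pi / 8)
    rw [show 2 * (Real.pi / 8) = Real.pi / 4 by ring] at h3 h4
    rw [Real.cos_pi_div_four] at h3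
    rw [Real.sin_pi_div_four] at h4
    exact_mod_cast h3.symm.trans h4
  generalize hC : ((Real.cos (Real.pi / 8) : ℝ) : ℂ) = C at h1 h2
  generalize hS : ((Real.sin (Real.pi / 8) : ℝ) : ℂ) = S at h1 h2
  simp only [Fintype.sum_bool, Function.update_self, Function.update_idem,
    Function.update_of_ne hi, Function.update_of_ne hj, rot_apply, Real.cos_neg, Real.sin_neg,
    Complex.ofReal_neg, hC, hS]
  generalize Φ x (Function.update s k false) = f
  clear h
  cases s i <;> cases s j <;> cases s k <;> simp [h0] <;> grind

end

/-! ### Controlled NOT of `Π ⊗ ⟨00|` -/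

section

variable {q w n : ℕ} {e : Fin q ⊕ Fin 6 ⊕ Fin w ≃ Fin n}

/-- The register state in which the auxiliary qubits `0`, `1`, `2` are in the joint state `Θ` with
the main qubits, and the auxiliary qubits `3`, `4`, `5` in the state `|0⟩`. -/
def ext3 (Θ : Bits q → Bool → Bool → Bool → ℂ) : Bits q → Bits 6 → ℂ := fun x s =>
  if s 3 = false ∧ s 4 = false ∧ s 5 = false then Θ x (s 0) (s 1) (s 2) else 0

/-- The register state in which the auxiliary qubits `0` and `1` are in the joint state `Θ` with
the main qubits, and all others in the state `|0⟩`. -/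
def ext2 (Θ : Bits q → Bool → Bool → ℂ) : Bits q → Bits 6 → ℂ :=
  ext3 fun x a b t => if t then 0 else Θ x a b

/-- The computation of the condition `E ∧ a₀ = 0 ∧ a₁ = 0` into the auxiliary qubit `5`, where the
circuit `c` flips the auxiliary qubit `3` on the range of `E`. -/
noncomputable def conditionCircuit (e : Fin q ⊕ Fin 6 ⊕ Fin w ≃ Fin n) (c : Circuit n) :
    Circuit n :=
  c ++ ([.single (aux e 0) pauliX] ++ ([.single (aux e 1) pauliX] ++
    (andCircuit e 3 0 4 (by decide) (by decide) ++ andCircuit e 4 1 5 (by decide) (by decide))))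

/-- A circuit flipping the auxiliary qubit `2` on the range of `E ⊗ |00⟩⟨00|`. -/
noncomputable def condNotCircuit (e : Fin q ⊕ Fin 6 ⊕ Fin w ≃ Fin n) (c : Circuit n) :
    Circuit n :=
  conditionCircuit e c ++ ([.cnot (aux e 5) (aux e 2) (aux_ne (by decide))] ++
    Circuit.inv (conditionCircuit e c))

/-- The circuit `c` flips the auxiliary qubit `3` on the range of `E`. -/
def FlipsThree (e : Fin q ⊕ Fin 6 ⊕ Fin w ≃ Fin n) (c : Circuit n)
    (E : Matrix (Bits q) (Bits q) ℂ) : Prop :=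
  ∀ Φ, Maps e c Φ fun x s => ((1 - E) *ᵥ fun y => Φ y s) x +
    (E *ᵥ fun y => Φ y (Function.update s 3 (!s 3))) x

/-- The state after the condition has been computed: the auxiliary qubits `0` and `1` are negated,
`3` holds the outcome of `E`, and `5` holds the condition. -/
theorem FlipsThree.conditionCircuit {c : Circuit n} {E : Matrix (Bits q) (Bits q) ℂ}
    (h : FlipsThree e c E) (Θ : Bits q → Bool → Bool → Bool → ℂ) :
    Maps e (conditionCircuit e c) (ext3 Θ) fun x s =>
      if s 4 = (s 3 && s 0) ∧ s 5 = (s 4 && s 1) then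
        (if s 3 then (E *ᵥ fun y => Θ y (!s 0) (!s 1) (s 2)) x
          else ((1 - E) *ᵥ fun y => Θ y (!s 0) (!s 1) (s 2)) x) else 0 := by
  have h1 : Maps e c (ext3 Θ) fun x s => if s 4 = false ∧ s 5 = false then
        (if s 3 then (E *ᵥ fun y => Θ y (s 0) (s 1) (s 2)) x
          else ((1 - E) *ᵥ fun y => Θ y (s 0) (s 1) (s 2)) x) else 0 := by
    refine (h _).congr fun x s => ?_
    have h0 : ∀ A : Matrix (Bits q) (Bits q) ℂ, (A *ᵥ fun _ => (0 : ℂ)) x = 0 := fun A =>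
      congrFun (Matrix.mulVec_zero A) x
    by_cases h45 : s 4 = false ∧ s 5 = false
    · cases h3 : s 3 <;> simp [ext3, h45, h3, h0]
    · simp only [ext3, Function.update_apply]
      simp [h45, h0]
  refine h1.append (((Maps.pauliX 0 _).append ((Maps.pauliX 1 _).append
    ((Maps.and 3 0 4 (by decide) (by decide) _ ?_).append
    (Maps.and 4 1 5 (by decide) (by decide) _ ?_)))).congr ?_)
  · intro x s hs
    simp [hs]
  · intro x s hs
    simp [hs]
  · intro x s
    simp only [Function.update_apply]
    simp
    grind

theorem FlipsThree.condNotCircuit {c : Circuit n} {E : Matrix (Bits q) (Bits q) ℂ}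
    (h : FlipsThree e c E) (hE : E * E = E) (Θ : Bits q → Bool → Bool → Bool → ℂ) :
    Maps e (condNotCircuit e c) (ext3 Θ) (ext3 fun x a b t =>
      if a = false ∧ b = false then
        ((1 - E) *ᵥ fun y => Θ y a b t) x + (E *ᵥ fun y => Θ y a b (!t)) x
      else Θ x a b t) := by
  refine (h.conditionCircuit Θ).append ((((Maps.cnot 5 2 (by decide) _ _)).congr ?_).append
    (h.conditionCircuit _).inv)
  intro x s
  have hE' : E * (1 - E) = 0 := by rw [mul_sub, hE, mul_one, sub_self]
  have hE2 : (1 - E) * E = 0 := by rw [sub_mul, hE, one_mul, sub_self]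
  have hE3 : (1 - E) * (1 - E) = 1 - E := by rw [mul_sub, hE2, mul_one, sub_zero]
  have k1 : ∀ φ χ : Bits q → ℂ, (E *ᵥ fun y => ((1 - E) *ᵥ φ) y + (E *ᵥ χ) y) = E *ᵥ χ := by
    intro φ χ
    rw [show (fun y => ((1 - E) *ᵥ φ) y + (E *ᵥ χ) y) = (1 - E) *ᵥ φ + E *ᵥ χ from rfl,
      Matrix.mulVec_add, Matrix.mulVec_mulVec, Matrix.mulVec_mulVec, hE', hE, Matrix.zero_mulVec,
      zero_add]
  have k2 : ∀ φ χ : Bits q → ℂ,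
      ((1 - E) *ᵥ fun y => ((1 - E) *ᵥ φ) y + (E *ᵥ χ) y) = (1 - E) *ᵥ φ := by
    intro φ χ
    rw [show (fun y => ((1 - E) *ᵥ φ) y + (E *ᵥ χ) y) = (1 - E) *ᵥ φ + E *ᵥ χ from rfl,
      Matrix.mulVec_add, Matrix.mulVec_mulVec, Matrix.mulVec_mulVec, hE2, hE3, Matrix.zero_mulVec,
      add_zero]
  cases h0 : s 0 <;> cases h1 : s 1 <;> cases h3 : s 3 <;> cases h4 : s 4 <;> cases h5 : s 5 <;>
    simp [h0, h1, h3, h4, h5, k1, k2]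

/-- A circuit for the reflection `1 - 2 E ⊗ |00⟩⟨00|`: a phase flip of the auxiliary qubit `2`,
conjugated by the controlled NOT of `E ⊗ |00⟩⟨00|`. -/
noncomputable def reflectCircuit (e : Fin q ⊕ Fin 6 ⊕ Fin w ≃ Fin n) (c : Circuit n) :
    Circuit n :=
  condNotCircuit e c ++ ([.single (aux e 2) pauliZ] ++ condNotCircuit e c)

theorem FlipsThree.reflectCircuit {c : Circuit n} {E : Matrix (Bits q) (Bits q) ℂ}
    (h : FlipsThree e c E) (hE : E * E = E) (Θ : Bits q → Bool → Bool → ℂ) :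
    Maps e (reflectCircuit e c) (ext2 Θ) (ext2 fun x a b =>
      if a = false ∧ b = false then Θ x a b - 2 * (E *ᵥ fun y => Θ y a b) x else Θ x a b) := by
  refine (h.condNotCircuit hE _).append ((Maps.congr (Ψ' := ext3 ?_) (Maps.pauliZ 2 _) ?_).append
    ((h.condNotCircuit hE _).congr ?_))
  · exact fun x a b t => if a = false ∧ b = false then
      (if t then -(E *ᵥ fun y => Θ y a b) x else ((1 - E) *ᵥ fun y => Θ y a b) x)
      else (if t then 0 else Θ x a b)
  · intro x s
    have h0 : ∀ A : Matrix (Bits q) (Bits q) ℂ, (A *ᵥ fun _ => (0 : ℂ)) x = 0 := fun A =>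
      congrFun (Matrix.mulVec_zero A) x
    simp only [ext3]
    cases h2 : s 2 <;> simp [h0]
    split_ifs <;> simp
  · intro x s
    have hE' : E * (1 - E) = 0 := by rw [mul_sub, hE, mul_one, sub_self]
    have hE2 : (1 - E) * E = 0 := by rw [sub_mul, hE, one_mul, sub_self]
    have hE3 : (1 - E) * (1 - E) = 1 - E := by rw [mul_sub, hE2, mul_one, sub_zero]
    have k1 : ∀ (A : Matrix (Bits q) (Bits q) ℂ) (φ : Bits q → ℂ),
        (A *ᵥ fun y => -(E *ᵥ φ) y) = -((A * E) *ᵥ φ) := by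
      intro A φ
      rw [show (fun y => -(E *ᵥ φ) y) = -(E *ᵥ φ) from rfl, Matrix.mulVec_neg,
        Matrix.mulVec_mulVec]
    have k2 : ∀ (A : Matrix (Bits q) (Bits q) ℂ) (φ : Bits q → ℂ),
        (A *ᵥ fun y => ((1 - E) *ᵥ φ) y) = (A * (1 - E)) *ᵥ φ := by
      intro A φ
      rw [show (fun y => ((1 - E) *ᵥ φ) y) = (1 - E) *ᵥ φ from rfl, Matrix.mulVec_mulVec]
    have k3 : ∀ (φ : Bits q → ℂ), ((1 - E) *ᵥ φ) x = φ x - (E *ᵥ φ) x := by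
      intro φ
      rw [Matrix.sub_mulVec, Matrix.one_mulVec, Pi.sub_apply]
    simp only [ext3, ext2]
    by_cases hb : s 0 = false ∧ s 1 = false
    · cases h2 : s 2
      · simp [hb, k1, k2, hE, hE3]
        simp only [k3]
        congr 1
        ring
      · simp [hb, k1, k2, hE', hE2]
    · cases h2 : s 2 <;> simp [hb]

end

/-! ### Amplitude amplification -/

/-- The coefficients of the good and of the bad part of the initial state after `k` Grover
iterations, as polynomials in the initial success probability. -/
noncomputable def amp : ℕ → ℝ[X] × ℝ[X]
  | 0 => (1, 1)
  | k + 1 =>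
    (-(1 - 2 * Polynomial.X) * (amp k).1 - 2 * (1 - Polynomial.X) * (amp k).2,
      2 * Polynomial.X * (amp k).1 - (1 - 2 * Polynomial.X) * (amp k).2)

section

variable {q w n : ℕ} {e : Fin q ⊕ Fin 6 ⊕ Fin w ≃ Fin n}

/-- The joint states of the main qubits and two ancillas. -/
abbrev AncState (q : ℕ) : Type := Bits q → Bool → Bool → ℂ

/-- The operation `U` on the main qubits, together with the rotation by `θ` of the first ancilla. -/
noncomputable def prepMap (θ : ℝ) (U : Matrix (Bits q) (Bits q) ℂ) :
    AncState q →ₗ[ℂ] AncState q where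
  toFun Θ x a b := ∑ a', (rot θ : Matrix Bool Bool ℂ) a a' * (U *ᵥ fun y => Θ y a' b) x
  map_add' Θ Θ' := by
    ext x a b
    simp only [Matrix.mulVec, dotProduct, Pi.add_apply, mul_add, Finset.sum_add_distrib]
  map_smul' c Θ := by
    ext x a b
    simp only [Matrix.mulVec, dotProduct, Pi.smul_apply, smul_eq_mul, RingHom.id_apply,
      Finset.mul_sum, mul_left_comm _ c]

/-- The reflection `1 - 2 E ⊗ |00⟩⟨00|`. -/
noncomputable def reflMap (E : Matrix (Bits q) (Bits q) ℂ) : AncState q →ₗ[ℂ] AncState q where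
  toFun Θ x a b :=
    if a = false ∧ b = false then Θ x a b - 2 * (E *ᵥ fun y => Θ y a b) x else Θ x a b
  map_add' Θ Θ' := by
    ext x a b
    simp only [Matrix.mulVec, dotProduct, Pi.add_apply, mul_add, Finset.sum_add_distrib]
    split_ifs
    · ring
    · rfl
  map_smul' c Θ := by
    ext x a b
    simp only [Matrix.mulVec, dotProduct, Pi.smul_apply, smul_eq_mul, RingHom.id_apply,
      Finset.mul_sum, mul_left_comm _ c]
    split_ifs
    · rw [mul_sub, Finset.mul_sum]
    · rfl

theorem prepMap_prepMap_neg (θ : ℝ) {U : Matrix (Bits q) (Bits q) ℂ} (hU : U * Uᴴ = 1)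
    (Θ : AncState q) : prepMap θ U (prepMap (-θ) Uᴴ Θ) = Θ := by
  ext x a b
  have h1 : ((Real.cos θ : ℝ) : ℂ) ^ 2 + ((Real.sin θ : ℝ) : ℂ) ^ 2 = 1 := by
    exact_mod_cast Real.cos_sq_add_sin_sq _
  have h2 : ∀ (c d : ℂ) (φ χ : Bits q → ℂ),
      (U *ᵥ fun y => c * (Uᴴ *ᵥ φ) y + d * (Uᴴ *ᵥ χ) y) x = c * φ x + d * χ x := by
    intro c d φ χ
    rw [show (fun y => c * (Uᴴ *ᵥ φ) y + d * (Uᴴ *ᵥ χ) y) = c • (Uᴴ *ᵥ φ) + d • (Uᴴ *ᵥ χ) from rfl,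
      Matrix.mulVec_add, Matrix.mulVec_smul, Matrix.mulVec_smul, Matrix.mulVec_mulVec,
      Matrix.mulVec_mulVec, hU, Matrix.one_mulVec, Matrix.one_mulVec]
    rfl
  simp only [prepMap, LinearMap.coe_mk, AddHom.coe_mk, Fintype.sum_bool, h2, rot_apply,
    Real.cos_neg, Real.sin_neg]
  cases a <;> simp only [if_true, if_false, Bool.false_eq_true, Complex.ofReal_neg, reduceCtorEq]
  · linear_combination (Θ x false b) * h1
  · linear_combination (Θ x true b) * h1

/-- A circuit for `prepMap`, given a circuit for `U`. -/
noncomputable def prepCircuit (e : Fin q ⊕ Fin 6 ⊕ Fin w ≃ Fin n) (c : Circuit n) (θ : ℝ) :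
    Circuit n := c ++ [.single (aux e 0) (rot θ)]

/-- The circuit `c` executes `U` on the main qubits. -/
def ActsOnMain (e : Fin q ⊕ Fin 6 ⊕ Fin w ≃ Fin n) (c : Circuit n)
    (U : Matrix (Bits q) (Bits q) ℂ) : Prop :=
  ∀ Φ : Bits q → Bits 6 → ℂ, Maps e c Φ fun x s => (U *ᵥ fun y => Φ y s) x

theorem ActsOnMain.prepCircuit {c : Circuit n} {U : Matrix (Bits q) (Bits q) ℂ}
    (h : ActsOnMain e c U) (θ : ℝ) (Θ : AncState q) :
    Maps e (prepCircuit e c θ) (ext2 Θ) (ext2 (prepMap θ U Θ)) := by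
  refine (h _).append ((Maps.single 0 (rot θ) _).congr fun x s => ?_)
  have h0 : ∀ A : Matrix (Bits q) (Bits q) ℂ, (A *ᵥ fun _ => (0 : ℂ)) x = 0 := fun A =>
    congrFun (Matrix.mulVec_zero A) x
  simp only [ext2, ext3, prepMap, Function.update_apply]
  by_cases hs : s 3 = false ∧ s 4 = false ∧ s 5 = false
  · cases s 2 <;> simp [hs, h0]
  · simp [hs, h0]

theorem Maps.reflect {c : Circuit n} {E : Matrix (Bits q) (Bits q) ℂ}
    (h : FlipsThree e c E) (hE : E * E = E) (Θ : AncState q) :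
    Maps e (reflectCircuit e c) (ext2 Θ) (ext2 (reflMap E Θ)) :=
  h.reflectCircuit hE Θ

/-- Preparation followed by `k` Grover iterations. -/
noncomputable def groverCircuit (e : Fin q ⊕ Fin 6 ⊕ Fin w ≃ Fin n) (cU cZ cP : Circuit n) (θ : ℝ) :
    ℕ → Circuit n
  | 0 => prepCircuit e cU θ
  | k + 1 => groverCircuit e cU cZ cP θ k ++ (reflectCircuit e cP ++
      (Circuit.inv (prepCircuit e cU θ) ++ (reflectCircuit e cZ ++ prepCircuit e cU θ)))

/-- A Grover iteration, for the initial state prepared by `prepMap θ U`: the reflection about the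
range of `E ⊗ |00⟩⟨00|`, followed by the reflection about the initial state. -/
noncomputable def groverMap (θ : ℝ) (U Z E : Matrix (Bits q) (Bits q) ℂ) :
    AncState q →ₗ[ℂ] AncState q :=
  prepMap θ U ∘ₗ reflMap Z ∘ₗ prepMap (-θ) Uᴴ ∘ₗ reflMap E

theorem Maps.grover {cU cZ cP : Circuit n} {U Z E : Matrix (Bits q) (Bits q) ℂ}
    (hU : ActsOnMain e cU U) (hZ : FlipsThree e cZ Z) (hP : FlipsThree e cP E)
    (hUU : U * Uᴴ = 1) (hZZ : Z * Z = Z) (hEE : E * E = E) (θ : ℝ) (k : ℕ) (Θ : AncState q) :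
    Maps e (groverCircuit e cU cZ cP θ k) (ext2 Θ)
      (ext2 ((groverMap θ U Z E)^[k] (prepMap θ U Θ))) := by
  induction k with
  | zero => exact hU.prepCircuit θ Θ
  | succ k ih =>
    rw [Function.iterate_succ_apply']
    generalize (groverMap θ U Z E)^[k] (prepMap θ U Θ) = Ψ at ih ⊢
    have h := (hU.prepCircuit θ (prepMap (-θ) Uᴴ (reflMap E Ψ))).inv
    rw [prepMap_prepMap_neg θ hUU] at h
    exact ih.append ((Maps.reflect hP hEE Ψ).append (h.append
      ((Maps.reflect hZ hZZ _).append (hU.prepCircuit θ _))))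

/-- The initial state `|0⟩`. -/
noncomputable def zeroState (q : ℕ) : AncState q := fun x a b =>
  if x = zeroBits q ∧ a = false ∧ b = false then 1 else 0

/-- The good part of the prepared state, its component in the range of `E ⊗ |00⟩⟨00|`. -/
noncomputable def goodPart (θ : ℝ) (U E : Matrix (Bits q) (Bits q) ℂ) : AncState q := fun x a b =>
  if a = false ∧ b = false then (Real.cos θ : ℂ) * (E *ᵥ fun y => U y (zeroBits q)) x else 0

theorem prepMap_zeroState (θ : ℝ) (U : Matrix (Bits q) (Bits q) ℂ) (x : Bits q) (a b : Bool) :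
    prepMap θ U (zeroState q) x a b =
      if b then 0 else (rot θ : Matrix Bool Bool ℂ) a false * U x (zeroBits q) := by
  cases b <;>
    simp [prepMap, zeroState, Matrix.mulVec, dotProduct]

theorem mulVec_const_mul {ι κ : Type*} [Fintype ι] (A : Matrix κ ι ℂ) (c : ℂ) (φ : ι → ℂ) (x : κ) :
    (A *ᵥ fun y => c * φ y) x = c * (A *ᵥ φ) x :=
  congrFun (Matrix.mulVec_smul A c φ) x

theorem reflMap_goodPart (θ : ℝ) {U E : Matrix (Bits q) (Bits q) ℂ} (hEE : E * E = E) :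
    reflMap E (goodPart θ U E) = -goodPart θ U E := by
  ext x a b
  simp only [reflMap, goodPart, LinearMap.coe_mk, AddHom.coe_mk, Pi.neg_apply]
  split_ifs with h
  · simp only [mulVec_const_mul]
    rw [Matrix.mulVec_mulVec, hEE]
    ring
  · simp

theorem reflMap_prepMap (θ : ℝ) {U E : Matrix (Bits q) (Bits q) ℂ} :
    reflMap E (prepMap θ U (zeroState q)) =
      prepMap θ U (zeroState q) - (2 : ℂ) • goodPart θ U E := by
  ext x a b
  simp only [reflMap, goodPart, LinearMap.coe_mk, AddHom.coe_mk, Pi.sub_apply, Pi.smul_apply,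
    prepMap_zeroState, smul_eq_mul]
  split_ifs with h h'
  · simp_all
  · simp only [h, mulVec_const_mul]
    simp [rot_apply]
  · simp
  · simp

/-- The reflection about `|0⟩`. -/
theorem reflMap_braZero (Θ : AncState q) :
    reflMap ((braZero q)ᴴ * braZero q) Θ =
      Θ - (2 * Θ (zeroBits q) false false) • zeroState q := by
  ext x a b
  have h : ∀ φ : Bits q → ℂ, (((braZero q)ᴴ * braZero q) *ᵥ φ) x =
      if x = zeroBits q then φ (zeroBits q) else 0 := by
    intro φ
    simp [Matrix.mulVec, dotProduct, Matrix.mul_apply, braZero]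
  simp only [reflMap, LinearMap.coe_mk, AddHom.coe_mk, h, zeroState, Pi.sub_apply, Pi.smul_apply,
    smul_eq_mul]
  by_cases hx : x = zeroBits q <;> cases a <;> cases b <;> simp [hx]

/-- Amplitude amplification acts on the plane spanned by the good and the bad part of the prepared
state, as described by the polynomials `amp k` in the success probability `cos θ ^ 2 * p₀`. -/
theorem groverMap_iterate (θ p₀ : ℝ) {U E : Matrix (Bits q) (Bits q) ℂ} (hUU : Uᴴ * U = 1)
    (hUU' : U * Uᴴ = 1)
    (hEE : E * E = E)
    (hp : (Uᴴ *ᵥ E *ᵥ fun y => U y (zeroBits q)) (zeroBits q) = p₀) (k : ℕ) :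
    (groverMap θ U ((braZero q)ᴴ * braZero q) E)^[k] (prepMap θ U (zeroState q)) =
      (((amp k).1.eval (Real.cos θ ^ 2 * p₀) : ℝ) : ℂ) • goodPart θ U E +
      (((amp k).2.eval (Real.cos θ ^ 2 * p₀) : ℝ) : ℂ) •
        (prepMap θ U (zeroState q) - goodPart θ U E) := by
  have hU0 : (Uᴴ *ᵥ fun y => U y (zeroBits q)) (zeroBits q) = 1 := by
    have := congrFun (congrFun hUU (zeroBits q)) (zeroBits q)
    simpa [Matrix.mul_apply, Matrix.mulVec, dotProduct] using this
  have h1 : prepMap (-θ) Uᴴ (goodPart θ U E) (zeroBits q) false false =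
      ((Real.cos θ ^ 2 * p₀ : ℝ) : ℂ) := by
    have h0 : (Uᴴ *ᵥ fun _ => (0 : ℂ)) (zeroBits q) = 0 :=
      congrFun (Matrix.mulVec_zero Uᴴ) (zeroBits q)
    rw [Matrix.mulVec_mulVec] at hp
    simp [prepMap, goodPart, mulVec_const_mul, rot_apply, h0]
    rw [hp]
    ring
  have h2 : prepMap (-θ) Uᴴ (prepMap θ U (zeroState q)) (zeroBits q) false false = 1 := by
    have := prepMap_prepMap_neg (q := q) (-θ) (U := Uᴴ) (by simpa using hUU) (zeroState q)
    rw [neg_neg, Matrix.conjTranspose_conjTranspose] at this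
    rw [this]
    simp [zeroState]
  induction k with
  | zero => simp [amp]
  | succ k ih =>
    rw [Function.iterate_succ_apply', ih]
    generalize hα : (amp k).1.eval (Real.cos θ ^ 2 * p₀) = α
    generalize hβ : (amp k).2.eval (Real.cos θ ^ 2 * p₀) = β
    simp only [groverMap, LinearMap.comp_apply, map_add, map_sub, map_smul, reflMap_goodPart θ hEE,
      reflMap_prepMap, reflMap_braZero, prepMap_prepMap_neg θ hUU', map_neg, h1, h2]
    simp only [amp, Polynomial.eval_sub, Polynomial.eval_mul, Polynomial.eval_neg,
      Polynomial.eval_one, Polynomial.eval_X, Polynomial.eval_ofNat, hα, hβ]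
    generalize Real.cos θ ^ 2 * p₀ = p
    push_cast
    module

/-- The Grover iterations, followed by a rotation of the second ancilla. -/
noncomputable def amplifyCircuit (e : Fin q ⊕ Fin 6 ⊕ Fin w ≃ Fin n) (cU cZ cP : Circuit n)
    (θ θ' : ℝ) (k : ℕ) : Circuit n :=
  groverCircuit e cU cZ cP θ k ++ [.single (aux e 1) (rot θ')]

theorem Maps.amplify {cU cZ cP : Circuit n} {U Z E : Matrix (Bits q) (Bits q) ℂ}
    (hU : ActsOnMain e cU U) (hZ : FlipsThree e cZ Z) (hP : FlipsThree e cP E)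
    (hUU : U * Uᴴ = 1) (hZZ : Z * Z = Z) (hEE : E * E = E) (θ θ' : ℝ) (k : ℕ) (Θ : AncState q) :
    Maps e (amplifyCircuit e cU cZ cP θ θ' k) (ext2 Θ)
      (ext2 fun x a b => ∑ b', (rot θ' : Matrix Bool Bool ℂ) b b' *
        (groverMap θ U Z E)^[k] (prepMap θ U Θ) x a b') := by
  refine (Maps.grover hU hZ hP hUU hZZ hEE θ k Θ).append
    ((Maps.single 1 (rot θ') _).congr fun x s => ?_)
  simp only [ext2, ext3, Function.update_apply]
  by_cases hs : s 3 = false ∧ s 4 = false ∧ s 5 = false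
  · cases s 2 <;> simp [hs]
  · simp [hs]

/-- The projection `P ⊗ ⟨00|` annihilates the bad part of the amplified state, so only the first
polynomial of `amp k` remains. -/
theorem amplified_proj {N : ℕ} (θ θ' p₀ : ℝ) {U : Matrix (Bits q) (Bits q) ℂ}
    {P : Matrix (Fin N) (Bits q) ℂ} (hP : P * Pᴴ = 1) (hUU : Uᴴ * U = 1) (hUU' : U * Uᴴ = 1)
    (hp : (Uᴴ *ᵥ (Pᴴ * P) *ᵥ fun y => U y (zeroBits q)) (zeroBits q) = p₀) (k : ℕ) :
    (P *ᵥ fun x => ∑ b', (rot θ' : Matrix Bool Bool ℂ) false b' *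
      (groverMap θ U ((braZero q)ᴴ * braZero q) (Pᴴ * P))^[k]
        (prepMap θ U (zeroState q)) x false b') =
    ((Real.cos θ' * Real.cos θ * (amp k).1.eval (Real.cos θ ^ 2 * p₀) : ℝ) : ℂ) •
      (P *ᵥ fun y => U y (zeroBits q)) := by
  have hEE : (Pᴴ * P) * (Pᴴ * P) = Pᴴ * P := by
    rw [Matrix.mul_assoc, ← Matrix.mul_assoc P, hP, Matrix.one_mul]
  have hPE : P * (Pᴴ * P) = P := by rw [← Matrix.mul_assoc, hP, Matrix.one_mul]
  rw [groverMap_iterate θ p₀ hUU hUU' hEE hp]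
  generalize (amp k).1.eval (Real.cos θ ^ 2 * p₀) = α
  generalize (amp k).2.eval (Real.cos θ ^ 2 * p₀) = β
  have h : (fun x => ∑ b', (rot θ' : Matrix Bool Bool ℂ) false b' *
      (((α : ℂ) • goodPart θ U (Pᴴ * P) +
        (β : ℂ) • (prepMap θ U (zeroState q) - goodPart θ U (Pᴴ * P))) x false b')) =
      ((Real.cos θ' : ℂ) * Real.cos θ) •
        ((α : ℂ) • ((Pᴴ * P) *ᵥ fun y => U y (zeroBits q)) +
        (β : ℂ) • ((fun y => U y (zeroBits q)) - (Pᴴ * P) *ᵥ fun y => U y (zeroBits q))) := by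
    ext x
    simp [goodPart, prepMap_zeroState, rot_apply]
    ring
  rw [h]
  simp only [Matrix.mulVec_smul, Matrix.mulVec_add, Matrix.mulVec_sub, Matrix.mulVec_mulVec, hPE,
    sub_self, smul_zero, add_zero, smul_smul]
  push_cast
  rfl

end

/-! ### Wire layouts -/

/-- The wires in the order: main qubits, auxiliary qubits, work qubits. -/
def layout {q w n : ℕ} (h : q + (6 + w) = n) : Fin q ⊕ Fin 6 ⊕ Fin w ≃ Fin n :=
  (((Equiv.refl _).sumCongr finSumFinEquiv).trans finSumFinEquiv).trans (finCongr h)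

section

variable {q w n : ℕ}

theorem layout_main (h : q + (6 + w) = n) (i : Fin q) :
    (layout h (.inl i)).val = i := by simp [layout]

theorem layout_aux (h : q + (6 + w) = n) (i : Fin 6) :
    (layout h (.inr (.inl i))).val = q + i := by simp [layout]

theorem layout_work (h : q + (6 + w) = n) (j : Fin w) :
    (layout h (.inr (.inr j))).val = q + (6 + j) := by simp [layout]

/-- A state of the main qubits and two ancillas, as a state of `q + 2` qubits. -/
def ofAnc (Θ : AncState q) : Bits (q + 2) → ℂ := fun y =>
  Θ (fun i => y (Fin.castAdd 2 i)) (y (Fin.natAdd q 0)) (y (Fin.natAdd q 1))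

/-- A state of the main qubits, two ancillas and a target, as a state of `q + 2 + 1` qubits. -/
def ofAncTarget (Θ : Bits q → Bool → Bool → Bool → ℂ) : Bits (q + 2 + 1) → ℂ := fun y =>
  Θ (fun i => y (Fin.castAdd 2 i).castSucc) (y (Fin.natAdd q 0).castSucc)
    (y (Fin.natAdd q 1).castSucc) (y (Fin.last _))

theorem forall_work {m : ℕ} (P : Fin (m + w) → Prop) :
    (∀ j, P j) ↔ (∀ j, P (Fin.natAdd m j)) ∧ ∀ i, P (Fin.castAdd w i) := by
  refine ⟨fun h => ⟨fun j => h _, fun i => h _⟩, fun h j => ?_⟩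
  induction j using Fin.addCases with
  | left i => exact h.2 i
  | right j => exact h.1 j

theorem regState_ext2 (h : q + (6 + w) = q + 2 + (4 + w)) (Θ : AncState q) :
    regState (layout h) (ext2 Θ) = padState (ofAnc Θ) := by
  ext z
  have hm : ∀ i, layout h (.inl i) = Fin.castAdd (4 + w) (Fin.castAdd 2 i) := fun i =>
    Fin.ext (by simp [layout_main])
  have hw : ∀ j, layout h (.inr (.inr j)) = Fin.natAdd (q + 2) (Fin.natAdd 4 j) := fun j =>
    Fin.ext (by simp [layout_work]; omega)
  have h0 : layout h (.inr (.inl 0)) = Fin.castAdd (4 + w) (Fin.natAdd q 0) :=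
    Fin.ext (by simp [layout_aux])
  have h1 : layout h (.inr (.inl 1)) = Fin.castAdd (4 + w) (Fin.natAdd q 1) :=
    Fin.ext (by simp [layout_aux])
  have h2 : layout h (.inr (.inl 2)) = Fin.natAdd (q + 2) (Fin.castAdd w 0) :=
    Fin.ext (by simp [layout_aux])
  have h3 : layout h (.inr (.inl 3)) = Fin.natAdd (q + 2) (Fin.castAdd w 1) :=
    Fin.ext (by simp [layout_aux])
  have h4 : layout h (.inr (.inl 4)) = Fin.natAdd (q + 2) (Fin.castAdd w 2) :=
    Fin.ext (by simp [layout_aux])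
  have h5 : layout h (.inr (.inl 5)) = Fin.natAdd (q + 2) (Fin.castAdd w 3) :=
    Fin.ext (by simp [layout_aux])
  simp only [regState, ext2, ext3, padState, ofAnc, hm, hw, h0, h1, h2, h3, h4, h5,
    forall_work, Fin.forall_fin_succ]
  by_cases hz : ∀ j, z (Fin.natAdd (q + 2) (Fin.natAdd 4 j)) = false
  · simp [hz]
    grind
  · simp [hz]

theorem regState_ext3 (h : q + (6 + w) = q + 2 + 1 + (3 + w))
    (Θ : Bits q → Bool → Bool → Bool → ℂ) :
    regState (layout h) (ext3 Θ) = padState (ofAncTarget Θ) := by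
  ext z
  have hm : ∀ i, layout h (.inl i) = Fin.castAdd (3 + w) (Fin.castAdd 2 i).castSucc := fun i =>
    Fin.ext (by simp [layout_main])
  have hw : ∀ j, layout h (.inr (.inr j)) = Fin.natAdd (q + 2 + 1) (Fin.natAdd 3 j) := fun j =>
    Fin.ext (by simp [layout_work]; omega)
  have h0 : layout h (.inr (.inl 0)) = Fin.castAdd (3 + w) (Fin.natAdd q 0).castSucc :=
    Fin.ext (by simp [layout_aux])
  have h1 : layout h (.inr (.inl 1)) = Fin.castAdd (3 + w) (Fin.natAdd q 1).castSucc :=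
    Fin.ext (by simp [layout_aux])
  have h2 : layout h (.inr (.inl 2)) = Fin.castAdd (3 + w) (Fin.last (q + 2)) :=
    Fin.ext (by simp [layout_aux])
  have h3 : layout h (.inr (.inl 3)) = Fin.natAdd (q + 2 + 1) (Fin.castAdd w 0) :=
    Fin.ext (by simp [layout_aux])
  have h4 : layout h (.inr (.inl 4)) = Fin.natAdd (q + 2 + 1) (Fin.castAdd w 1) :=
    Fin.ext (by simp [layout_aux])
  have h5 : layout h (.inr (.inl 5)) = Fin.natAdd (q + 2 + 1) (Fin.castAdd w 2) :=
    Fin.ext (by simp [layout_aux])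
  simp only [regState, ext3, padState, ofAncTarget, hm, hw, h0, h1, h2, h3, h4, h5,
    forall_work, Fin.forall_fin_succ]
  by_cases hz : ∀ j, z (Fin.natAdd (q + 2 + 1) (Fin.natAdd 3 j)) = false
  · simp [hz]
  · simp [hz]

theorem append_pair (y : Bits (q + 2)) :
    Fin.append (fun i => y (Fin.castAdd 2 i)) ![y (Fin.natAdd q 0), y (Fin.natAdd q 1)] = y := by
  ext i
  induction i using Fin.addCases with
  | left i => simp
  | right i => rw [Fin.append_right]; fin_cases i <;> rfl

theorem ofAnc_append (φ : Bits (q + 2) → ℂ) :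
    ofAnc (fun x a b => φ (Fin.append x ![a, b])) = φ := by
  ext y
  rw [ofAnc, append_pair]

theorem ofAncTarget_append (φ : Bits (q + 2 + 1) → ℂ) :
    ofAncTarget (fun x a b t => φ (Fin.snoc (Fin.append x ![a, b]) t)) = φ := by
  ext y
  rw [ofAncTarget, append_pair (fun i => y i.castSucc)]
  congr 1
  ext i
  induction i using Fin.lastCases with
  | last => simp
  | cast i => simp

/-- The projection `Π ⊗ ⟨00|`. -/
def extProj {N : ℕ} (P : Matrix (Fin N) (Bits q) ℂ) : Matrix (Fin N) (Bits (q + 2)) ℂ :=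
  Matrix.of fun j x => if (fun k => x (Fin.natAdd q k)) = zeroBits 2
    then P j (fun k => x (Fin.castAdd 2 k)) else 0

theorem extProj_append {N : ℕ} (P : Matrix (Fin N) (Bits q) ℂ) (j : Fin N) (x : Bits q)
    (y : Bits 2) : extProj P j (Fin.append x y) = if y = zeroBits 2 then P j x else 0 := by
  simp [extProj]

theorem extProj_braZero : extProj (braZero q) = braZero (q + 2) := by
  ext j x
  obtain ⟨x, y, rfl⟩ := exists_append x
  rw [extProj_append]
  have : Fin.append x y = zeroBits (q + 2) ↔ y = zeroBits 2 ∧ x = zeroBits q := by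
    rw [funext_iff, forall_work]
    simp [funext_iff, zeroBits]
  simp only [braZero, Matrix.of_apply, this]
  split_ifs <;> simp_all

theorem extProj_mul_conjTranspose {N : ℕ} (P : Matrix (Fin N) (Bits q) ℂ) :
    extProj P * (extProj P)ᴴ = P * Pᴴ := by
  ext i j
  simp [Matrix.mul_apply, sum_append, extProj_append, apply_ite]

theorem extProj_mulVec {N : ℕ} (P : Matrix (Fin N) (Bits q) ℂ) (φ : Bits (q + 2) → ℂ) :
    extProj P *ᵥ φ = P *ᵥ fun x => φ (Fin.append x (zeroBits 2)) := by
  ext i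
  simp [Matrix.mulVec, dotProduct, sum_append, extProj_append]

theorem extProj_proj_mulVec {N : ℕ} (P : Matrix (Fin N) (Bits q) ℂ) (φ : Bits (q + 2) → ℂ)
    (x : Bits q) (a b : Bool) :
    (((extProj P)ᴴ * extProj P) *ᵥ φ) (Fin.append x ![a, b]) =
      if a = false ∧ b = false
      then ((Pᴴ * P) *ᵥ fun x => φ (Fin.append x ![a, b])) x else 0 := by
  rw [← Matrix.mulVec_mulVec, extProj_mulVec, ← Matrix.mulVec_mulVec]
  have h : ![a, b] = zeroBits 2 ↔ a = false ∧ b = false := by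
    simp [funext_iff, Fin.forall_fin_two, zeroBits]
  simp only [Matrix.mulVec, dotProduct, Matrix.conjTranspose_apply, extProj_append, h]
  split_ifs with h'
  · rw [← h] at h'
    rw [h']
  · simp

/-- A circuit flipping the auxiliary qubit `2` on the range of `Pᴴ P ⊗ |00⟩⟨00|` implements the
controlled NOT of `P ⊗ ⟨00|`. -/
theorem implements_extProj {N : ℕ} {P : Matrix (Fin N) (Bits q) ℂ} {w : ℕ}
    {h : q + (6 + w) = q + 2 + 1 + (3 + w)} {c : Circuit (q + 2 + 1 + (3 + w))}
    (hc : ∀ Θ, Maps (layout h) c (ext3 Θ) (ext3 fun x a b t =>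
      if a = false ∧ b = false then
        ((1 - Pᴴ * P) *ᵥ fun y => Θ y a b t) x + ((Pᴴ * P) *ᵥ fun y => Θ y a b (!t)) x
      else Θ x a b t)) :
    (⟨3 + w, c⟩ : Implementation (q + 2 + 1)).Implements (projNot (extProj P)) := by
  obtain ⟨h1, h2⟩ := Implementation.clean_of_mulVec_padState c
    (fun φ => projNot (extProj P) *ᵥ φ) fun φ => by
      have h3 := hc fun x a b t => φ (Fin.snoc (Fin.append x ![a, b]) t)
      rw [Maps, regState_ext3, regState_ext3, ofAncTarget_append] at h3
      rw [h3]
      congr 1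
      ext y
      rw [projNot_mulVec, ofAncTarget]
      have hy := append_pair fun i => y (Fin.castSucc i)
      rw [Matrix.sub_mulVec, Matrix.one_mulVec, Matrix.sub_mulVec, Matrix.one_mulVec,
        Pi.sub_apply, Pi.sub_apply, ← hy, extProj_proj_mulVec, extProj_proj_mulVec]
      split_ifs with h4
      · rfl
      · simp
  refine ⟨h1, ?_⟩
  ext x y
  rw [h2, Matrix.mulVec_single_one]
  rfl

end

/-! ### Circuits with calls of an unknown block encoding -/

/-- The total number of work qubits of the circuits of a block encoding. -/
abbrev Shape.work (s : Shape) : ℕ := s.unitaryWork + (s.zeroNotWork + s.projNotWork)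

/-- The arrangement on `n` wires of the main qubits of a block encoding of shape `s`, six auxiliary
qubits and the work qubits of its circuits. -/
abbrev Layout (s : Shape) (n : ℕ) : Type := Fin s.qubits ⊕ Fin 6 ⊕ Fin s.work ≃ Fin n

section

variable {s : Shape} {n : ℕ}

/-- The wires for a circuit on the main qubits, with work qubits given by `g`. -/
def mainWire (e : Layout s n) {v : ℕ} (g : Fin v ↪ Fin s.work) : Fin (s.qubits + v) → Fin n :=
  Fin.addCases (fun i => e (.inl i)) (fun j => e (.inr (.inr (g j))))

theorem mainWire_main (e : Layout s n) {v : ℕ} (g : Fin v ↪ Fin s.work) (i : Fin s.qubits) :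
    mainWire e g (Fin.castAdd v i) = e (.inl i) := by
  simp [mainWire]

theorem mainWire_work (e : Layout s n) {v : ℕ} (g : Fin v ↪ Fin s.work) (j : Fin v) :
    mainWire e g (Fin.natAdd s.qubits j) = e (.inr (.inr (g j))) := by
  simp [mainWire]

/-- The wires for a circuit on the main qubits and the auxiliary qubit `t`, with work qubits given
by `g`. -/
def targetWire (e : Layout s n) (t : Fin 6) {v : ℕ} (g : Fin v ↪ Fin s.work) :
    Fin (s.qubits + 1 + v) → Fin n :=
  Fin.addCases (Fin.lastCases (aux e t) (fun i => e (.inl i))) (fun j => e (.inr (.inr (g j))))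

theorem targetWire_main (e : Layout s n) (t : Fin 6) {v : ℕ} (g : Fin v ↪ Fin s.work)
    (i : Fin s.qubits) : targetWire e t g (Fin.castAdd v i.castSucc) = e (.inl i) := by
  simp [targetWire]

theorem targetWire_target (e : Layout s n) (t : Fin 6) {v : ℕ} (g : Fin v ↪ Fin s.work) :
    targetWire e t g (Fin.castAdd v (Fin.last _)) = e (.inr (.inl t)) := by
  simp [targetWire]

theorem targetWire_work (e : Layout s n) (t : Fin 6) {v : ℕ} (g : Fin v ↪ Fin s.work)
    (j : Fin v) : targetWire e t g (Fin.natAdd (s.qubits + 1) j) = e (.inr (.inr (g j))) := by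
  simp [targetWire]

/-- `mainWire` as an embedding. -/
def mainWires (e : Layout s n) {v : ℕ} (g : Fin v ↪ Fin s.work) :
    Fin (s.qubits + v) ↪ Fin n where
  toFun := mainWire e g
  inj' := by
    intro a b hab
    induction a using Fin.addCases <;> induction b using Fin.addCases <;>
      simp_all [e.injective.eq_iff, mainWire_main, mainWire_work]

/-- `targetWire` as an embedding. -/
def targetWires (e : Layout s n) (t : Fin 6) {v : ℕ} (g : Fin v ↪ Fin s.work) :
    Fin (s.qubits + 1 + v) ↪ Fin n where
  toFun := targetWire e t g
  inj' := by
    have key : ∀ x : Fin (s.qubits + 1 + v), (∃ i : Fin s.qubits, x = Fin.castAdd v i.castSucc) ∨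
        x = Fin.castAdd v (Fin.last _) ∨ ∃ j, x = Fin.natAdd _ j := by
      intro x
      induction x using Fin.addCases with
      | left i => induction i using Fin.lastCases <;> simp
      | right j => simp
    intro a b hab
    rcases key a with ⟨i, rfl⟩ | rfl | ⟨j, rfl⟩ <;> rcases key b with ⟨i', rfl⟩ | rfl | ⟨j', rfl⟩ <;>
      simp_all [e.injective.eq_iff, targetWire_main, targetWire_target, targetWire_work]

/-- The call of the unitary of the block encoding. -/
def unitaryCall (e : Layout s n) : BoxGate s n :=
  .call .unitary false (mainWires e (Fin.castAddEmb _))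

/-- The call of the controlled NOT of `⟨0|`, with target `t`. -/
def zeroNotCall (e : Layout s n) (t : Fin 6) : BoxGate s n :=
  .call .zeroNot false (targetWires e t ((Fin.castAddEmb _).trans (Fin.natAddEmb _)))

/-- The call of the controlled NOT of `Π`, with target `t`. -/
def projNotCall (e : Layout s n) (t : Fin 6) : BoxGate s n :=
  .call .projNot false (targetWires e t ((Fin.natAddEmb _).trans (Fin.natAddEmb _)))

/-- The inverse operation. -/
noncomputable def BoxGate.inv : BoxGate s n → BoxGate s n
  | .gate g => .gate g.inv
  | .call b i f => .call b (!i) f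

/-- The inverse of a sequence of operations. -/
noncomputable def invList (l : List (BoxGate s n)) : List (BoxGate s n) :=
  l.reverse.map BoxGate.inv

/-- `conditionCircuit`, with a call `g`. -/
noncomputable def conditionList (e : Layout s n) (g : BoxGate s n) : List (BoxGate s n) :=
  g :: ([Gate.single (aux e 0) pauliX] ++ ([Gate.single (aux e 1) pauliX] ++
    (andCircuit e 3 0 4 (by decide) (by decide) ++
      andCircuit e 4 1 5 (by decide) (by decide)))).map BoxGate.gate

/-- `condNotCircuit`, with a call `g`. -/
noncomputable def condNotList (e : Layout s n) (g : BoxGate s n) : List (BoxGate s n) :=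
  conditionList e g ++ (.gate (.cnot (aux e 5) (aux e 2) (aux_ne (by decide))) ::
    invList (conditionList e g))

/-- `reflectCircuit`, with a call `g`. -/
noncomputable def reflectList (e : Layout s n) (g : BoxGate s n) : List (BoxGate s n) :=
  condNotList e g ++ (.gate (.single (aux e 2) pauliZ) :: condNotList e g)

/-- `prepCircuit`, with calls. -/
noncomputable def prepList (e : Layout s n) (θ : ℝ) : List (BoxGate s n) :=
  [unitaryCall e, .gate (.single (aux e 0) (rot θ))]

/-- `groverCircuit`, with calls. -/
noncomputable def groverList (e : Layout s n) (θ : ℝ) : ℕ → List (BoxGate s n)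
  | 0 => prepList e θ
  | k + 1 => groverList e θ k ++ (reflectList e (projNotCall e 3) ++
      (invList (prepList e θ) ++ (reflectList e (zeroNotCall e 3) ++ prepList e θ)))

/-- `amplifyCircuit`, with calls. -/
noncomputable def amplifyList (e : Layout s n) (θ θ' : ℝ) (k : ℕ) : List (BoxGate s n) :=
  groverList e θ k ++ [.gate (.single (aux e 1) (rot θ'))]

/-- The amplified block encoding: `k` Grover iterations, after attenuation of the amplitude by
`cos θ`, and a subsequent attenuation by `cos θ'`. -/
noncomputable def amplified (s : Shape) (θ θ' γ' : ℝ) (k : ℕ) : BoxEncoding s where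
  ancillas := 2
  unitaryWork := 4 + s.work
  unitary := amplifyList (layout (by omega)) θ θ' k
  zeroNotWork := 3 + s.work
  zeroNot := condNotList (layout (by omega)) (zeroNotCall (layout (by omega)) 3)
  projNotWork := 3 + s.work
  projNot := condNotList (layout (by omega)) (projNotCall (layout (by omega)) 3)
  γ := γ'

end

section

variable {N n : ℕ} (B : BlockEncoding N)

/-- The circuit that is executed by a sequence of operations. -/
noncomputable def expandList (l : List (BoxGate B.shape n)) : Circuit n :=
  l.flatMap (BoxGate.expand B)

theorem expandList_append (l l' : List (BoxGate B.shape n)) :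
    expandList B (l ++ l') = expandList B l ++ expandList B l' := by
  simp [expandList]

theorem expandList_cons (g : BoxGate B.shape n) (l : List (BoxGate B.shape n)) :
    expandList B (g :: l) = expandList B [g] ++ expandList B l := by
  simp [expandList]

theorem expandList_gates (c : Circuit n) : expandList B (c.map BoxGate.gate) = c := by
  induction c with
  | nil => rfl
  | cons g c ih =>
    rw [List.map_cons, expandList_cons, ih]
    simp [expandList, BoxGate.expand]

theorem BoxGate.expand_inv (g : BoxGate B.shape n) :
    g.inv.expand B = Circuit.inv (g.expand B) := by
  cases g with
  | gate g => simp [BoxGate.inv, BoxGate.expand, Circuit.inv]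
  | call b i f =>
    cases i <;> simp [BoxGate.inv, BoxGate.expand, Circuit.inv_map_rewire, Circuit.inv_inv]

theorem expandList_inv (l : List (BoxGate B.shape n)) :
    expandList B (invList l) = Circuit.inv (expandList B l) := by
  induction l with
  | nil => simp [expandList, invList, Circuit.inv]
  | cons g l ih =>
    rw [expandList_cons, Circuit.inv_append, ← ih]
    simp [expandList, invList, BoxGate.expand_inv]

theorem expandList_condition (e : Layout B.shape n) (g : BoxGate B.shape n) :
    expandList B (conditionList e g) = conditionCircuit e (expandList B [g]) := by
  rw [conditionList, expandList_cons, expandList_gates]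
  rfl

theorem expandList_condNot (e : Layout B.shape n) (g : BoxGate B.shape n) :
    expandList B (condNotList e g) = condNotCircuit e (expandList B [g]) := by
  rw [condNotList, expandList_append, expandList_cons, expandList_inv, expandList_condition]
  rfl

theorem expandList_reflect (e : Layout B.shape n) (g : BoxGate B.shape n) :
    expandList B (reflectList e g) = reflectCircuit e (expandList B [g]) := by
  rw [reflectList, expandList_append, expandList_cons, expandList_condNot]
  rfl

theorem expandList_prep (e : Layout B.shape n) (θ : ℝ) :
    expandList B (prepList e θ) = prepCircuit e (expandList B [unitaryCall e]) θ := by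
  rw [prepList, expandList_cons]
  rfl

theorem expandList_grover (e : Layout B.shape n) (θ : ℝ) (k : ℕ) :
    expandList B (groverList e θ k) = groverCircuit e (expandList B [unitaryCall e])
      (expandList B [zeroNotCall e 3]) (expandList B [projNotCall e 3]) θ k := by
  induction k with
  | zero => exact expandList_prep B e θ
  | succ k ih =>
    simp only [groverList, groverCircuit, expandList_append, expandList_inv, expandList_prep,
      expandList_reflect, ih]

theorem expandList_amplify (e : Layout B.shape n) (θ θ' : ℝ) (k : ℕ) :
    expandList B (amplifyList e θ θ' k) = amplifyCircuit e (expandList B [unitaryCall e])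
      (expandList B [zeroNotCall e 3]) (expandList B [projNotCall e 3]) θ θ' k := by
  rw [amplifyList, expandList_append, expandList_grover]
  rfl

variable {B}

theorem actsOnMain_unitaryCall (hB : B.unitary.Clean) (e : Layout B.shape n) :
    ActsOnMain (q := B.qubits) e (expandList B [unitaryCall e]) B.unitary.matrix := by
  intro Φ
  have h : expandList B [unitaryCall e] = B.unitary.circuit.map
      (Gate.rewire (mainWires e (Fin.castAddEmb _))) := List.append_nil _
  rw [h]
  refine Maps.box (I := B.unitary) ⟨hB, rfl⟩ _ (Fin.castAddEmb _) ?_ ?_ Φ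
  · exact mainWire_main e _
  · exact mainWire_work e _

theorem maps_zeroNotCall (hB : B.zeroNot.Implements (projNot (braZero B.qubits)))
    (e : Layout B.shape n) (t : Fin 6) (Φ : Bits B.qubits → Bits 6 → ℂ) :
    Maps (q := B.qubits) e (expandList B [zeroNotCall e t]) Φ fun x s =>
      ((1 - (braZero B.qubits)ᴴ * braZero B.qubits) *ᵥ fun y => Φ y s) x +
      (((braZero B.qubits)ᴴ * braZero B.qubits) *ᵥ fun y => Φ y (Function.update s t (!s t))) x := by
  have h : expandList B [zeroNotCall e t] = B.zeroNot.circuit.map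
      (Gate.rewire (targetWires e t ((Fin.castAddEmb _).trans (Fin.natAddEmb _)))) := List.append_nil _
  rw [h]
  refine Maps.flip hB t _ ((Fin.castAddEmb _).trans (Fin.natAddEmb _)) ?_ ?_ ?_ Φ
  · exact targetWire_main e t _
  · exact targetWire_target e t _
  · exact targetWire_work e t _

theorem maps_projNotCall (hB : B.projNot.Implements (projNot B.proj))
    (e : Layout B.shape n) (t : Fin 6) (Φ : Bits B.qubits → Bits 6 → ℂ) :
    Maps (q := B.qubits) e (expandList B [projNotCall e t]) Φ fun x s =>
      ((1 - B.projᴴ * B.proj) *ᵥ fun y => Φ y s) x +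
      ((B.projᴴ * B.proj) *ᵥ fun y => Φ y (Function.update s t (!s t))) x := by
  have h : expandList B [projNotCall e t] = B.projNot.circuit.map
      (Gate.rewire (targetWires e t ((Fin.natAddEmb _).trans (Fin.natAddEmb _)))) := List.append_nil _
  rw [h]
  refine Maps.flip hB t _ ((Fin.natAddEmb _).trans (Fin.natAddEmb _)) ?_ ?_ ?_ Φ
  · exact targetWire_main e t _
  · exact targetWire_target e t _
  · exact targetWire_work e t _

end

/-! ### The amplified block encoding -/

section

variable {N n : ℕ}

theorem isProj_of_orthonormal {q : ℕ} {P : Matrix (Fin N) (Bits q) ℂ} (hP : P * Pᴴ = 1) :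
    (Pᴴ * P) * (Pᴴ * P) = Pᴴ * P := by
  rw [Matrix.mul_assoc, ← Matrix.mul_assoc P, hP, Matrix.one_mul]

theorem braZero_mul_conjTranspose (q : ℕ) : braZero q * (braZero q)ᴴ = 1 := by
  ext i j
  rw [Subsingleton.elim j i]
  simp [Matrix.mul_apply, braZero]

theorem BlockEncoding.efficiency_sq (B : BlockEncoding N) :
    B.efficiency ^ 2 =
      normSq (B.proj *ᵥ fun x => B.unitary.matrix x (zeroBits B.qubits)) := by
  rw [BlockEncoding.efficiency, EuclideanSpace.norm_eq, Real.sq_sqrt]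
  · rfl
  · positivity

/-- The success probability, as a matrix element. -/
theorem BlockEncoding.inner_eq_efficiency_sq (B : BlockEncoding N) :
    (B.unitary.matrixᴴ *ᵥ (B.projᴴ * B.proj) *ᵥ
      fun y => B.unitary.matrix y (zeroBits B.qubits)) (zeroBits B.qubits) =
      ((B.efficiency ^ 2 : ℝ) : ℂ) := by
  rw [B.efficiency_sq, ofReal_normSq_mulVec]
  rfl

variable {B : BlockEncoding N} {v : EuclideanSpace ℂ (Fin N)} {ε : ℝ}

theorem BlockEncoding.Encodes.unitary (hB : B.Encodes v ε) :
    B.unitary.matrixᴴ * B.unitary.matrix = 1 :=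
  Implementation.Implements.conjTranspose_mul ⟨hB.unitary_clean, rfl⟩

theorem BlockEncoding.Encodes.flips_zeroNot (hB : B.Encodes v ε) (e : Layout B.shape n) :
    FlipsThree (q := B.qubits) e (expandList B [zeroNotCall e 3])
      ((braZero B.qubits)ᴴ * braZero B.qubits) :=
  fun Φ => maps_zeroNotCall hB.zeroNot_implements e 3 Φ

theorem BlockEncoding.Encodes.flips_projNot (hB : B.Encodes v ε) (e : Layout B.shape n) :
    FlipsThree (q := B.qubits) e (expandList B [projNotCall e 3]) (B.projᴴ * B.proj) :=
  fun Φ => maps_projNotCall hB.projNot_implements e 3 Φ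

theorem amplified_zeroNot (hB : B.Encodes v ε) (θ θ' γ' : ℝ) (k : ℕ) :
    ((amplified B.shape θ θ' γ' k).expand B).zeroNot.Implements
      (projNot (braZero (B.qubits + 2))) := by
  have h0 : B.qubits + (6 + B.shape.work) = B.qubits + 2 + 1 + (3 + B.shape.work) := by omega
  have h := (hB.flips_zeroNot (layout h0)).condNotCircuit
    (isProj_of_orthonormal (braZero_mul_conjTranspose _))
  rw [← extProj_braZero]
  have h2 := implements_extProj (h := h0) h
  exact (congrArg (fun c => (⟨3 + B.shape.work, c⟩ : Implementation (B.qubits + 2 + 1)).Implements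
    (projNot (extProj (braZero B.qubits)))) (expandList_condNot B _ (zeroNotCall _ 3))).mpr h2

theorem amplified_projNot (hB : B.Encodes v ε) (θ θ' γ' : ℝ) (k : ℕ) :
    ((amplified B.shape θ θ' γ' k).expand B).projNot.Implements (projNot (extProj B.proj)) := by
  have h0 : B.qubits + (6 + B.shape.work) = B.qubits + 2 + 1 + (3 + B.shape.work) := by omega
  have h := (hB.flips_projNot (layout h0)).condNotCircuit
    (isProj_of_orthonormal hB.orthonormal_rows)
  have h2 := implements_extProj (h := h0) h
  exact (congrArg (fun c => (⟨3 + B.shape.work, c⟩ : Implementation (B.qubits + 2 + 1)).Implements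
    (projNot (extProj B.proj))) (expandList_condNot B _ (projNotCall _ 3))).mpr h2

theorem amplified_unitary (hB : B.Encodes v ε) (θ θ' γ' : ℝ) (k : ℕ) :
    ((amplified B.shape θ θ' γ' k).expand B).unitary.Clean ∧
    ∀ x : Bits (B.qubits + 2),
      ((amplified B.shape θ θ' γ' k).expand B).unitary.matrix x (zeroBits (B.qubits + 2)) =
        ofAnc (fun x a b => ∑ b', (rot θ' : Matrix Bool Bool ℂ) b b' *
          (groverMap θ B.unitary.matrix ((braZero B.qubits)ᴴ * braZero B.qubits)
            (B.projᴴ * B.proj))^[k]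
            (prepMap θ B.unitary.matrix (zeroState B.qubits)) x a b') x := by
  have h0 : B.qubits + (6 + B.shape.work) = B.qubits + 2 + (4 + B.shape.work) := by omega
  have hU := hB.unitary
  have key : ∀ Θ, Maps (q := B.qubits) (layout h0)
      (expandList B (amplifyList (layout h0) θ θ' k)) (ext2 Θ) (ext2 fun x a b =>
        ∑ b', (rot θ' : Matrix Bool Bool ℂ) b b' *
          (groverMap θ B.unitary.matrix ((braZero B.qubits)ᴴ * braZero B.qubits)
            (B.projᴴ * B.proj))^[k] (prepMap θ B.unitary.matrix Θ) x a b') := fun Θ =>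
    (congrArg (fun c => Maps (q := B.qubits) (layout h0) c (ext2 Θ) _)
      (expandList_amplify B (layout h0) θ θ' k)).mpr <|
    Maps.amplify (actsOnMain_unitaryCall hB.unitary_clean (layout h0))
      (hB.flips_zeroNot (layout h0)) (hB.flips_projNot (layout h0)) (mul_eq_one_comm.mp hU)
      (isProj_of_orthonormal (braZero_mul_conjTranspose _))
      (isProj_of_orthonormal hB.orthonormal_rows) θ θ' k Θ
  obtain ⟨h1, h2⟩ := Implementation.clean_of_mulVec_padState (k := B.qubits + 2)
    (w := 4 + B.shape.work) (expandList B (amplifyList (layout h0) θ θ' k))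
    (fun φ => ofAnc fun x a b => ∑ b', (rot θ' : Matrix Bool Bool ℂ) b b' *
          (groverMap θ B.unitary.matrix ((braZero B.qubits)ᴴ * braZero B.qubits)
            (B.projᴴ * B.proj))^[k]
            (prepMap θ B.unitary.matrix (fun x a b => φ (Fin.append x ![a, b]))) x a b')
    fun φ => by
      have h3 := key fun x a b => φ (Fin.append x ![a, b])
      rw [Maps] at h3
      have h4 := regState_ext2 h0 fun x a b => φ (Fin.append x ![a, b])
      rw [ofAnc_append] at h4
      rw [← h4, ← regState_ext2 h0]
      exact h3
  refine ⟨h1, fun x => (h2 x (zeroBits _)).trans ?_⟩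
  have h5 : (fun (x : Bits B.qubits) a b => (Pi.single (zeroBits (B.qubits + 2)) 1 :
      Bits (B.qubits + 2) → ℂ) (Fin.append x ![a, b])) = zeroState B.qubits := by
    ext x a b
    have : Fin.append x ![a, b] = zeroBits (B.qubits + 2) ↔
        x = zeroBits B.qubits ∧ a = false ∧ b = false := by
      rw [funext_iff, forall_work]
      simp [funext_iff, zeroBits]
      tauto
    simp [Pi.single_apply, this, zeroState]
  rw [h5]

theorem amplified_vec (hB : B.Encodes v ε) (θ θ' γ' : ℝ) (k : ℕ) :
    ((amplified B.shape θ θ' γ' k).expand B).vec =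
      ((Real.cos θ' * Real.cos θ * (amp k).1.eval (Real.cos θ ^ 2 * B.efficiency ^ 2) : ℝ) : ℂ) •
        B.vec := by
  have h := amplified_proj θ θ' (B.efficiency ^ 2) hB.orthonormal_rows hB.unitary
    (mul_eq_one_comm.mp hB.unitary) B.inner_eq_efficiency_sq k
  rw [BlockEncoding.vec, BlockEncoding.vec, ← WithLp.toLp_smul, ← h]
  congr 1
  refine (extProj_mulVec B.proj _).trans ?_
  congr 1
  ext x
  refine ((amplified_unitary hB θ θ' γ' k).2 _).trans ?_
  have hx : (fun i => Fin.append x (zeroBits 2) (Fin.castAdd 2 i)) = x := by ext i; simp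
  simp only [ofAnc, hx, Fin.append_right]
  rfl

/-- Only the normalization factor and the error have to be checked for the amplified block encoding;
its circuits are correct for all angles. -/
theorem amplified_encodes (hB : B.Encodes v ε) (θ θ' γ' : ℝ) (k : ℕ) {ε' : ℝ} (h1 : ‖v‖ ≤ γ')
    (h2 : ‖((γ' * (Real.cos θ' * Real.cos θ *
      (amp k).1.eval (Real.cos θ ^ 2 * B.efficiency ^ 2)) : ℝ) : ℂ) • B.vec - v‖ ≤ ε' * ‖v‖) :
    ((amplified B.shape θ θ' γ' k).expand B).Encodes v ε' where
  unitary_clean := (amplified_unitary hB θ θ' γ' k).1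
  zeroNot_implements := amplified_zeroNot hB θ θ' γ' k
  orthonormal_rows := (extProj_mul_conjTranspose B.proj).trans hB.orthonormal_rows
  projNot_implements := amplified_projNot hB θ θ' γ' k
  norm_le := h1
  error_le := by
    rw [amplified_vec hB, smul_smul, ← Complex.ofReal_mul]
    exact h2

theorem amplified_efficiency (hB : B.Encodes v ε) (θ θ' γ' : ℝ) (k : ℕ) :
    ((amplified B.shape θ θ' γ' k).expand B).efficiency =
      |Real.cos θ' * Real.cos θ * (amp k).1.eval (Real.cos θ ^ 2 * B.efficiency ^ 2)| *
        B.efficiency := by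
  rw [BlockEncoding.efficiency, amplified_vec hB, norm_smul, Complex.norm_real, Real.norm_eq_abs,
    BlockEncoding.efficiency]

theorem BlockEncoding.Encodes.efficiency_le_one (hB : B.Encodes v ε) : B.efficiency ≤ 1 := by
  have hu : normSq (fun x => B.unitary.matrix x (zeroBits B.qubits)) = 1 := by
    have := congrFun (congrFun hB.unitary (zeroBits B.qubits)) (zeroBits B.qubits)
    rw [Matrix.one_apply_eq] at this
    have h2 := ofReal_normSq fun x => B.unitary.matrix x (zeroBits B.qubits)
    have h3 : (star fun x => B.unitary.matrix x (zeroBits B.qubits)) ⬝ᵥ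
        (fun x => B.unitary.matrix x (zeroBits B.qubits)) = 1 := this
    rw [h3] at h2
    exact_mod_cast h2
  have hE := isProj_of_orthonormal hB.orthonormal_rows
  set u : Bits B.qubits → ℂ := fun x => B.unitary.matrix x (zeroBits B.qubits) with hu_def
  -- `1 - E` is an orthogonal projection too, so `1 - ‖E u‖²` is a squared norm
  have h1 := ofReal_normSq_mulVec (1 - B.projᴴ * B.proj) u
  have h2 := ofReal_normSq_mulVec B.proj u
  have h3 : (1 - B.projᴴ * B.proj)ᴴ * (1 - B.projᴴ * B.proj) = 1 - B.projᴴ * B.proj := by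
    rw [Matrix.conjTranspose_sub, Matrix.conjTranspose_one, Matrix.conjTranspose_mul,
      Matrix.conjTranspose_conjTranspose, Matrix.sub_mul, Matrix.one_mul, Matrix.mul_sub,
      Matrix.mul_one, hE, sub_self, sub_zero]
  rw [h3, Matrix.sub_mulVec, Matrix.one_mulVec, dotProduct_sub, ← h2, ← ofReal_normSq, hu] at h1
  have h4 : normSq ((1 - B.projᴴ * B.proj) *ᵥ u) = 1 - normSq (B.proj *ᵥ u) := by
    rw [Matrix.sub_mulVec, Matrix.one_mulVec]
    exact_mod_cast h1
  have h5 := normSq_nonneg ((1 - B.projᴴ * B.proj) *ᵥ u)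
  have h6 := B.efficiency_sq
  rw [← hu_def] at h6
  have h7 : 0 ≤ B.efficiency := norm_nonneg _
  nlinarith

/-- The controlled NOT of `⟨0|` is not the identity, so its circuit is not empty. -/
theorem BlockEncoding.Encodes.one_le_gates (hB : B.Encodes v ε) : 1 ≤ B.gates := by
  by_contra! h
  have h0 : B.zeroNot.circuit = [] := by
    rw [← List.length_eq_zero_iff]
    unfold BlockEncoding.gates at h
    omega
  have h1 := congrFun (congrFun hB.zeroNot_implements.2
    (Fin.snoc (zeroBits B.qubits) true)) (zeroBits _)
  have h2 : (Fin.snoc (zeroBits B.qubits) true : Bits (B.qubits + 1)) (Fin.last _) = true := by simp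
  have h3 : Fin.append (Fin.snoc (zeroBits B.qubits) true : Bits (B.qubits + 1))
      (zeroBits B.zeroNot.work) ≠ Fin.append (zeroBits (B.qubits + 1)) (zeroBits B.zeroNot.work) := by
    intro e
    have := congrFun e (Fin.castAdd _ (Fin.last _))
    simp [zeroBits] at this
  have h4 : (fun k => (Fin.snoc (zeroBits B.qubits) true : Bits (B.qubits + 1)) k.castSucc) =
      zeroBits B.qubits := by ext k; simp
  have h5 : (fun k : Fin B.qubits => zeroBits (B.qubits + 1) k.castSucc) = zeroBits B.qubits := rfl
  simp only [Implementation.matrix, Matrix.of_apply, h0, Circuit.matrix, Matrix.one_apply_ne h3,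
    QEnc.projNot, h2, h4, h5] at h1
  simp [zeroBits, braZero, Matrix.mul_apply] at h1

end

/-! ### Gate counts -/

section

variable {N n : ℕ} (B : BlockEncoding N)

theorem length_condition {q w : ℕ} (e : Fin q ⊕ Fin 6 ⊕ Fin w ≃ Fin n) (c : Circuit n) :
    (conditionCircuit e c).length = c.length + 16 := by
  simp [conditionCircuit, andCircuit]

theorem length_condNot {q w : ℕ} (e : Fin q ⊕ Fin 6 ⊕ Fin w ≃ Fin n) (c : Circuit n) :
    (condNotCircuit e c).length = 2 * c.length + 33 := by
  simp [condNotCircuit, length_condition, Circuit.inv]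
  omega

theorem length_reflect {q w : ℕ} (e : Fin q ⊕ Fin 6 ⊕ Fin w ≃ Fin n) (c : Circuit n) :
    (reflectCircuit e c).length = 4 * c.length + 67 := by
  simp [reflectCircuit, length_condNot]
  omega

theorem length_grover {q w : ℕ} (e : Fin q ⊕ Fin 6 ⊕ Fin w ≃ Fin n) (cU cZ cP : Circuit n) (θ : ℝ)
    (k : ℕ) : (groverCircuit e cU cZ cP θ k).length =
      cU.length + 1 + k * (2 * cU.length + 4 * cZ.length + 4 * cP.length + 136) := by
  induction k with
  | zero => simp [groverCircuit, prepCircuit]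
  | succ k ih =>
    simp [groverCircuit, ih, length_reflect, prepCircuit, Circuit.inv]
    ring

theorem length_unitaryCall (e : Layout B.shape n) :
    (expandList B [unitaryCall e]).length = B.unitary.circuit.length :=
  (congrArg List.length (List.append_nil _)).trans (List.length_map _)

theorem length_zeroNotCall (e : Layout B.shape n) (t : Fin 6) :
    (expandList B [zeroNotCall e t]).length = B.zeroNot.circuit.length :=
  (congrArg List.length (List.append_nil _)).trans (List.length_map _)

theorem length_projNotCall (e : Layout B.shape n) (t : Fin 6) :
    (expandList B [projNotCall e t]).length = B.projNot.circuit.length :=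
  (congrArg List.length (List.append_nil _)).trans (List.length_map _)

theorem length_zeroNotList (e : Layout B.shape n) :
    (expandList B (condNotList e (zeroNotCall e 3))).length =
      2 * B.zeroNot.circuit.length + 33 := by
  rw [expandList_condNot, length_condNot, length_zeroNotCall]

theorem length_projNotList (e : Layout B.shape n) :
    (expandList B (condNotList e (projNotCall e 3))).length =
      2 * B.projNot.circuit.length + 33 := by
  rw [expandList_condNot, length_condNot, length_projNotCall]

theorem length_amplifyList (e : Layout B.shape n) (θ θ' : ℝ) (k : ℕ) :
    (expandList B (amplifyList e θ θ' k)).length =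
      B.unitary.circuit.length + 1 + k * (2 * B.unitary.circuit.length +
        4 * B.zeroNot.circuit.length + 4 * B.projNot.circuit.length + 136) + 1 := by
  rw [expandList_amplify, amplifyCircuit, List.length_append, length_grover, length_unitaryCall,
    length_zeroNotCall, length_projNotCall]
  rfl

theorem gates_amplified (θ θ' γ' : ℝ) (k : ℕ) :
    ((amplified B.shape θ θ' γ' k).expand B).gates =
      B.unitary.circuit.length * (2 * k + 1) +
        (B.zeroNot.circuit.length + B.projNot.circuit.length) * (4 * k + 2) + (136 * k + 68) := by
  have h1 : ((amplified B.shape θ θ' γ' k).expand B).unitary.circuit.length = _ :=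
    length_amplifyList B _ θ θ' k
  have h2 : ((amplified B.shape θ θ' γ' k).expand B).zeroNot.circuit.length = _ :=
    length_zeroNotList B _
  have h3 : ((amplified B.shape θ θ' γ' k).expand B).projNot.circuit.length = _ :=
    length_projNotList B _
  rw [BlockEncoding.gates, h1, h2, h3]
  ring

/-- Every circuit of the block encoding occurs in the amplified one. This holds without any
assumption on `B`, so the cost of producing an invalid `B` is also bounded by the size of the
output. -/
theorem gates_le_gates_amplified (θ θ' γ' : ℝ) (k : ℕ) :
    B.gates ≤ ((amplified B.shape θ θ' γ' k).expand B).gates := by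
  rw [gates_amplified, BlockEncoding.gates]
  nlinarith [Nat.zero_le (B.unitary.circuit.length * k), Nat.zero_le (B.zeroNot.circuit.length * k),
    Nat.zero_le (B.projNot.circuit.length * k)]

theorem gates_amplified_le (θ θ' γ' : ℝ) (k : ℕ) :
    ((amplified B.shape θ θ' γ' k).expand B).gates ≤ 136 * (k + 1) * (B.gates + 1) := by
  rw [gates_amplified, BlockEncoding.gates]
  nlinarith [Nat.zero_le (B.unitary.circuit.length * k), Nat.zero_le (B.zeroNot.circuit.length * k),
    Nat.zero_le (B.projNot.circuit.length * k)]

end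

/-! ### The critical point of the amplification polynomial -/

section

open Polynomial

/-- With initial success probability `sin² θ`, a Grover iteration is a rotation by `2 θ`, up to
sign. -/
theorem amp_sin (k : ℕ) (θ : ℝ) :
    (amp k).1.eval (Real.sin θ ^ 2) * Real.sin θ = (-1) ^ k * Real.sin ((2 * k + 1) * θ) ∧
    (amp k).2.eval (Real.sin θ ^ 2) * Real.cos θ = (-1) ^ k * Real.cos ((2 * k + 1) * θ) := by
  induction k with
  | zero => simp [amp]
  | succ k ih =>
    obtain ⟨h1, h2⟩ := ih
    have h3 : (2 * ((k + 1 : ℕ) : ℝ) + 1) * θ = (2 * k + 1) * θ + 2 * θ := by push_cast; ring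
    have hs := Real.sin_sq_add_cos_sq θ
    rw [h3, Real.sin_add, Real.cos_add, Real.sin_two_mul, Real.cos_two_mul']
    simp only [amp, eval_sub, eval_mul, eval_neg, eval_one, eval_X, eval_ofNat, pow_succ (-1 : ℝ)]
    generalize (amp k).1.eval (Real.sin θ ^ 2) = α at *
    generalize (amp k).2.eval (Real.sin θ ^ 2) = β at *
    generalize Real.sin θ = S at *
    generalize Real.cos θ = C at *
    constructor
    · linear_combination (-(C ^ 2 - S ^ 2)) * h1 - 2 * S * C * h2 + (α * S + 2 * β * S) * hs
    · linear_combination (-(C ^ 2 - S ^ 2)) * h2 + 2 * S * C * h1 + β * C * hs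

/-- Near a critical point, a polynomial deviates only quadratically from its value there. -/
theorem exists_quadratic_bound (f : ℝ[X]) (p : ℝ) (h : f.derivative.eval p = 0) :
    ∃ M : ℝ, 0 < M ∧ ∀ x ∈ Set.Icc (0 : ℝ) 1, |f.eval x - f.eval p| ≤ M * (x - p) ^ 2 := by
  obtain ⟨g, hg⟩ : (X - C p) ∣ f - C (f.eval p) := by
    rw [dvd_iff_isRoot]; simp
  have hg0 : g.eval p = 0 := by
    have := congrArg (fun f => (derivative f).eval p) hg
    simpa [h] using this.symm
  obtain ⟨r, hr⟩ : (X - C p) ∣ g := by rwa [dvd_iff_isRoot]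
  obtain ⟨M, hM⟩ := isCompact_Icc.exists_bound_of_continuousOn
    (s := Set.Icc (0 : ℝ) 1) (f := fun x => r.eval x) r.continuous.continuousOn
  refine ⟨|M| + 1, by positivity, fun x hx => ?_⟩
  have h1 : f.eval x - f.eval p = (x - p) ^ 2 * r.eval x := by
    have := congrArg (eval x) hg
    rw [hr] at this
    simp only [eval_sub, eval_C, eval_mul, eval_X] at this
    rw [this]
    ring
  rw [h1, abs_mul, abs_of_nonneg (sq_nonneg _), mul_comm]
  have h2 := hM x hx
  rw [Real.norm_eq_abs] at h2
  have := le_abs_self M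
  gcongr
  linarith

/-- The number of Grover iterations and the success probability to which the block encoding is
attenuated: at `p` the amplified amplitude is constant to first order relative to the original
amplitude, and it is bounded below. -/
theorem exists_critical (η : ℝ) (h0 : 0 < η) (h1 : η ≤ 1) :
    ∃ (k : ℕ) (p M : ℝ), (k : ℝ) + 1 ≤ 7 * η⁻¹ ∧ 0 < p ∧ p ≤ η ^ 2 / 2 ∧ 0 < M ∧
      2 / 3 ≤ √p * |(amp k).1.eval p| ∧
      ∀ x ∈ Set.Icc (0 : ℝ) 1, |(amp k).1.eval x - (amp k).1.eval p| ≤ M * (x - p) ^ 2 := by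
  obtain ⟨k, hk⟩ : ∃ k : ℕ, k = ⌈5 * η⁻¹⌉₊ := ⟨_, rfl⟩
  have hinv : 1 ≤ η⁻¹ := (one_le_inv₀ h0).mpr h1
  have hk1 : 5 * η⁻¹ ≤ k := hk ▸ Nat.le_ceil _
  have hk2 : (k : ℝ) < 5 * η⁻¹ + 1 := hk ▸ Nat.ceil_lt_add_one (by positivity)
  have hpi := Real.pi_pos
  have hpi4 := Real.pi_lt_d2
  set n : ℝ := 2 * k + 1 with hn
  have hn0 : 10 < n := by linarith
  -- the first positive zeros of `sin (n x)` are `φ` and `2 φ`, and its minimum is at `3 / 2 * φ`;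
  -- the bound `5 * η⁻¹ ≤ k` keeps all of these angles small compared to `η`
  set φ : ℝ := Real.pi / n with hφ
  have hφ0 : 0 < φ := by positivity
  have hnφ : n * φ = Real.pi := by rw [hφ]; field_simp
  have hφ1 : 2 * φ < Real.pi / 2 := by nlinarith
  have hφη : 2 * φ ≤ 7 / 10 * η := by
    have : 10 ≤ n * η := by
      have : η⁻¹ * η = 1 := inv_mul_cancel₀ h0.ne'
      nlinarith
    have : 2 * Real.pi ≤ 7 / 10 * (n * η) := by nlinarith
    nlinarith
  have hsin_pos : ∀ x, φ ≤ x → x ≤ 2 * φ → 0 < Real.sin x := fun x hx1 hx2 =>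
    Real.sin_pos_of_pos_of_lt_pi (by linarith) (by linarith)
  have hmono : ∀ x y, 0 ≤ x → x ≤ y → y ≤ 2 * φ → Real.sin x ≤ Real.sin y := fun x y hx hxy hy =>
    Real.sin_le_sin_of_le_of_le_pi_div_two (by linarith) (by linarith) hxy
  have hs1 := hsin_pos φ le_rfl (by linarith)
  have hs2 := hsin_pos (2 * φ) (by linarith) le_rfl
  have hs3 := hsin_pos (3 / 2 * φ) (by linarith) (by linarith)
  have h12 := hmono φ (3 / 2 * φ) hφ0.le (by linarith) (by linarith)
  have h23 := hmono (3 / 2 * φ) (2 * φ) (by linarith) (by linarith) le_rfl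
  -- the signed amplitude, which is negative between its zeros `φ` and `2 φ`
  set f : ℝ[X] := (-1) ^ k * (amp k).1 with hf
  have hfs : ∀ x, f.eval (Real.sin x ^ 2) * Real.sin x = Real.sin (n * x) := by
    intro x
    have := (amp_sin k x).1
    simp only [hf, eval_mul, eval_pow, eval_neg, eval_one]
    rw [mul_assoc, this, ← mul_assoc, ← mul_pow]
    simp [hn]
  have hfabs : ∀ x, |f.eval x| = |(amp k).1.eval x| := by
    intro x
    simp [hf, abs_mul]
  have e1 : f.eval (Real.sin φ ^ 2) = 0 := by
    have := hfs φ
    rw [hnφ, Real.sin_pi] at this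
    exact (mul_eq_zero.mp this).resolve_right hs1.ne'
  have e2 : f.eval (Real.sin (2 * φ) ^ 2) = 0 := by
    have := hfs (2 * φ)
    rw [show n * (2 * φ) = 2 * Real.pi by linarith, Real.sin_two_pi] at this
    exact (mul_eq_zero.mp this).resolve_right hs2.ne'
  have e3 : f.eval (Real.sin (3 / 2 * φ) ^ 2) * Real.sin (3 / 2 * φ) = -1 := by
    rw [hfs, show n * (3 / 2 * φ) = Real.pi / 2 + Real.pi by linarith, Real.sin_add_pi,
      Real.sin_pi_div_two]
  have e3' : f.eval (Real.sin (3 / 2 * φ) ^ 2) < 0 := by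
    by_contra! h
    nlinarith
  have hq1 : Real.sin φ ^ 2 ≤ Real.sin (3 / 2 * φ) ^ 2 := by gcongr
  have hq2 : Real.sin (3 / 2 * φ) ^ 2 ≤ Real.sin (2 * φ) ^ 2 := by gcongr
  obtain ⟨p, hp, hmin⟩ := isCompact_Icc.exists_isMinOn
    (s := Set.Icc (Real.sin φ ^ 2) (Real.sin (2 * φ) ^ 2)) ⟨_, hq1, hq2⟩
    (f := fun x => f.eval x) f.continuous.continuousOn
  have hle : f.eval p ≤ f.eval (Real.sin (3 / 2 * φ) ^ 2) := hmin ⟨hq1, hq2⟩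
  have hp1 : Real.sin φ ^ 2 < p := lt_of_le_of_ne hp.1 (by rintro rfl; linarith)
  have hp2 : p < Real.sin (2 * φ) ^ 2 := lt_of_le_of_ne hp.2 (by rintro rfl; linarith)
  have hder : f.derivative.eval p = 0 := by
    have hloc : IsLocalMin (fun x => f.eval x) p := hmin.isLocalMin (Icc_mem_nhds hp1 hp2)
    exact hloc.hasDerivAt_eq_zero (f.hasDerivAt p)
  have hder' : (amp k).1.derivative.eval p = 0 := by
    have h3 : f.derivative.eval p = (-1) ^ k * (amp k).1.derivative.eval p := by
      have : f = C ((-1) ^ k) * (amp k).1 := by simp [hf]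
      rw [this, derivative_C_mul]
      simp
    rw [h3] at hder
    exact (mul_eq_zero.mp hder).resolve_left (pow_ne_zero _ (by norm_num))
  obtain ⟨M, hM0, hM⟩ := exists_quadratic_bound _ p hder'
  have hp0 : 0 < p := lt_of_le_of_lt (sq_nonneg _) hp1
  refine ⟨k, p, M, by linarith, hp0, ?_, hM0, ?_, hM⟩
  · have h4 : Real.sin (2 * φ) ≤ 7 / 10 * η := (Real.sin_le (by linarith)).trans hφη
    nlinarith
  · rw [← hfabs]
    have h5 : Real.sin φ ≤ √p := Real.le_sqrt_of_sq_le hp1.le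
    have h6 : 1 ≤ |f.eval p| * Real.sin (3 / 2 * φ) := by
      rw [abs_of_neg (by linarith)]
      nlinarith
    -- concavity of the sine
    have h7 : 2 / 3 * Real.sin (3 / 2 * φ) ≤ Real.sin φ := by
      have hc := strictConcaveOn_sin_Icc.concaveOn.2 (show (0 : ℝ) ∈ Set.Icc 0 Real.pi from
        ⟨le_rfl, hpi.le⟩) (show 3 / 2 * φ ∈ Set.Icc 0 Real.pi from ⟨by linarith, by linarith⟩)
        (show (0 : ℝ) ≤ 1 / 3 by norm_num) (show (0 : ℝ) ≤ 2 / 3 by norm_num) (by norm_num)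
      simp only [smul_eq_mul, Real.sin_zero, mul_zero, zero_add] at hc
      rwa [show 2 / 3 * (3 / 2 * φ) = φ by ring] at hc
    have h8 : Real.sin φ * |f.eval p| ≤ √p * |f.eval p| := by gcongr
    have h9 := mul_le_mul_of_nonneg_right h7 (abs_nonneg (f.eval p))
    linarith

end

/-! ### Accuracy of the output -/

/-- The parameters of the routine: the number `k` of Grover iterations, the success probability
`p` to which the block encoding is attenuated, and the accuracy `τ √ε` with which its success
probability has to be known for a relative error of `ε / 8`. -/
theorem exists_params (η : ℝ) (h0 : 0 < η) (h1 : η ≤ 1) :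
    ∃ (k : ℕ) (p τ : ℝ), (k : ℝ) + 1 ≤ 7 * η⁻¹ ∧ 0 < p ∧ p ≤ η ^ 2 / 2 ∧ 0 < τ ∧ τ ≤ η ^ 2 / 16 ∧
      2 / 3 ≤ √p * |(amp k).1.eval p| ∧
      ∀ x ∈ Set.Icc (0 : ℝ) 1, 8 * τ ^ 2 * |(amp k).1.eval x - (amp k).1.eval p| ≤
        |(amp k).1.eval p| * (x - p) ^ 2 := by
  obtain ⟨k, p, M, hk, hp0, hp, hM0, hl, hM⟩ := exists_critical η h0 h1
  have ha : 0 < |(amp k).1.eval p| := by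
    by_contra! h
    have := Real.sqrt_nonneg p
    nlinarith
  refine ⟨k, p, min (η ^ 2 / 16) √(|(amp k).1.eval p| / (8 * M)), hk, hp0, hp,
    lt_min (by positivity) (by positivity), min_le_left _ _, hl, fun x hx => ?_⟩
  have h2 : (min (η ^ 2 / 16) √(|(amp k).1.eval p| / (8 * M))) ^ 2 ≤
      |(amp k).1.eval p| / (8 * M) := by
    rw [← Real.sq_sqrt (show 0 ≤ |(amp k).1.eval p| / (8 * M) by positivity)]
    have : 0 ≤ min (η ^ 2 / 16) √(|(amp k).1.eval p| / (8 * M)) := by positivity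
    gcongr
    rw [Real.sqrt_sq (Real.sqrt_nonneg _)]
    exact min_le_right _ _
  calc _ ≤ 8 * (|(amp k).1.eval p| / (8 * M)) * (M * (x - p) ^ 2) := by
        gcongr
        exact hM x hx
    _ = |(amp k).1.eval p| * (x - p) ^ 2 := by field_simp

/-- The output of the routine when the estimate of the success probability is `phat`. The first
angle attenuates the success probability by `p / phat`, hence to about `p`; the second one
attenuates the amplified amplitude to about one third. -/
noncomputable def output (k : ℕ) (p : ℝ) (s : Shape) (phat : ℝ) : BoxEncoding s :=
  amplified s (Real.arccos √(p / phat)) (Real.arccos (1 / (3 * √p * (amp k).1.eval p)))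
    (3 * s.γ * √phat) k

/-- The attenuated and amplified amplitude is the original one, divided by `3 √phat`, up to a
relative error of `ε / 8`. -/
theorem amplitude_estimate {ε η p τ phat e : ℝ} {k : ℕ} (hε0 : 0 < ε) (hε1 : ε < 1) (hη0 : 0 < η)
    (hη : η ≤ e) (he1 : e ≤ 1) (hp0 : 0 < p) (hp : p ≤ η ^ 2 / 2) (hτ0 : 0 < τ)
    (hτ : τ ≤ η ^ 2 / 16) (hl : 2 / 3 ≤ √p * |(amp k).1.eval p|)
    (hflat : ∀ x ∈ Set.Icc (0 : ℝ) 1, 8 * τ ^ 2 * |(amp k).1.eval x - (amp k).1.eval p| ≤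
      |(amp k).1.eval p| * (x - p) ^ 2)
    (hest : |phat - e ^ 2| ≤ τ * √ε) :
    ∃ t : ℝ, |t - 1| ≤ ε / 8 ∧ 0 < √phat ∧ 9 / 10 * e ≤ √phat ∧ 9 / 10 * √phat ≤ e ∧
      Real.cos (Real.arccos (1 / (3 * √p * (amp k).1.eval p))) *
        Real.cos (Real.arccos √(p / phat)) *
        (amp k).1.eval (Real.cos (Real.arccos √(p / phat)) ^ 2 * e ^ 2) = t / (3 * √phat) := by
  have he0 : 0 < e := hη0.trans_le hη
  have hsε : √ε ≤ 1 := Real.sqrt_le_one.mpr hε1.le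
  have hηe : η ^ 2 ≤ e ^ 2 := by gcongr
  have he2 : 0 < e ^ 2 := by positivity
  have hest' : |phat - e ^ 2| ≤ e ^ 2 / 16 := by
    have : τ * √ε ≤ τ * 1 := by gcongr
    linarith
  obtain ⟨hlo, hhi⟩ := abs_le.mp hest'
  have hph0 : 0 < phat := by linarith
  have hpph : p ≤ phat := by linarith
  have hsph : 0 < √phat := Real.sqrt_pos.mpr hph0
  have hsp : 0 < √p := Real.sqrt_pos.mpr hp0
  have hroot : 9 / 10 * e ≤ √phat := by
    apply Real.le_sqrt_of_sq_le
    rw [mul_pow]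
    linarith
  have hroot' : 9 / 10 * √phat ≤ e := by
    refine abs_le_of_sq_le_sq' ?_ he0.le |>.2
    rw [mul_pow, Real.sq_sqrt hph0.le]
    linarith
  generalize ha : (amp k).1.eval p = a at *
  have ha0 : a ≠ 0 := by
    rintro rfl
    norm_num at hl
  have hc : Real.cos (Real.arccos √(p / phat)) = √(p / phat) := by
    apply Real.cos_arccos
    · linarith [Real.sqrt_nonneg (p / phat)]
    · rw [Real.sqrt_le_one, div_le_one hph0]
      exact hpph
  have hr : Real.cos (Real.arccos (1 / (3 * √p * a))) = 1 / (3 * √p * a) := by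
    have : |1 / (3 * √p * a)| ≤ 1 := by
      rw [abs_div, abs_one, abs_mul, abs_of_pos (by positivity : 0 < 3 * √p), div_le_one₀]
      · linarith
      · positivity
    exact Real.cos_arccos (abs_le.mp this).1 (abs_le.mp this).2
  rw [hc, hr, Real.sq_sqrt (by positivity)]
  -- the success probability after the attenuation
  obtain ⟨x, hx⟩ : ∃ x, x = p / phat * e ^ 2 := ⟨_, rfl⟩
  have hpp1 : p / phat ≤ 1 := (div_le_one hph0).mpr hpph
  have hpp0 : 0 < p / phat := by positivity
  have hxI : x ∈ Set.Icc (0 : ℝ) 1 := by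
    rw [hx]
    exact ⟨by positivity, mul_le_one₀ hpp1 he2.le (pow_le_one₀ he0.le he1)⟩
  have hxp : (x - p) ^ 2 ≤ τ ^ 2 * ε := by
    have h1 : x - p = p / phat * (e ^ 2 - phat) := by
      rw [hx]
      field_simp
    have h2 : |x - p| ≤ τ * √ε := by
      rw [h1, abs_mul, abs_of_pos hpp0, abs_sub_comm]
      calc p / phat * |phat - e ^ 2| ≤ 1 * (τ * √ε) := by gcongr
        _ = _ := one_mul _
    calc (x - p) ^ 2 = |x - p| ^ 2 := (sq_abs _).symm
      _ ≤ (τ * √ε) ^ 2 := by gcongr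
      _ = τ ^ 2 * ε := by rw [mul_pow, Real.sq_sqrt hε0.le]
  rw [← hx]
  refine ⟨(amp k).1.eval x / a, ?_, hsph, hroot, hroot', ?_⟩
  · have h1 := hflat x hxI
    have h2 : |a| * (x - p) ^ 2 ≤ |a| * (τ ^ 2 * ε) := by gcongr
    have h3 : |(amp k).1.eval x - a| ≤ |a| * (ε / 8) := by
      have : 0 < 8 * τ ^ 2 := by positivity
      refine le_of_mul_le_mul_left ?_ this
      linarith
    have h4 : (amp k).1.eval x / a - 1 = ((amp k).1.eval x - a) / a := by field_simp
    rw [h4, abs_div, div_le_iff₀ (by positivity)]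
    linarith
  · rw [Real.sqrt_div hp0.le]
    field_simp

/-- The two errors, `ε / 2` of the given block encoding and `ε / 8` of the amplified amplitude, add
up to less than `ε`. The efficiency is about a third, which leaves room for `‖v‖ ≤ γ'`. -/
theorem output_spec {N : ℕ} {B : BlockEncoding N} {v : EuclideanSpace ℂ (Fin N)} {ε η p τ phat : ℝ}
    {k : ℕ} (hε0 : 0 < ε) (hε1 : ε < 1) (hB : B.Encodes v (ε / 2)) (hη0 : 0 < η)
    (hη : η ≤ B.efficiency) (hp0 : 0 < p) (hp : p ≤ η ^ 2 / 2) (hτ0 : 0 < τ)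
    (hτ : τ ≤ η ^ 2 / 16) (hl : 2 / 3 ≤ √p * |(amp k).1.eval p|)
    (hflat : ∀ x ∈ Set.Icc (0 : ℝ) 1, 8 * τ ^ 2 * |(amp k).1.eval x - (amp k).1.eval p| ≤
      |(amp k).1.eval p| * (x - p) ^ 2)
    (hest : |phat - B.efficiency ^ 2| ≤ τ * √ε) :
    ((output k p B.shape phat).expand B).Encodes v ε ∧
      1 / 4 ≤ ((output k p B.shape phat).expand B).efficiency := by
  obtain ⟨t, ht1, hsph, hroot, hroot', hfac⟩ := amplitude_estimate hε0 hε1 hη0 hη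
    hB.efficiency_le_one hp0 hp hτ0 hτ hl hflat hest
  have he0 : 0 < B.efficiency := hη0.trans_le hη
  clear hη hp hτ hl hflat hest
  have hγ0 : 0 ≤ B.γ := (norm_nonneg v).trans hB.norm_le
  have hBerr := hB.error_le
  have hγvec : ‖(B.γ : ℂ) • B.vec‖ = B.γ * B.efficiency := by
    rw [norm_smul, Complex.norm_real, Real.norm_of_nonneg hγ0, BlockEncoding.efficiency]
  have hγe1 : B.γ * B.efficiency ≤ (1 + ε / 2) * ‖v‖ := by
    have := norm_sub_norm_le ((B.γ : ℂ) • B.vec) v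
    rw [hγvec] at this
    linarith
  have hγe2 : (1 - ε / 2) * ‖v‖ ≤ B.γ * B.efficiency := by
    have := norm_sub_norm_le v ((B.γ : ℂ) • B.vec)
    rw [hγvec, norm_sub_rev] at this
    linarith
  have hv := norm_nonneg v
  refine ⟨amplified_encodes hB _ _ _ _ ?_ ?_, ?_⟩
  · change ‖v‖ ≤ 3 * B.γ * √phat
    have h1 : B.γ * (9 / 10 * B.efficiency) ≤ B.γ * √phat := by gcongr
    have h2 : ε * ‖v‖ ≤ 1 * ‖v‖ := by gcongr
    linarith
  · rw [hfac]
    change ‖((3 * B.γ * √phat * (t / (3 * √phat)) : ℝ) : ℂ) • B.vec - v‖ ≤ ε * ‖v‖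
    have h1 : 3 * B.γ * √phat * (t / (3 * √phat)) = (t - 1) * B.γ + B.γ := by
      field_simp
      ring
    rw [h1, Complex.ofReal_add, Complex.ofReal_mul, add_smul, mul_smul, add_sub_assoc]
    refine (norm_add_le _ _).trans ?_
    rw [norm_smul, hγvec, Complex.norm_real, Real.norm_eq_abs]
    have h2 : |t - 1| * (B.γ * B.efficiency) ≤ ε / 8 * ((1 + ε / 2) * ‖v‖) := by gcongr
    have h3 : ε * (ε * ‖v‖) ≤ 1 * (ε * ‖v‖) := by gcongr
    linarith
  · rw [output, amplified_efficiency hB, hfac, abs_div,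
      abs_of_pos (by positivity : 0 < 3 * √phat)]
    have h1 : 7 / 8 ≤ |t| := by
      have := (abs_le.mp ht1).1
      exact le_trans (by linarith) (le_abs_self t)
    have h2 : 7 / 8 * B.efficiency ≤ |t| * B.efficiency := by gcongr
    rw [div_mul_eq_mul_div, le_div_iff₀ (by positivity)]
    linarith

/-! ### Estimation of the success probability -/

/-- The expectation of `h` after `m` independent trials with success probability `p`, where `h`
depends on the number of successes, counted from `j` on. -/
noncomputable def trials (p : ℝ) (h : ℕ → ℝ) : ℕ → ℕ → ℝ
  | 0, j => h j
  | m + 1, j => (1 - p) * trials p h m j + p * trials p h m (j + 1)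

theorem trials_mono {p : ℝ} (hp0 : 0 ≤ p) (hp1 : p ≤ 1) {h h' : ℕ → ℝ} (hh : ∀ j, h j ≤ h' j)
    (m j : ℕ) : trials p h m j ≤ trials p h' m j := by
  induction m generalizing j with
  | zero => exact hh j
  | succ m ih =>
    have : 0 ≤ 1 - p := by linarith
    simp only [trials]
    gcongr <;> apply ih

theorem trials_add (p : ℝ) (h h' : ℕ → ℝ) (m j : ℕ) :
    trials p (fun i => h i + h' i) m j = trials p h m j + trials p h' m j := by
  induction m generalizing j with
  | zero => rfl
  | succ m ih => simp only [trials, ih]; ring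

theorem trials_one (p : ℝ) (m j : ℕ) : trials p (fun _ => 1) m j = 1 := by
  induction m generalizing j with
  | zero => rfl
  | succ m ih => simp only [trials, ih]; ring

theorem trials_exp (p l b : ℝ) (m j : ℕ) :
    trials p (fun i => Real.exp (l * i + b)) m j =
      (1 - p + p * Real.exp l) ^ m * Real.exp (l * j + b) := by
  induction m generalizing j with
  | zero => simp [trials]
  | succ m ih =>
    have : Real.exp (l * (j + 1 : ℕ) + b) = Real.exp l * Real.exp (l * j + b) := by
      rw [← Real.exp_add]
      push_cast
      ring_nf
    simp only [trials, ih, this]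
    ring

theorem exp_le_add_exp_sq {x : ℝ} (hx : |x| ≤ 1) : Real.exp x ≤ x + Real.exp (x ^ 2) := by
  have h1 := (abs_le.mp (Real.abs_exp_sub_one_sub_id_le hx)).2
  have h2 := Real.add_one_le_exp (x ^ 2)
  linarith

/-- The moment generating function of a Bernoulli variable. -/
theorem bernoulli_mgf_le {p l : ℝ} (hp0 : 0 ≤ p) (hp1 : p ≤ 1) (hl : |l| ≤ 1) :
    1 - p + p * Real.exp l ≤ Real.exp (l * p + l ^ 2) := by
  have hp : |p| ≤ 1 := abs_le.mpr ⟨by linarith, hp1⟩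
  have hp' : |1 - p| ≤ 1 := abs_le.mpr ⟨by linarith, by linarith⟩
  have h1 : Real.exp (l * (1 - p)) ≤ l * (1 - p) + Real.exp (l ^ 2) := by
    refine (exp_le_add_exp_sq ?_).trans ?_
    · rw [abs_mul]; exact mul_le_one₀ hl (abs_nonneg _) hp'
    · have : (l * (1 - p)) ^ 2 ≤ l ^ 2 := by
        rw [mul_pow]
        exact mul_le_of_le_one_right (sq_nonneg _) (by nlinarith)
      linarith [Real.exp_le_exp.mpr this]
  have h2 : Real.exp (-(l * p)) ≤ -(l * p) + Real.exp (l ^ 2) := by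
    refine (exp_le_add_exp_sq ?_).trans ?_
    · rw [abs_neg, abs_mul]; exact mul_le_one₀ hl (abs_nonneg _) hp
    · have : (-(l * p)) ^ 2 ≤ l ^ 2 := by
        rw [neg_sq, mul_pow]
        exact mul_le_of_le_one_right (sq_nonneg _) (by nlinarith)
      linarith [Real.exp_le_exp.mpr this]
  have h3 : p * Real.exp (l * (1 - p)) + (1 - p) * Real.exp (-(l * p)) ≤ Real.exp (l ^ 2) := by
    have h4 := mul_le_mul_of_nonneg_left h1 hp0
    have h5 := mul_le_mul_of_nonneg_left h2 (show 0 ≤ 1 - p by linarith)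
    linarith
  have h6 := mul_le_mul_of_nonneg_left h3 (Real.exp_nonneg (l * p))
  rw [← Real.exp_add] at h6
  refine le_trans (le_of_eq ?_) h6
  rw [mul_add, mul_left_comm, ← Real.exp_add, mul_left_comm, ← Real.exp_add, add_neg_cancel,
    show l * p + l * (1 - p) = l by ring, Real.exp_zero]
  ring

open Classical in
/-- A Chernoff bound for the empirical mean. -/
theorem trials_deviation {p τ : ℝ} (hp0 : 0 ≤ p) (hp1 : p ≤ 1) (hτ0 : 0 < τ) (hτ1 : τ ≤ 1) (m : ℕ)
    (hm : 0 < m) :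
    1 - 2 * Real.exp (-(m * τ ^ 2 / 4)) ≤
      trials p (fun i => if |(i / m : ℝ) - p| ≤ τ then 1 else 0) m 0 := by
  -- exponential Markov inequality: off the good event, one of the two exponentials is at least one
  set l := τ / 2 with hl
  have hl1 : |l| ≤ 1 := by rw [abs_of_pos (by positivity)]; linarith
  have hm' : (0 : ℝ) < m := by exact_mod_cast hm
  have h1 : trials p (fun _ => 1) m 0 ≤ trials p (fun i =>
      (if |(i / m : ℝ) - p| ≤ τ then 1 else 0) + (Real.exp (l * i + -(l * (m * p + m * τ))) +
        Real.exp (-l * i + l * (m * p - m * τ)))) m 0 := by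
    refine trials_mono hp0 hp1 (fun i => ?_) m 0
    have e1 := Real.exp_pos (l * i + -(l * (m * p + m * τ)))
    have e2 := Real.exp_pos (-l * i + l * (m * p - m * τ))
    split_ifs with h
    · linarith
    · push Not at h
      rcases lt_abs.mp h with h | h
      · have h2 : m * p + m * τ < i := by
          have : p + τ < i / m := by linarith
          rw [lt_div_iff₀ hm'] at this
          linarith
        have h3 : 1 ≤ Real.exp (l * i + -(l * (m * p + m * τ))) := by
          apply Real.one_le_exp
          have : 0 < l := by positivity
          nlinarith
        linarith
      · have h2 : i < m * p - m * τ := by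
          have : (i : ℝ) / m < p - τ := by linarith
          rw [div_lt_iff₀ hm'] at this
          linarith
        have h3 : 1 ≤ Real.exp (-l * i + l * (m * p - m * τ)) := by
          apply Real.one_le_exp
          have : 0 < l := by positivity
          nlinarith
        linarith
  rw [trials_one, trials_add, trials_add, trials_exp, trials_exp] at h1
  have key : ∀ l' b : ℝ, |l'| ≤ 1 → l' ^ 2 = τ ^ 2 / 4 → m * (l' * p) + b = -(m * τ ^ 2 / 2) →
      (1 - p + p * Real.exp l') ^ m * Real.exp (l' * (0 : ℕ) + b) ≤
        Real.exp (-(m * τ ^ 2 / 4)) := by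
    intro l' b hl' hsq hb
    have h2 := bernoulli_mgf_le hp0 hp1 hl'
    have h3 : 0 ≤ 1 - p + p * Real.exp l' := by
      have := mul_nonneg hp0 (Real.exp_nonneg l')
      linarith
    calc (1 - p + p * Real.exp l') ^ m * Real.exp (l' * (0 : ℕ) + b)
        ≤ Real.exp (l' * p + l' ^ 2) ^ m * Real.exp (l' * (0 : ℕ) + b) := by gcongr
      _ = Real.exp (-(m * τ ^ 2 / 4)) := by
        rw [← Real.exp_nat_mul, ← Real.exp_add, hsq]
        congr 1
        push_cast
        linarith
  have k1 := key l (-(l * (m * p + m * τ))) hl1 (by rw [hl]; ring) (by rw [hl]; ring)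
  have k2 := key (-l) (l * (m * p - m * τ)) (by rwa [abs_neg]) (by rw [hl]; ring) (by rw [hl]; ring)
  linarith

/-! ### The routine -/

/-- The routine that tests `m` times whether `Π U |0⟩` is measured, and returns `F i` if this
happens `i - j` times. -/
noncomputable def sampleProg (s : Shape) (F : ℕ → BoxEncoding s) :
    ℕ → ℕ → {n : ℕ} → Prog (BoxGate s) (BoxEncoding s) n
  | 0, j, _ => .ret (F j)
  | m + 1, j, _ => .fresh (s.qubits + (6 + s.work)) <|
      .gate (unitaryCall (layout rfl)) <| .gate (projNotCall (layout rfl) 2) <|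
      .measure (aux (layout rfl : Layout s _) 2) fun b => sampleProg s F m (if b then j + 1 else j)

section

variable {N : ℕ} {B : BlockEncoding N}

theorem single_eq_regState {q r w n : ℕ} (e : Fin q ⊕ Fin r ⊕ Fin w ≃ Fin n) :
    (Pi.single (zeroBits n) 1 : Bits n → ℂ) =
      regState e fun x s => if x = zeroBits q ∧ s = zeroBits r then 1 else 0 := by
  ext z
  have h : z = zeroBits n ↔ (∀ j, z (e (.inr (.inr j))) = false) ∧
      (fun i => z (e (.inl i))) = zeroBits q ∧ (fun i => z (e (.inr (.inl i)))) = zeroBits r := by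
    simp only [funext_iff, zeroBits, ← e.forall_congr_right, Sum.forall]
    tauto
  simp only [Pi.single_apply, h, regState]
  split_ifs <;> tauto

theorem normSq_mask {q r w n : ℕ} (e : Fin q ⊕ Fin r ⊕ Fin w ≃ Fin n) (t : Fin r)
    {Φ : Bits q → Bits r → ℂ} {ψ : Bits n → ℂ} (h : ψ = regState e Φ) :
    normSq (fun z => if z (aux e t) = true then ψ z else 0) =
      ∑ x, ∑ s, ‖if s t = true then Φ x s else 0‖ ^ 2 := by
  rw [h, ← normSq_regState (e := e) fun x s => if s t = true then Φ x s else 0]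
  congr 1
  ext z
  simp only [regState]
  split_ifs <;> rfl

/-- The probability that a test succeeds. -/
theorem normSq_success {v : EuclideanSpace ℂ (Fin N)} {ε : ℝ} (hB : B.Encodes v ε) {n : ℕ}
    (e : Layout B.shape n) :
    normSq (fun z => if z (aux e 2) = true then
      (Circuit.matrix (expandList B [unitaryCall e] ++ expandList B [projNotCall e 2]) *ᵥ
        Pi.single (zeroBits n) 1) z else 0) = B.efficiency ^ 2 := by
  have h := (actsOnMain_unitaryCall hB.unitary_clean e
    (fun x s => if x = zeroBits B.qubits ∧ s = zeroBits 6 then 1 else 0)).append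
    (maps_projNotCall hB.projNot_implements e 2 _)
  have h0 := (congrArg ((expandList B [unitaryCall e] ++
    expandList B [projNotCall e 2]).matrix *ᵥ ·) (single_eq_regState e)).trans h
  refine (normSq_mask _ 2 h0).trans ?_
  have h1 : ∀ s : Bits 6, ((B.unitary.matrix *ᵥ fun y =>
      if y = zeroBits B.qubits ∧ s = zeroBits 6 then (1 : ℂ) else 0) =
      if s = zeroBits 6 then fun x => B.unitary.matrix x (zeroBits B.qubits) else 0) := by
    intro s
    ext x
    split_ifs with hs <;> simp [Matrix.mulVec, dotProduct, hs]
  have h2 : ∀ (A : Matrix (Bits B.qubits) (Bits B.qubits) ℂ) (s : Bits 6),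
      (A *ᵥ fun y => (B.unitary.matrix *ᵥ fun y =>
        if y = zeroBits B.qubits ∧ s = zeroBits 6 then (1 : ℂ) else 0) y) =
      if s = zeroBits 6 then A *ᵥ fun x => B.unitary.matrix x (zeroBits B.qubits) else 0 := by
    intro A s
    rw [h1]
    split_ifs with hs
    · rfl
    · exact Matrix.mulVec_zero A
  simp only [h2]
  have hP : (B.projᴴ * B.proj)ᴴ * (B.projᴴ * B.proj) = B.projᴴ * B.proj := by
    rw [Matrix.conjTranspose_mul, Matrix.conjTranspose_conjTranspose,
      isProj_of_orthonormal hB.orthonormal_rows]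
  have h3 := ofReal_normSq_mulVec (B.projᴴ * B.proj)
    fun x => B.unitary.matrix x (zeroBits B.qubits)
  rw [hP, ← ofReal_normSq_mulVec, ← B.efficiency_sq] at h3
  have h4 : normSq ((B.projᴴ * B.proj) *ᵥ fun x => B.unitary.matrix x (zeroBits B.qubits)) =
      B.efficiency ^ 2 := by exact_mod_cast h3
  rw [← h4]
  refine Finset.sum_congr rfl fun x _ => ?_
  rw [Finset.sum_eq_single (Function.update (zeroBits 6) 2 true)]
  · have h5 : Function.update (zeroBits 6) 2 true ≠ zeroBits 6 := fun h => by
      have := congrFun h 2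
      simp [zeroBits] at this
    have h6 : Function.update (zeroBits 6) 2 false = zeroBits 6 := by
      rw [Function.update_eq_self_iff]; rfl
    simp [h5, h6]
  · intro s _ hs
    by_cases hs2 : s 2 = true
    · have h5 : s ≠ zeroBits 6 := by
        rintro rfl
        simp [zeroBits] at hs2
      have h6 : Function.update s 2 false ≠ zeroBits 6 := fun h => hs <| by
        rw [← h]
        simp [← hs2]
      simp [hs2, h5, h6]
    · simp [hs2]
  · simp

/-- The distribution of the returned value is that of independent trials whose success probability
is the square of the efficiency. -/
theorem sampleProg_expect {v : EuclideanSpace ℂ (Fin N)} {ε : ℝ} (hB : B.Encodes v ε)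
    (F : ℕ → BoxEncoding B.shape) (G : BlockEncoding N → ℝ) (m j : ℕ) {n : ℕ} (ψ : Bits n → ℂ) :
    ((sampleProg B.shape F m j : Prog _ _ n).expand B).expect ψ G =
      normSq ψ * trials (B.efficiency ^ 2) (fun i => G ((F i).expand B)) m j := by
  induction m generalizing j n with
  | zero => exact Prog.expect_ret _ _ _
  | succ m ih =>
    have h1 := normSq_success hB (layout rfl)
    have h2 := normSq_split (aux (layout rfl : Layout B.shape _) 2)
      (Circuit.matrix (expandList B [unitaryCall (layout rfl)] ++
        expandList B [projNotCall (layout rfl) 2]) *ᵥ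
        Pi.single (zeroBits (B.shape.qubits + (6 + B.shape.work))) 1)
    rw [normSq_circuit, normSq_single, h1] at h2
    rw [sampleProg, Prog.expand, Prog.expect_fresh, Prog.expand, Prog.expect_foldr_gate,
      Prog.expand, Prog.expect_foldr_gate, Prog.expand, Prog.expect_measure, ih, ih,
      Matrix.mulVec_mulVec, ← Circuit.matrix_append]
    have h3 : ∀ g : BoxGate B.shape (B.shape.qubits + (6 + B.shape.work)),
        g.expand B = expandList B [g] := fun g => (List.append_nil _).symm
    rw [h3, h3, h1, trials]
    simp only [if_true, Bool.false_eq_true, if_false]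
    congr 2
    · congr 1
      linarith

theorem length_expand_calls {n : ℕ} (e : Layout B.shape n) :
    ((unitaryCall e).expand B).length + ((projNotCall e 2).expand B).length ≤ B.gates := by
  have h1 := length_unitaryCall B e
  have h2 := length_projNotCall B e 2
  have h3 : ∀ g : BoxGate B.shape n, g.expand B = expandList B [g] :=
    fun g => (List.append_nil _).symm
  rw [h3, h3, h1, h2, BlockEncoding.gates]
  omega

theorem sampleProg_runs (F : ℕ → BoxEncoding B.shape) (m j : ℕ) {n : ℕ} (ψ : Bits n → ℂ) :
    ∀ r ∈ ((sampleProg B.shape F m j : Prog _ _ n).expand B).runs ψ,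
      r.gates ≤ m * B.gates ∧ ∃ i, r.output = (F i).expand B := by
  induction m generalizing j n with
  | zero =>
    intro r hr
    rw [sampleProg, Prog.expand, Prog.runs, List.mem_singleton] at hr
    subst hr
    exact ⟨Nat.zero_le _, j, rfl⟩
  | succ m ih =>
    intro r hr
    rw [sampleProg, Prog.expand, Prog.runs, Prog.expand, Prog.runs_foldr_gate, Prog.expand,
      Prog.runs_foldr_gate, Prog.expand, Prog.runs] at hr
    simp only [List.mem_map, List.mem_append] at hr
    obtain ⟨_, ⟨_, ⟨r, hr, rfl⟩, rfl⟩, rfl⟩ := hr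
    have h := length_expand_calls (layout rfl : Layout B.shape _)
    have h' : r.gates ≤ m * B.gates ∧ ∃ i, r.output = (F i).expand B := by
      rcases hr with hr | hr <;> exact ih _ _ r hr
    refine ⟨?_, h'.2⟩
    have h'' := h'.1
    simp only [add_mul, one_mul]
    omega

end

/-- The number of tests for an estimate with accuracy `τ √ε` and failure probability `δ / 2`. -/
noncomputable def numSamples (τ ε δ : ℝ) : ℕ := ⌈4 / (τ ^ 2 * ε) * Real.log (4 / δ)⌉₊

theorem numSamples_pos {τ ε δ : ℝ} (hτ : 0 < τ) (hε : 0 < ε) (hδ0 : 0 < δ) (hδ1 : δ < 1) :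
    0 < numSamples τ ε δ := by
  apply Nat.ceil_pos.mpr
  have : 0 < Real.log (4 / δ) := Real.log_pos (by rw [lt_div_iff₀ hδ0]; linarith)
  positivity

theorem exp_numSamples_le {τ ε δ : ℝ} (hτ : 0 < τ) (hε : 0 < ε) (hδ0 : 0 < δ) :
    2 * Real.exp (-(numSamples τ ε δ * (τ * √ε) ^ 2 / 4)) ≤ δ / 2 := by
  have h1 : 4 / (τ ^ 2 * ε) * Real.log (4 / δ) ≤ numSamples τ ε δ := Nat.le_ceil _
  have h2 : Real.log (4 / δ) ≤ numSamples τ ε δ * (τ * √ε) ^ 2 / 4 := by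
    rw [mul_pow, Real.sq_sqrt hε.le]
    rw [div_mul_eq_mul_div, div_le_iff₀ (by positivity)] at h1
    linarith
  have h3 : Real.exp (-(numSamples τ ε δ * (τ * √ε) ^ 2 / 4)) ≤ Real.exp (-Real.log (4 / δ)) :=
    Real.exp_le_exp.mpr (by linarith)
  rw [Real.exp_neg (Real.log (4 / δ)), Real.exp_log (by positivity), inv_div] at h3
  linarith

theorem numSamples_le {τ ε δ : ℝ} (hτ : 0 < τ) (hε0 : 0 < ε) (hε1 : ε < 1) (hδ0 : 0 < δ)
    (hδ1 : δ < 1) :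
    (numSamples τ ε δ : ℝ) ≤ (8 / τ ^ 2 + 1) * ε⁻¹ * (1 + Real.log δ⁻¹) := by
  have hl0 : 0 ≤ Real.log δ⁻¹ := Real.log_nonneg ((one_le_inv₀ hδ0).mpr hδ1.le)
  have hinv : 1 ≤ ε⁻¹ := (one_le_inv₀ hε0).mpr hε1.le
  have h4 : Real.log (4 / δ) ≤ 2 * (1 + Real.log δ⁻¹) := by
    rw [div_eq_mul_inv, Real.log_mul (by norm_num) (by positivity),
      show (4 : ℝ) = 2 ^ 2 by norm_num, Real.log_pow]
    have := Real.log_two_lt_d9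
    push_cast
    linarith
  have h5 : 0 ≤ Real.log (4 / δ) := Real.log_nonneg (by rw [le_div_iff₀ hδ0]; linarith)
  have h1 : (numSamples τ ε δ : ℝ) < 4 / (τ ^ 2 * ε) * Real.log (4 / δ) + 1 :=
    Nat.ceil_lt_add_one (by positivity)
  have h2 : 4 / (τ ^ 2 * ε) * Real.log (4 / δ) ≤ 8 / τ ^ 2 * ε⁻¹ * (1 + Real.log δ⁻¹) := by
    calc _ ≤ 4 / (τ ^ 2 * ε) * (2 * (1 + Real.log δ⁻¹)) := by gcongr
      _ = _ := by field_simp; ring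
  have h3 : 1 ≤ ε⁻¹ * (1 + Real.log δ⁻¹) := one_le_mul_of_one_le_of_one_le hinv (by linarith)
  linarith

/-- The routine: estimate the success probability, and amplify accordingly. -/
noncomputable def amplification (k : ℝ → ℕ) (p τ : ℝ → ℝ) : Routine := fun η ε δ s =>
  sampleProg s (fun i => output (k η) (p η) s (i / numSamples (τ η) ε δ))
    (numSamples (τ η) ε δ) 0

/-! ### The converted encoding -/

theorem Prog.expect_nonneg {α : Type} {n : ℕ} (p : Prog Gate α n) (ψ : Bits n → ℂ) {F : α → ℝ}
    (h : ∀ a, 0 ≤ F a) : 0 ≤ p.expect ψ F := by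
  apply List.sum_nonneg
  intro x hx
  obtain ⟨r, hr, rfl⟩ := List.mem_map.mp hx
  exact mul_nonneg (p.runs_prob_nonneg ψ r hr) (h _)

theorem Prog.exists_run_of_prob_pos {α : Type} (p : Prog Gate α 0) {S : α → Prop}
    (h : 0 < p.prob S) : ∃ r ∈ p.allRuns, 0 < r.prob ∧ S r.output := by
  classical
  by_contra! h'
  refine h.ne' (List.sum_eq_zero fun x hx => ?_)
  obtain ⟨r, hr, rfl⟩ := List.mem_map.mp hx
  rcases (p.runs_prob_nonneg _ r hr).eq_or_lt with h1 | h1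
  · simp [← h1]
  · simp [h' r hr h1]

theorem Prog.le_prob_bind {α β : Type} (p : Prog Gate α 0) (f : α → Prog Gate β 0)
    {S : α → Prop} {S' : β → Prop} {c : ℝ} (h : ∀ a, S a → c ≤ (f a).prob S') :
    c * p.prob S ≤ (p.bind f).prob S' := by
  classical
  simp only [Prog.prob_eq_expect] at h ⊢
  rw [Prog.expect_bind, ← Prog.expect_const_mul]
  refine Prog.expect_mono _ _ fun a => ?_
  split_ifs with ha
  · rw [mul_one]
    exact h a ha
  · rw [mul_zero]
    exact Prog.expect_nonneg _ _ fun b => by split_ifs <;> norm_num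

theorem Prog.exists_run {α : Type} (p : Prog Gate α 0) : ∃ r ∈ p.allRuns, 0 < r.prob := by
  have h : 0 < p.prob fun _ => True := by
    rw [Prog.prob_eq_expect]
    simp only [if_true]
    rw [Prog.expect_one, normSq_bits_zero]
    exact one_pos
  obtain ⟨r, hr, h0, -⟩ := p.exists_run_of_prob_pos h
  exact ⟨r, hr, h0⟩

section

variable {I : Type} {N : ℕ} {A : Algorithm I N} {T : EncTask I N} {k : ℝ → ℕ} {p τ : ℝ → ℝ}
  {η ε δ : ℝ} {i : I}

theorem mem_convert_runs {R : Routine} {r : Run (BlockEncoding N)} :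
    r ∈ (R.convert η A ε δ i).allRuns ↔ ∃ s ∈ (A (ε / 2) (δ / 2) i).allRuns,
      ∃ s' ∈ ((R η ε δ s.output.shape).expand s.output).allRuns,
        r = ⟨s.prob * s'.prob, s.gates + s'.gates, s'.output⟩ := by
  simp only [Routine.convert, Prog.allRuns, Prog.runs_bind, List.mem_flatMap, List.mem_map,
    eq_comm]

theorem prob_pos_of_mul {p : Prog Gate (BlockEncoding N) 0}
    {R : Prog Gate (BlockEncoding N) 0} {s s' : Run (BlockEncoding N)} (hs : s ∈ p.allRuns)
    (hs' : s' ∈ R.allRuns) (h : 0 < s.prob * s'.prob) : 0 < s.prob ∧ 0 < s'.prob := by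
  have h1 := p.runs_prob_nonneg _ s hs
  have h2 := R.runs_prob_nonneg _ s' hs'
  exact ⟨h1.lt_of_ne (by rintro h'; simp [← h'] at h), h2.lt_of_ne (by rintro h'; simp [← h'] at h)⟩

theorem gates_le_outputGates {p : Prog Gate (BlockEncoding N) 0} {s : Run (BlockEncoding N)}
    (hs : s ∈ p.allRuns) (h : 0 < s.prob) : (s.output.gates : ENNReal) ≤ p.outputGates :=
  le_iSup₂_of_le s hs (le_iSup_of_le h le_rfl)

/-- Every output contains the circuits of the original block encoding. -/
theorem outputGates_le_convert :
    (A (ε / 2) (δ / 2) i).outputGates ≤ ((amplification k p τ).convert η A ε δ i).outputGates := by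
  refine iSup₂_le fun s hs => iSup_le fun h => ?_
  obtain ⟨s', hs', h'⟩ := ((amplification k p τ η ε δ s.output.shape).expand s.output).exists_run
  have h1 := gates_le_outputGates (mem_convert_runs.mpr ⟨s, hs, s', hs', rfl⟩) (mul_pos h h')
  refine le_trans ?_ h1
  obtain ⟨-, j, hj⟩ := sampleProg_runs _ _ _ _ s' hs'
  rw [hj]
  exact_mod_cast gates_le_gates_amplified _ _ _ _ _

/-- A constructive encoding returns a valid block encoding with positive probability, which
restricts its efficiency and its worst-case size. -/
theorem IsConstructiveEncoding.exists_valid (hA : IsConstructiveEncoding A T η) (hε0 : 0 < ε)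
    (hε1 : ε < 1) (hδ0 : 0 < δ) (hδ1 : δ < 1) {y : EuclideanSpace ℂ (Fin N)} (hy : T.Target i y) :
    η ≤ 1 ∧ 1 ≤ (A ε δ i).outputGates := by
  have h := hA ε δ hε0 hε1 hδ0 hδ1 i y hy
  obtain ⟨r, hr, h0, hB, he⟩ := (A ε δ i).exists_run_of_prob_pos (lt_of_lt_of_le (by linarith) h)
  refine ⟨he.trans hB.efficiency_le_one, le_trans ?_ (gates_le_outputGates hr h0)⟩
  exact_mod_cast hB.one_le_gates

/-- The constant is `1904 = 136 * 7 * 2`: `136 * (k + 1)` gates for each gate of the block encoding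
plus one, at most `7 * η⁻¹` for `k + 1`, and a factor of two to absorb the summand one. -/
theorem convert_outputGates_le (hη : 0 < η) (hk : (k η : ℝ) + 1 ≤ 7 * η⁻¹)
    (hA : 1 ≤ (A (ε / 2) (δ / 2) i).outputGates) :
    ((amplification k p τ).convert η A ε δ i).outputGates ≤
      ENNReal.ofReal (1904 * η⁻¹) * (A (ε / 2) (δ / 2) i).outputGates := by
  refine iSup₂_le fun r hr => iSup_le fun h => ?_
  obtain ⟨s, hs, s', hs', rfl⟩ := mem_convert_runs.mp hr
  obtain ⟨h1, h2⟩ := prob_pos_of_mul hs hs' h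
  obtain ⟨-, j, hj⟩ := sampleProg_runs _ _ _ _ s' hs'
  have h3 := gates_le_outputGates hs h1
  have h4 : (s'.output.gates : ENNReal) ≤ (136 * (k η + 1) * (s.output.gates + 1) : ℕ) := by
    rw [hj]
    exact_mod_cast gates_amplified_le _ _ _ _ _
  refine h4.trans ?_
  have h5 : ((136 * (k η + 1) : ℕ) : ENNReal) ≤ ENNReal.ofReal (952 * η⁻¹) := by
    rw [← ENNReal.ofReal_natCast]
    apply ENNReal.ofReal_le_ofReal
    push_cast
    linarith
  have h6 : ENNReal.ofReal (1904 * η⁻¹) = ENNReal.ofReal (952 * η⁻¹) * 2 := by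
    rw [show 1904 * η⁻¹ = 952 * η⁻¹ * 2 by ring, ENNReal.ofReal_mul (by positivity)]
    simp
  rw [h6, Nat.cast_mul, mul_assoc, two_mul (Prog.outputGates _), Nat.cast_add, Nat.cast_one]
  exact mul_le_mul' h5 (add_le_add h3 hA)

/-- The gates executed are those of the given algorithm and those of the tests. Both are compared
with the output, which is at least as large as the given block encoding. -/
theorem convert_isEfficient (hτ : 0 < τ η) (hA : IsEfficient A T) :
    IsEfficient ((amplification k p τ).convert η A) T := by
  obtain ⟨K, hK⟩ := hA
  refine ⟨4 * |K| + (8 / τ η ^ 2 + 1), fun ε δ hε0 hε1 hδ0 hδ1 i y hy => ?_⟩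
  have hK' := hK (ε / 2) (δ / 2) (by linarith) (by linarith) (by linarith) (by linarith) i y hy
  have hl0 : 0 ≤ Real.log δ⁻¹ := Real.log_nonneg ((one_le_inv₀ hδ0).mpr hδ1.le)
  have h1 : K * (ε / 2)⁻¹ * (1 + Real.log (δ / 2)⁻¹) ≤ 4 * |K| * ε⁻¹ * (1 + Real.log δ⁻¹) := by
    have h2 : Real.log (δ / 2)⁻¹ = Real.log 2 + Real.log δ⁻¹ := by
      rw [inv_div, div_eq_mul_inv, Real.log_mul (by norm_num) (by positivity)]
    have h3 := Real.log_two_lt_d9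
    have h4 := Real.log_two_gt_d9
    have h5 : 1 + Real.log (δ / 2)⁻¹ ≤ 2 * (1 + Real.log δ⁻¹) := by linarith
    have h6 : 0 ≤ 1 + Real.log (δ / 2)⁻¹ := by linarith
    calc K * (ε / 2)⁻¹ * (1 + Real.log (δ / 2)⁻¹)
        ≤ |K| * (ε / 2)⁻¹ * (2 * (1 + Real.log δ⁻¹)) := by
          gcongr
          exact le_abs_self K
      _ = _ := by rw [inv_div]; field_simp; ring
  refine le_trans ?_ (mul_le_mul_right (outputGates_le_convert (k := k) (p := p) (τ := τ) (η := η)) _)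
  refine iSup₂_le fun r hr => iSup_le fun h => ?_
  obtain ⟨s, hs, s', hs', rfl⟩ := mem_convert_runs.mp hr
  obtain ⟨hp1, hp2⟩ := prob_pos_of_mul hs hs' h
  obtain ⟨hg, -⟩ := sampleProg_runs _ _ _ _ s' hs'
  have hG := gates_le_outputGates hs hp1
  have e1 : (s.gates : ENNReal) ≤
      ENNReal.ofReal (4 * |K| * ε⁻¹ * (1 + Real.log δ⁻¹)) * (A (ε / 2) (δ / 2) i).outputGates := by
    have : (s.gates : ENNReal) ≤ (A (ε / 2) (δ / 2) i).worstGates :=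
      le_iSup₂_of_le s hs (le_iSup_of_le hp1 le_rfl)
    refine (this.trans hK').trans ?_
    gcongr
  have e2 : (s'.gates : ENNReal) ≤ ENNReal.ofReal ((8 / τ η ^ 2 + 1) * ε⁻¹ * (1 + Real.log δ⁻¹)) *
      (A (ε / 2) (δ / 2) i).outputGates := by
    have h2 : (s'.gates : ENNReal) ≤ (numSamples (τ η) ε δ : ENNReal) * s.output.gates := by
      exact_mod_cast hg
    refine h2.trans ?_
    gcongr
    rw [← ENNReal.ofReal_natCast]
    exact ENNReal.ofReal_le_ofReal (numSamples_le hτ hε0 hε1 hδ0 hδ1)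
  push_cast
  refine (add_le_add e1 e2).trans (le_of_eq ?_)
  rw [← add_mul, ← ENNReal.ofReal_add (by positivity) (by positivity)]
  congr 2
  ring

/-- The given algorithm and the estimate fail with probability at most `δ / 2` each. -/
theorem convert_isConstructiveEncoding (hη : 0 < η) (hp0 : 0 < p η) (hp : p η ≤ η ^ 2 / 2)
    (hτ0 : 0 < τ η) (hτ : τ η ≤ η ^ 2 / 16) (hτ1 : τ η ≤ 1)
    (hl : 2 / 3 ≤ √(p η) * |(amp (k η)).1.eval (p η)|)
    (hflat : ∀ x ∈ Set.Icc (0 : ℝ) 1,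
      8 * τ η ^ 2 * |(amp (k η)).1.eval x - (amp (k η)).1.eval (p η)| ≤
        |(amp (k η)).1.eval (p η)| * (x - p η) ^ 2)
    (hA : IsConstructiveEncoding A T η) :
    IsConstructiveEncoding ((amplification k p τ).convert η A) T (1 / 4) := by
  intro ε δ hε0 hε1 hδ0 hδ1 i y hy
  have h1 := hA (ε / 2) (δ / 2) (by linarith) (by linarith) (by linarith) (by linarith) i y hy
  have h2 : (1 - δ / 2) * (A (ε / 2) (δ / 2) i).prob
      (fun B => B.Encodes y (ε / 2) ∧ η ≤ B.efficiency) ≤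
      ((amplification k p τ).convert η A ε δ i).prob
        fun B => B.Encodes y ε ∧ 1 / 4 ≤ B.efficiency := by
    refine Prog.le_prob_bind _ _ fun B hB => ?_
    rw [Prog.prob_eq_expect, amplification, sampleProg_expect hB.1, normSq_bits_zero, one_mul]
    have he0 : 0 ≤ B.efficiency := hη.le.trans hB.2
    have he1 : B.efficiency ^ 2 ≤ 1 := pow_le_one₀ he0 hB.1.efficiency_le_one
    have hsε : √ε ≤ 1 := Real.sqrt_le_one.mpr hε1.le
    have h3 := trials_deviation (sq_nonneg B.efficiency) he1
      (τ := τ η * √ε) (by positivity) (mul_le_one₀ hτ1 (Real.sqrt_nonneg _) hsε)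
      _ (numSamples_pos hτ0 hε0 hδ0 hδ1)
    refine le_trans ?_ (h3.trans (trials_mono (sq_nonneg _) he1 (fun j => ?_) _ _))
    · linarith [exp_numSamples_le hτ0 hε0 hδ0]
    · split_ifs with h4 h5 h6
      · exact le_rfl
      · exact absurd (output_spec hε0 hε1 hB.1 hη hB.2 hp0 hp hτ0 hτ hl hflat h4) h5
      · exact zero_le_one
      · exact le_rfl
  have h3 := mul_le_mul_of_nonneg_left h1 (show 0 ≤ 1 - δ / 2 by linarith)
  nlinarith

end

/-- The parameters, as functions of the lower bound `η` for the efficiency. -/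
theorem exists_param_functions : ∃ (k : ℝ → ℕ) (p τ : ℝ → ℝ), ∀ η, 0 < η → η ≤ 1 →
    (k η : ℝ) + 1 ≤ 7 * η⁻¹ ∧ 0 < p η ∧ p η ≤ η ^ 2 / 2 ∧ 0 < τ η ∧ τ η ≤ η ^ 2 / 16 ∧
      2 / 3 ≤ √(p η) * |(amp (k η)).1.eval (p η)| ∧
      ∀ x ∈ Set.Icc (0 : ℝ) 1,
        8 * τ η ^ 2 * |(amp (k η)).1.eval x - (amp (k η)).1.eval (p η)| ≤
          |(amp (k η)).1.eval (p η)| * (x - p η) ^ 2 := by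
  have h : ∀ η : ℝ, ∃ (k : ℕ) (p τ : ℝ), 0 < η → η ≤ 1 →
      (k : ℝ) + 1 ≤ 7 * η⁻¹ ∧ 0 < p ∧ p ≤ η ^ 2 / 2 ∧ 0 < τ ∧ τ ≤ η ^ 2 / 16 ∧
      2 / 3 ≤ √p * |(amp k).1.eval p| ∧
      ∀ x ∈ Set.Icc (0 : ℝ) 1, 8 * τ ^ 2 * |(amp k).1.eval x - (amp k).1.eval p| ≤
        |(amp k).1.eval p| * (x - p) ^ 2 := by
    intro η
    by_cases h : 0 < η ∧ η ≤ 1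
    · obtain ⟨k, p, τ, h'⟩ := exists_params η h.1 h.2
      exact ⟨k, p, τ, fun _ _ => h'⟩
    · exact ⟨0, 0, 0, fun h0 h1 => absurd ⟨h0, h1⟩ h⟩
  choose k p τ h using h
  exact ⟨k, p, τ, h⟩

/-- The amplification of constructive encodings, for an arbitrary encoding task. -/
theorem exists_routine : ∃ R : Routine, ∀ (I : Type) (N : ℕ) (T : EncTask I N)
    (A : Algorithm I N) (η : ℝ), 0 < η → IsEfficient A T → IsConstructiveEncoding A T η →
      IsEfficient (R.convert η A) T ∧ IsConstructiveEncoding (R.convert η A) T (1 / 4) ∧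
      ∀ ε δ : ℝ, 0 < ε → ε < 1 → 0 < δ → δ < 1 → ∀ i y, T.Target i y →
        complexity (R.convert η A) T ε δ i ≤
          ENNReal.ofReal (1904 * η⁻¹) * complexity A T (ε / 2) (δ / 2) i := by
  obtain ⟨k, p, τ, h⟩ := exists_param_functions
  refine ⟨amplification k p τ, fun I N T A η hη hE hA => ?_⟩
  by_cases hT : ∃ i y, T.Target i y
  · obtain ⟨i, y, hy⟩ := hT
    -- the existence of an admissible input forces `η ≤ 1`, so that the parameters are good
    have hη1 : η ≤ 1 := (hA.exists_valid (ε := 1 / 2) (δ := 1 / 2) (by norm_num) (by norm_num)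
      (by norm_num) (by norm_num) hy).1
    obtain ⟨hk, hp0, hp, hτ0, hτ, hl, hflat⟩ := h η hη hη1
    refine ⟨convert_isEfficient hτ0 hE,
      convert_isConstructiveEncoding hη hp0 hp hτ0 hτ (by nlinarith) hl hflat hA,
      fun ε δ hε0 hε1 hδ0 hδ1 i y hy => ?_⟩
    have h1 := (hA.exists_valid (ε := ε / 2) (δ := δ / 2) (by linarith) (by linarith)
      (by linarith) (by linarith) hy).2
    rw [complexity, complexity, ← mul_div_assoc]
    exact ENNReal.div_le_div_right (convert_outputGates_le hη hk h1) _
  · push Not at hT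
    exact ⟨⟨0, fun _ _ _ _ _ _ i y hy => absurd hy (hT i y)⟩,
      fun _ _ _ _ _ _ i y hy => absurd hy (hT i y),
      fun _ _ _ _ _ _ i y hy => absurd hy (hT i y)⟩

end QEnc

theorem corollary2p8 :
    ∃ Cie : ℝ, 1 / 4 ≤ Cie ∧ Cie ≤ 1 ∧ ∃ (R : QEnc.Routine) (C : ℝ),
      -- encodings of a vector
      (∀ (N : ℕ) (v : EuclideanSpace ℂ (Fin N)) (A : QEnc.Algorithm Unit N) (ηmin : ℝ),
        0 < ηmin →
        QEnc.IsEfficient A (QEnc.vectorTask v) →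
        QEnc.IsConstructiveEncoding A (QEnc.vectorTask v) ηmin →
          QEnc.IsEfficient (R.convert ηmin A) (QEnc.vectorTask v) ∧
          QEnc.IsConstructiveEncoding (R.convert ηmin A) (QEnc.vectorTask v) Cie ∧
          ∀ ε δ : ℝ, 0 < ε → ε < 1 → 0 < δ → δ < 1 →
            QEnc.complexity (R.convert ηmin A) (QEnc.vectorTask v) ε δ () ≤
              ENNReal.ofReal (C * ηmin⁻¹) *
                QEnc.complexity A (QEnc.vectorTask v) (ε / 2) (δ / 2) ()) ∧
      -- encodings of a vector-valued function
      (∀ (M N : ℕ) (f : EuclideanSpace ℂ (Fin M) → EuclideanSpace ℂ (Fin N))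
        (A : QEnc.Algorithm (QEnc.BlockEncoding M) N) (ηmin : ℝ),
        0 < ηmin →
        QEnc.IsEfficient A (QEnc.functionTask Cie f) →
        QEnc.IsConstructiveEncoding A (QEnc.functionTask Cie f) ηmin →
          QEnc.IsEfficient (R.convert ηmin A) (QEnc.functionTask Cie f) ∧
          QEnc.IsConstructiveEncoding (R.convert ηmin A) (QEnc.functionTask Cie f) Cie ∧
          ∀ ε δ : ℝ, 0 < ε → ε < 1 → 0 < δ → δ < 1 →
            ∀ (x : EuclideanSpace ℂ (Fin M)) (Ux : QEnc.BlockEncoding M),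
              Ux.Encodes x 0 → Cie ≤ Ux.efficiency →
              QEnc.complexity (R.convert ηmin A) (QEnc.functionTask Cie f) ε δ Ux ≤
                ENNReal.ofReal (C * ηmin⁻¹) *
                  QEnc.complexity A (QEnc.functionTask Cie f) (ε / 2) (δ / 2) Ux) := by
  obtain ⟨R, hR⟩ := QEnc.exists_routine
  refine ⟨1 / 4, le_rfl, by norm_num, R, 1904, fun N v A η hη hE hA => ?_,
    fun M N f A η hη hE hA => ?_⟩
  · obtain ⟨h1, h2, h3⟩ := hR Unit N (QEnc.vectorTask v) A η hη hE hA
    exact ⟨h1, h2, fun ε δ hε0 hε1 hδ0 hδ1 => h3 ε δ hε0 hε1 hδ0 hδ1 () v rfl⟩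
  · obtain ⟨h1, h2, h3⟩ := hR _ N (QEnc.functionTask (1 / 4) f) A η hη hE hA
    exact ⟨h1, h2, fun ε δ hε0 hε1 hδ0 hδ1 x Ux hUx he =>
      h3 ε δ hε0 hε1 hδ0 hδ1 Ux (f x) ⟨x, hUx, he, rfl⟩⟩
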